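/- Let $\Omega \subset \mathbb{R}^n$, $n \ge 2$, be a bounded open set with $C^\infty$ boundary, with outer unit normal $\nu$ and normal derivative $\partial_\nu f = \nabla f\cdot\nu$ on $\partial\Omega$. Let $C^\infty(\overline\Omega)$ denote the set of restrictions to $\overline\Omega$ of smooth functions on $\mathbb{R}^n$. Let $\varphi(x) = \alpha\cdot x$ where $\alpha \in \mathbb{R}^n$ is a unit vector, let $\kappa \in C^\infty(\overline\Omega)$ be real valued with $\partial_\nu\kappa = -1$ on $\partial\Omega$, and let $q \in L^\infty(\Omega)$ be complex valued. Write $D = -i\nabla$, $(hD)^2 = -h^2\Delta$, $\|\cdot\| = \|\cdot\|_{L^2(\Omega)}$, and let $dS$ be the surface measure on $\partial\Omega$. For a real valued $\psi \in C^\infty(\overline\Omega)$ put $\partial\Omega_\pm(\psi) = \{x\in\partial\Omega : \pm\partial_\nu\psi(x) > 0\}$. Then there are constants $\varepsilon, C_0, h_0 > 0$ with $h_0 \le \varepsilon \le 1$ such that for every $0 < h \le h_0$, with the weight $$\varphi_\varepsilon = \varphi + \frac{h}{\varepsilon}\,\frac{\varphi^2}{2} + h\kappa ,$$ one has $$\frac{h^3}{C_0}\int_{\partial\Omega_-(\varphi_\varepsilon)}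 |\partial_\nu\varphi_\varepsilon|\,|\partial_\nu u|^2\,dS + \frac{h^2}{C_0}\left(\|u\|^2 + \|hDu\|^2\right) \le \left\|e^{\varphi/h}\left((hD)^2 + h^2 q\right)\left(e^{-\varphi/h}u\right)\right\|^2 + h^3\int_{\partial\Omega_+(\varphi_\varepsilon)} |\partial_\nu\varphi_\varepsilon|\,|\partial_\nu u|^2\,dS$$ for all complex valued $u \in C^\infty(\overline\Omega)$ with $u|_{\partial\Omega} = 0$. -/

import Mathlib

open MeasureTheory Set Filter Topology
open scoped ContDiff MeasureTheory Gradient RealInnerProductSpace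

noncomputable section

namespace CarlemanBoundary

variable {n : ℕ}

/-! ### Domains with smooth boundary -/

/-- `ρ` is a smooth local defining function of the set `Ω` at the point `p`: near `p` the set `Ω`
is `{ρ < 0}`, the function `ρ` vanishes at `p`, and its gradient at `p` is nonzero. -/
structure IsDefiningFunctionAt (Ω : Set (EuclideanSpace ℝ (Fin n)))
    (p : EuclideanSpace ℝ (Fin n)) (ρ : EuclideanSpace ℝ (Fin n) → ℝ) : Prop where
  smooth : ContDiff ℝ ∞ ρ
  zero : ρ p = 0
  gradient_ne_zero : ∇ ρ p ≠ 0
  mem_iff : ∀ᶠ x in 𝓝 p, x ∈ Ω ↔ ρ x < 0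

/-- `Ω` has `C^∞` boundary: at each of its boundary points it has a smooth local defining
function (so `∂Ω` is a smooth hypersurface and `Ω` lies locally on one side of it). -/
def HasSmoothBoundary (Ω : Set (EuclideanSpace ℝ (Fin n))) : Prop :=
  ∀ p ∈ frontier Ω, ∃ ρ, IsDefiningFunctionAt Ω p ρ

/-- `v` is the outer unit normal of `Ω` at `p`: the normalized gradient of a local defining
function. -/
def IsOuterUnitNormal (Ω : Set (EuclideanSpace ℝ (Fin n)))
    (p v : EuclideanSpace ℝ (Fin n)) : Prop :=
  ∃ ρ, IsDefiningFunctionAt Ω p ρ ∧ v = ‖∇ ρ p‖⁻¹ • ∇ ρ p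

open Classical in
/-- The outer unit normal field `ν` of `Ω` (with the value `0` at points where `Ω` has no local
defining function, in particular off the boundary). -/
def outerNormal (Ω : Set (EuclideanSpace ℝ (Fin n))) (p : EuclideanSpace ℝ (Fin n)) :
    EuclideanSpace ℝ (Fin n) :=
  if h : ∃ v, IsOuterUnitNormal Ω p v then h.choose else 0

theorem IsDefiningFunctionAt.eventually_line {Ω : Set (EuclideanSpace ℝ (Fin n))}
    {p : EuclideanSpace ℝ (Fin n)} {ρ : EuclideanSpace ℝ (Fin n) → ℝ}
    (hρ : IsDefiningFunctionAt Ω p ρ) (w : EuclideanSpace ℝ (Fin n)) :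
    (⟪∇ ρ p, w⟫ < 0 → ∀ᶠ t : ℝ in 𝓝[>] 0, p + t • w ∈ Ω) ∧
      (0 < ⟪∇ ρ p, w⟫ → ∀ᶠ t : ℝ in 𝓝[>] 0, p + t • w ∉ Ω) := by
  have hd : DifferentiableAt ℝ ρ p := (hρ.smooth.differentiable (by simp)) p
  have hl : HasDerivAt (fun t : ℝ => p + t • w) w 0 := by
    simpa using ((hasDerivAt_id (0 : ℝ)).smul_const w).const_add p
  have hg : HasDerivAt (fun t : ℝ => ρ (p + t • w)) ⟪∇ ρ p, w⟫ 0 := by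
    have h1 : HasFDerivAt ρ (fderiv ℝ ρ p) (p + (0 : ℝ) • w) := by
      simpa using hd.hasFDerivAt
    have h2 := h1.comp_hasDerivAt (0 : ℝ) hl
    have h3 : fderiv ℝ ρ p w = ⟪∇ ρ p, w⟫ := by
      rw [gradient, InnerProductSpace.toDual_symm_apply]
    rw [h3] at h2
    exact h2
  have hs := hg.tendsto_slope_zero_right
  have hc : Tendsto (fun t : ℝ => p + t • w) (𝓝[>] 0) (𝓝 p) := by
    have : Tendsto (fun t : ℝ => p + t • w) (𝓝 0) (𝓝 (p + (0 : ℝ) • w)) :=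
      hl.continuousAt.tendsto
    simp only [zero_smul, add_zero] at this
    exact this.mono_left nhdsWithin_le_nhds
  have hm := hc.eventually hρ.mem_iff
  simp only [zero_add, zero_smul, add_zero, hρ.zero, sub_zero, smul_eq_mul] at hs
  refine ⟨fun hneg => ?_, fun hpos => ?_⟩
  · filter_upwards [hm, hs.eventually (gt_mem_nhds hneg), self_mem_nhdsWithin] with t h1 h2 h3
    have h3' : (0 : ℝ) < t⁻¹ := inv_pos.mpr h3
    exact h1.mpr (by nlinarith)
  · filter_upwards [hm, hs.eventually (lt_mem_nhds hpos), self_mem_nhdsWithin] with t h1 h2 h3 h4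
    have h3' : (0 : ℝ) < t⁻¹ := inv_pos.mpr h3
    have := h1.mp h4
    nlinarith

/-- The outer unit normal does not depend on the defining function. -/
theorem IsOuterUnitNormal.unique {Ω : Set (EuclideanSpace ℝ (Fin n))}
    {p v w : EuclideanSpace ℝ (Fin n)} (hv : IsOuterUnitNormal Ω p v)
    (hw : IsOuterUnitNormal Ω p w) : v = w := by
  obtain ⟨ρ, hρ, hv⟩ := hv
  obtain ⟨σ, hσ, hw⟩ := hw
  have hρ0 : 0 < ‖∇ ρ p‖ := norm_pos_iff.mpr hρ.gradient_ne_zero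
  have hσ0 : 0 < ‖∇ σ p‖ := norm_pos_iff.mpr hσ.gradient_ne_zero
  have hv1 : ‖v‖ = 1 := by
    rw [hv, norm_smul, norm_inv, norm_norm, inv_mul_cancel₀ hρ0.ne']
  have hw1 : ‖w‖ = 1 := by
    rw [hw, norm_smul, norm_inv, norm_norm, inv_mul_cancel₀ hσ0.ne']
  have hgv : ∇ ρ p = ‖∇ ρ p‖ • v := by
    rw [hv, smul_smul, mul_inv_cancel₀ hρ0.ne', one_smul]
  have hgw : ∇ σ p = ‖∇ σ p‖ • w := by
    rw [hw, smul_smul, mul_inv_cancel₀ hσ0.ne', one_smul]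
  by_contra hne
  have hlt : ⟪v, w⟫ < 1 := (inner_lt_one_iff_real_of_norm_eq_one hv1 hw1).mpr hne
  have h1 : ⟪∇ ρ p, w - v⟫ < 0 := by
    rw [hgv, real_inner_smul_left, inner_sub_right, real_inner_self_eq_norm_sq, hv1]
    nlinarith
  have h2 : 0 < ⟪∇ σ p, w - v⟫ := by
    rw [hgw, real_inner_smul_left, inner_sub_right, real_inner_self_eq_norm_sq, hw1,
      real_inner_comm]
    nlinarith
  obtain ⟨t, ht1, ht2⟩ :=
    (((hρ.eventually_line _).1 h1).and ((hσ.eventually_line _).2 h2)).exists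
  exact ht2 ht1

theorem IsOuterUnitNormal.outerNormal_eq {Ω : Set (EuclideanSpace ℝ (Fin n))}
    {p v : EuclideanSpace ℝ (Fin n)} (hv : IsOuterUnitNormal Ω p v) : outerNormal Ω p = v := by
  have h : ∃ v, IsOuterUnitNormal Ω p v := ⟨v, hv⟩
  rw [outerNormal, dif_pos h]
  exact h.choose_spec.unique hv

/-- The normal derivative `∂_ν f` of a real or vector valued function at boundary points. -/
def normalDeriv {F : Type*} [NormedAddCommGroup F] [NormedSpace ℝ F]
    (Ω : Set (EuclideanSpace ℝ (Fin n))) (f : EuclideanSpace ℝ (Fin n) → F)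
    (x : EuclideanSpace ℝ (Fin n)) : F :=
  fderiv ℝ f x (outerNormal Ω x)

/-- `∂Ω₊(ψ)`, the part of the boundary where `∂_ν ψ > 0`. -/
def boundaryPlus (Ω : Set (EuclideanSpace ℝ (Fin n))) (ψ : EuclideanSpace ℝ (Fin n) → ℝ) :
    Set (EuclideanSpace ℝ (Fin n)) :=
  {x ∈ frontier Ω | 0 < normalDeriv Ω ψ x}

/-- `∂Ω₋(ψ)`, the part of the boundary where `∂_ν ψ < 0`. -/
def boundaryMinus (Ω : Set (EuclideanSpace ℝ (Fin n))) (ψ : EuclideanSpace ℝ (Fin n) → ℝ) :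
    Set (EuclideanSpace ℝ (Fin n)) :=
  {x ∈ frontier Ω | normalDeriv Ω ψ x < 0}

/-- The surface measure of hypersurfaces in `ℝⁿ`: the `(n-1)`-dimensional Hausdorff measure,
normalized so that it agrees with Lebesgue measure on hyperplanes. -/
def surfaceMeasure (n : ℕ) : Measure (EuclideanSpace ℝ (Fin n)) := μHE[n - 1]

/-- The weighted boundary form `(|∂_ν ψ| ∂_ν u, ∂_ν u)_{L²(Γ)}` for a part `Γ` of `∂Ω`. -/
def boundaryForm (Ω Γ : Set (EuclideanSpace ℝ (Fin n))) (ψ : EuclideanSpace ℝ (Fin n) → ℝ)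
    (u : EuclideanSpace ℝ (Fin n) → ℂ) : ℝ :=
  ∫ x in Γ, |normalDeriv Ω ψ x| * ‖normalDeriv Ω u x‖ ^ 2 ∂(surfaceMeasure n)

/-! ### Semiclassical operators and norms -/

/-- The squared norm `‖u‖²` of `L²(Ω)`. -/
def normSqL2 (Ω : Set (EuclideanSpace ℝ (Fin n))) (u : EuclideanSpace ℝ (Fin n) → ℂ) : ℝ :=
  ∫ x in Ω, ‖u x‖ ^ 2

/-- The `j`-th component `hD_j = -i h ∂_j` of the semiclassical derivative `hD`, `D = -i∇`. -/
def semiD (h : ℝ) (j : Fin n) (u : EuclideanSpace ℝ (Fin n) → ℂ) :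
    EuclideanSpace ℝ (Fin n) → ℂ :=
  fun x => -Complex.I * (h : ℂ) * fderiv ℝ u x (EuclideanSpace.single j 1)

/-- `(hD)² u = ∑_j (hD_j)(hD_j u)`, that is, `-h² Δ u`. -/
def semiDSq (h : ℝ) (u : EuclideanSpace ℝ (Fin n) → ℂ) : EuclideanSpace ℝ (Fin n) → ℂ :=
  fun x => ∑ j, semiD h j (semiD h j u) x

/-- The conjugated Schrödinger operator `e^{φ/h} ((hD)² + h² q) (e^{-φ/h} u)`. -/
def conjugatedOp (h : ℝ) (φ : EuclideanSpace ℝ (Fin n) → ℝ) (q u : EuclideanSpace ℝ (Fin n) → ℂ) :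
    EuclideanSpace ℝ (Fin n) → ℂ :=
  let v : EuclideanSpace ℝ (Fin n) → ℂ := fun y => (Real.exp (-φ y / h) : ℂ) * u y
  fun x => (Real.exp (φ x / h) : ℂ) * (semiDSq h v x + (h : ℂ) ^ 2 * q x * v x)

/-- The linear weight `φ(x) = α · x`. -/
def linearWeight (α : EuclideanSpace ℝ (Fin n)) (x : EuclideanSpace ℝ (Fin n)) : ℝ := ⟪α, x⟫

/-- The convexified weight `φ_ε = φ + (h/ε) φ²/2 + h κ` for the linear weight `φ(x) = α · x`. -/
def convexifiedWeight (α : EuclideanSpace ℝ (Fin n)) (κ : EuclideanSpace ℝ (Fin n) → ℝ)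
    (ε h : ℝ) (x : EuclideanSpace ℝ (Fin n)) : ℝ :=
  linearWeight α x + h / ε * (linearWeight α x ^ 2 / 2) + h * κ x

end CarlemanBoundary

end

/-!
# Carleman estimate with boundary terms for a linear weight

Put `ψ = φ_ε = φ + h g` with `g = φ² / (2ε) + κ`, and let `w = e^g u`. Then
`e^{φ/h} ((hD)² + h² q) e^{-φ/h} u = e^{-g} (A + B + h² q) w`, where
`A = -h²Δ - |∇ψ|²` and `B = 2h∇ψ·∇ + hΔψ` are the symmetric and antisymmetric parts of
`e^{ψ/h} (hD)² e^{-ψ/h}` (`conjugatedOp_eq`). Both have real coefficients, so the real and imaginary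
parts of `w` are treated separately. For a real function `v` that vanishes on `∂Ω`, integration by
parts gives (`integral_symPart_mul_skewPart`)
`2 (Av, Bv) = ∫ 4h³ ψ''(∇v, ∇v) + 4h ψ''(∇ψ, ∇ψ) v² - h³ Δ²ψ v² - 2h³ ∫_{∂Ω} ∂_νψ (∂_ν v)²`.
The convexification makes `4h ψ''(∇ψ, ∇ψ)` at least `h²/ε - O(h²)`, while
`4h³ ψ''(∇v, ∇v) ≥ -O(h⁴) |∇v|²`. The latter loss is absorbed by `‖Av‖²`, since
`(Av, v) = h² ‖∇v‖² - ∫ |∇ψ|² v²` controls the gradient at the price of another `O(h²) ‖v‖²`, and all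
errors `O(h²) ‖v‖²`, the one from the potential included, are absorbed by `h²/ε` for small `ε`
(`carleman_real`, `exists_carleman_real`). With `ε` fixed, `e^{±g}` is bounded, and returning from
`w` to `u` changes constants only.

The integrations by parts need the divergence theorem on `Ω`. The boundary integrals over `∂Ω₊` and
`∂Ω₋` are estimated separately and up to constants, so it is enough to have it with some boundary
measure `σ` for which `σ` and the surface measure bound each other up to a constant
(`exists_boundaryMeasure`, `boundary_comparison`); the area formula is not needed. Locally
`Ω = {ρ < 0}` with `∂_k ρ ≠ 0`. For the direction `k` the divergence theorem is Fubini and the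
fundamental theorem of calculus on the coordinate lines, and it yields Lebesgue measure of the
projection of `∂Ω` along `x_k`. This is comparable to Hausdorff measure, because the projection is
Lipschitz and so is its inverse on `∂Ω`. Any other direction `j` is reduced to `k` by
`∫_Ω ∂_j (b ∂_k ρ) = ∫_Ω ∂_k (b ∂_j ρ)` (`setIntegral_dirDeriv_swap`), which holds because
`∂_k ρ ∂_j - ∂_j ρ ∂_k` is tangent to the level sets of `ρ`.
-/

noncomputable section

namespace CarlemanBoundary

/-! ### Directional derivatives and the tangential identity -/

section DirDeriv

variable {E : Type*} [NormedAddCommGroup E] [NormedSpace ℝ E]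

/-- The derivative `∂_v f` of a real valued function in the fixed direction `v`, as a function. -/
def dirDeriv (v : E) (f : E → ℝ) : E → ℝ := fun x => fderiv ℝ f x v

theorem dirDeriv_contDiff {f : E → ℝ} {k l : WithTop ℕ∞} (hf : ContDiff ℝ l f) (hkl : k + 1 ≤ l)
    (v : E) : ContDiff ℝ k (dirDeriv v f) :=
  (hf.fderiv_right hkl).clm_apply contDiff_const

theorem dirDeriv_smooth {f : E → ℝ} (hf : ContDiff ℝ ∞ f) (v : E) :
    ContDiff ℝ ∞ (dirDeriv v f) :=
  dirDeriv_contDiff hf (by simp) v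

theorem dirDeriv_continuous {f : E → ℝ} (hf : ContDiff ℝ 1 f) (v : E) :
    Continuous (dirDeriv v f) :=
  (dirDeriv_contDiff (k := 0) hf (by simp) v).continuous

theorem dirDeriv_mul {f g : E → ℝ} {x : E} (hf : DifferentiableAt ℝ f x)
    (hg : DifferentiableAt ℝ g x) (v : E) :
    dirDeriv v (fun y => f y * g y) x = dirDeriv v f x * g x + f x * dirDeriv v g x := by
  simp only [dirDeriv, fderiv_fun_mul hf hg]
  simp
  ring

theorem dirDeriv_add {f g : E → ℝ} {x : E} (hf : DifferentiableAt ℝ f x)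
    (hg : DifferentiableAt ℝ g x) (v : E) :
    dirDeriv v (fun y => f y + g y) x = dirDeriv v f x + dirDeriv v g x := by
  simp [dirDeriv, fderiv_fun_add hf hg]

theorem dirDeriv_sum {ι : Type*} (s : Finset ι) {f : ι → E → ℝ} {x : E}
    (hf : ∀ i ∈ s, DifferentiableAt ℝ (f i) x) (v : E) :
    dirDeriv v (fun y => ∑ i ∈ s, f i y) x = ∑ i ∈ s, dirDeriv v (f i) x := by
  simp [dirDeriv, fderiv_fun_sum hf]

theorem dirDeriv_comp {f : E → ℝ} {φ : ℝ → ℝ} {x : E} (hf : DifferentiableAt ℝ f x)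
    (hφ : DifferentiableAt ℝ φ (f x)) (v : E) :
    dirDeriv v (fun y => φ (f y)) x = deriv φ (f x) * dirDeriv v f x := by
  have h := (hφ.hasDerivAt.comp_hasFDerivAt x hf.hasFDerivAt).fderiv
  have h' : fderiv ℝ (fun y => φ (f y)) x = deriv φ (f x) • fderiv ℝ f x := h
  simp [dirDeriv, h']

theorem dirDeriv_comm {f : E → ℝ} (hf : ContDiff ℝ ∞ f) (v w : E) (x : E) :
    dirDeriv v (dirDeriv w f) x = dirDeriv w (dirDeriv v f) x := by
  have h2 : ∀ y, HasFDerivAt f (fderiv ℝ f y) y := fun y =>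
    (hf.differentiable (by simp) y).hasFDerivAt
  have hd : Differentiable ℝ (fderiv ℝ f) :=
    (hf.fderiv_right (m := 1) (by norm_cast)).differentiable (by simp)
  have key : ∀ a b : E, dirDeriv a (dirDeriv b f) x = fderiv ℝ (fderiv ℝ f) x a b := by
    intro a b
    change fderiv ℝ (fun y => fderiv ℝ f y b) x a = _
    rw [fderiv_clm_apply (hd x) (differentiableAt_const b)]
    simp
  rw [key, key]
  exact second_derivative_symmetric h2 (hd x).hasFDerivAt v w

theorem dirDeriv_hasCompactSupport {f : E → ℝ} (hf : HasCompactSupport f) (v : E) :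
    HasCompactSupport (dirDeriv v f) :=
  hf.fderiv_apply ℝ v

theorem dirDeriv_eq_zero_of_notMem_tsupport {f : E → ℝ} {x : E} (hx : x ∉ tsupport f) (v : E) :
    dirDeriv v f x = 0 := by
  have := image_eq_zero_of_notMem_tsupport
    (fun h => hx (tsupport_fderiv_subset ℝ h) : x ∉ tsupport (fderiv ℝ f))
  simp [dirDeriv, this]

variable [FiniteDimensional ℝ E] [MeasurableSpace E] [BorelSpace E] {μ : Measure E}
  [μ.IsAddHaarMeasure]

theorem integral_dirDeriv_eq_zero {f : E → ℝ} (hf : ContDiff ℝ 1 f) (hc : HasCompactSupport f)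
    (v : E) : ∫ x, dirDeriv v f x ∂μ = 0 := by
  have h := integral_mul_fderiv_eq_neg_fderiv_mul_of_integrable (μ := μ) (𝕜 := ℝ)
    (f := fun _ : E => (1 : ℝ)) (g := f) (v := v) (by simp)
    (by simp only [one_mul]
        exact (dirDeriv_continuous hf v).integrable_of_hasCompactSupport
          (dirDeriv_hasCompactSupport hc v))
    (by simpa using hf.continuous.integrable_of_hasCompactSupport hc)
    (fun x _ => differentiableAt_const _) (fun x _ => hf.differentiable (by simp) x)
  simpa [dirDeriv] using h

/-- The field `w ∂_v - v ∂_w` weighted by the derivatives of `ρ` is tangent to the level sets of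
`ρ`, so its divergence over `{ρ < 0}` produces no boundary term. This is what allows an arbitrary
partial derivative to be traded for the derivative in a direction transversal to the boundary. -/
theorem setIntegral_dirDeriv_swap {Ω : Set E} (hΩ : MeasurableSet Ω) {ρ b : E → ℝ}
    (hρ : ContDiff ℝ ∞ ρ) (hb : ContDiff ℝ 1 b) (hbc : HasCompactSupport b)
    (hU : ∀ x ∈ tsupport b, x ∈ Ω ↔ ρ x < 0) (v w : E) :
    ∫ x in Ω, dirDeriv v (fun y => b y * dirDeriv w ρ y) x ∂μ =
      ∫ x in Ω, dirDeriv w (fun y => b y * dirDeriv v ρ y) x ∂μ := by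
  have hbd : Differentiable ℝ b := hb.differentiable (by simp)
  have hρ' : ∀ a : E, ContDiff ℝ 1 (dirDeriv a ρ) := fun a =>
    (dirDeriv_smooth hρ a).of_le (by norm_cast)
  have hρ'd : ∀ a : E, Differentiable ℝ (dirDeriv a ρ) := fun a =>
    (hρ' a).differentiable (by simp)
  set J : E → ℝ := fun x => dirDeriv v b x * dirDeriv w ρ x - dirDeriv w b x * dirDeriv v ρ x
    with hJ
  have hJc : Continuous J := ((dirDeriv_continuous hb v).mul (hρ' w).continuous).sub
    ((dirDeriv_continuous hb w).mul (hρ' v).continuous)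
  have hJs : ∀ x, x ∉ tsupport b → J x = 0 := fun x hx => by
    simp [hJ, dirDeriv_eq_zero_of_notMem_tsupport hx]
  have hJcs : HasCompactSupport J := HasCompactSupport.intro hbc hJs
  have hJi : Integrable J μ := hJc.integrable_of_hasCompactSupport hJcs
  have hcomp : ∀ c : E, HasCompactSupport (fun y => b y * dirDeriv c ρ y) := fun c =>
    hbc.mul_right
  have hint : ∀ a c : E, Integrable (dirDeriv a (fun y => b y * dirDeriv c ρ y)) μ := fun a c =>
    (dirDeriv_continuous (hb.mul (hρ' c)) a).integrable_of_hasCompactSupport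
      (dirDeriv_hasCompactSupport (hcomp c) a)
  rw [← sub_eq_zero, ← integral_sub (hint v w).integrableOn (hint w v).integrableOn]
  have hJeq : ∀ x, dirDeriv v (fun y => b y * dirDeriv w ρ y) x
      - dirDeriv w (fun y => b y * dirDeriv v ρ y) x = J x := fun x => by
    rw [dirDeriv_mul (hbd x) (hρ'd w x), dirDeriv_mul (hbd x) (hρ'd v x), dirDeriv_comm hρ v w x]
    simp only [hJ]
    ring
  simp only [hJeq]
  -- smooth cutoffs increasing to the indicator of `{ρ < 0}`
  set H : ℕ → E → ℝ := fun m x => Real.smoothTransition (-(m : ℝ) * ρ x) with hH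
  have hst : ContDiff ℝ 1 Real.smoothTransition := Real.smoothTransition.contDiff (n := 1)
  have hHs : ∀ m, ContDiff ℝ 1 (H m) := fun m =>
    hst.comp (contDiff_const.mul (hρ.of_le (by norm_cast)))
  have hzero : ∀ m, ∫ x, H m x * J x ∂μ = 0 := by
    intro m
    have hbH : ContDiff ℝ 1 (fun y => b y * H m y) := hb.mul (hHs m)
    have hbHd : Differentiable ℝ (fun y => b y * H m y) := hbH.differentiable (by simp)
    have hA : ∀ c : E, ContDiff ℝ 1 (fun y => b y * H m y * dirDeriv c ρ y) := fun c =>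
      hbH.mul (hρ' c)
    have hAc : ∀ c : E, HasCompactSupport (fun y => b y * H m y * dirDeriv c ρ y) := fun c =>
      (hbc.mul_right (f' := H m)).mul_right
    have hdH : ∀ a x, dirDeriv a (H m) x =
        deriv Real.smoothTransition (-(m : ℝ) * ρ x) * (-(m : ℝ) * dirDeriv a ρ x) := by
      intro a x
      have h1 : DifferentiableAt ℝ (fun y => -(m : ℝ) * ρ y) x :=
        (hρ.differentiable (by simp) x).const_mul _
      have := dirDeriv_comp h1 (hst.differentiable (by simp) (-(m : ℝ) * ρ x)) a
      rw [hH]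
      refine this.trans ?_
      congr 1
      simp [dirDeriv, fderiv_const_mul (hρ.differentiable (by simp) x)]
    have : ∀ x, H m x * J x = dirDeriv v (fun y => b y * H m y * dirDeriv w ρ y) x
        - dirDeriv w (fun y => b y * H m y * dirDeriv v ρ y) x := by
      intro x
      have hHd := (hHs m).differentiable (by simp) x
      rw [dirDeriv_mul (hbHd x) (hρ'd w x), dirDeriv_mul (hbHd x) (hρ'd v x),
        dirDeriv_mul (hbd x) hHd, dirDeriv_mul (hbd x) hHd, dirDeriv_comm hρ v w x, hdH, hdH]
      simp only [hJ]
      ring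
    simp only [this]
    rw [integral_sub, integral_dirDeriv_eq_zero (hA w) (hAc w),
      integral_dirDeriv_eq_zero (hA v) (hAc v), sub_zero]
    · exact (dirDeriv_continuous (hA w) v).integrable_of_hasCompactSupport
        (dirDeriv_hasCompactSupport (hAc w) v)
    · exact (dirDeriv_continuous (hA v) w).integrable_of_hasCompactSupport
        (dirDeriv_hasCompactSupport (hAc v) w)
  have hlim : Tendsto (fun m => ∫ x, H m x * J x ∂μ) atTop (𝓝 (∫ x, Ω.indicator J x ∂μ)) := by
    refine tendsto_integral_of_dominated_convergence (fun x => ‖J x‖)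
      (fun m => ((hHs m).continuous.mul hJc).aestronglyMeasurable) hJi.norm
      (fun m => Eventually.of_forall fun x => ?_) (Eventually.of_forall fun x => ?_)
    · rw [norm_mul]
      refine mul_le_of_le_one_left (norm_nonneg _) ?_
      rw [Real.norm_eq_abs, abs_of_nonneg (Real.smoothTransition.nonneg _)]
      exact Real.smoothTransition.le_one _
    · by_cases hx : x ∈ tsupport b
      · by_cases hxΩ : x ∈ Ω
        · have hneg := (hU x hx).1 hxΩ
          rw [indicator_of_mem hxΩ]
          obtain ⟨M, hM⟩ := exists_nat_ge (1 / (-ρ x))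
          refine tendsto_const_nhds.congr' ?_
          filter_upwards [eventually_ge_atTop M] with m hm
          have : 1 ≤ -(m : ℝ) * ρ x := by
            have h1 : 1 / (-ρ x) ≤ m := hM.trans (by exact_mod_cast hm)
            rw [div_le_iff₀ (by linarith)] at h1
            linarith
          simp only [hH, Real.smoothTransition.one_of_one_le this, one_mul]
        · have hnn : 0 ≤ ρ x := not_lt.1 fun h => hxΩ ((hU x hx).2 h)
          rw [indicator_of_notMem hxΩ]
          refine tendsto_const_nhds.congr fun m => ?_
          have : -(m : ℝ) * ρ x ≤ 0 := by
            have := mul_nonneg (Nat.cast_nonneg (α := ℝ) m) hnn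
            linarith
          simp only [hH, Real.smoothTransition.zero_of_nonpos this, zero_mul]
      · have h0 := hJs x hx
        simp [h0, indicator]
  simp only [hzero] at hlim
  rw [← integral_indicator hΩ]
  exact (tendsto_nhds_unique hlim tendsto_const_nhds)

end DirDeriv

/-! ### Hausdorff measure of Lipschitz graphs -/

section GraphMeasure

theorem euclideanHausdorffMeasure_image_le {X Y : Type*} [EMetricSpace X] [EMetricSpace Y]
    [MeasurableSpace X] [BorelSpace X] [MeasurableSpace Y] [BorelSpace Y] {K : NNReal}
    {f : X → Y} {s : Set X} (hf : LipschitzOnWith K f s) (d : ℕ) :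
    μHE[d] (f '' s) ≤ (K : ENNReal) ^ d * μHE[d] s := by
  have h := hf.hausdorffMeasure_image_le (d := (d : ℝ)) (Nat.cast_nonneg d)
  rw [ENNReal.rpow_natCast] at h
  simp only [Measure.euclideanHausdorffMeasure_def, Measure.smul_apply, ENNReal.smul_def,
    smul_eq_mul]
  rw [mul_left_comm]
  gcongr

theorem injOn_of_dist_le {X Y : Type*} [MetricSpace X] [MetricSpace Y] {π : X → Y} {Z : Set X}
    {L : NNReal} (hanti : ∀ z ∈ Z, ∀ w ∈ Z, dist z w ≤ L * dist (π z) (π w)) :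
    InjOn π Z := fun z hz w hw h => by
  have := hanti z hz w hw
  rw [h, dist_self, mul_zero] at this
  exact dist_le_zero.1 this

theorem lipschitzOnWith_invFunOn {X Y : Type*} [MetricSpace X] [MetricSpace Y] [Nonempty X]
    {π : X → Y} {Z : Set X} {L : NNReal}
    (hanti : ∀ z ∈ Z, ∀ w ∈ Z, dist z w ≤ L * dist (π z) (π w)) :
    LipschitzOnWith L (Function.invFunOn π Z) (π '' Z) := by
  have hinj := injOn_of_dist_le hanti
  refine LipschitzOnWith.of_dist_le_mul ?_
  rintro _ ⟨z, hz, rfl⟩ _ ⟨w, hw, rfl⟩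
  rw [hinj.leftInvOn_invFunOn hz, hinj.leftInvOn_invFunOn hw]
  exact hanti z hz w hw

theorem measurableSet_image_of_dist_le {X Y : Type*} [MetricSpace X] [MeasurableSpace X]
    [BorelSpace X] [PolishSpace X] [MetricSpace Y] [MeasurableSpace Y] [BorelSpace Y]
    {π : X → Y} {Z : Set X} {L : NNReal} (hπ : LipschitzWith 1 π) (hZ : MeasurableSet Z)
    (hanti : ∀ z ∈ Z, ∀ w ∈ Z, dist z w ≤ L * dist (π z) (π w)) : MeasurableSet (π '' Z) :=
  hZ.image_of_continuousOn_injOn hπ.continuous.continuousOn (injOn_of_dist_le hanti)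

variable {m : ℕ} {X : Type*} [MetricSpace X] [MeasurableSpace X] [BorelSpace X]

/-- The measure on the set `Z` that corresponds to Lebesgue measure under a map `π` to `ℝᵐ` which
is injective on `Z`. -/
def liftedMeasure (π : X → EuclideanSpace ℝ (Fin m)) (Z : Set X) [Nonempty X] : Measure X :=
  (volume.restrict (π '' Z)).map (Function.invFunOn π Z)

variable [Nonempty X] [PolishSpace X] {π : X → EuclideanSpace ℝ (Fin m)} {Z : Set X} {L : NNReal}

theorem aemeasurable_invFunOn (hπ : LipschitzWith 1 π) (hZ : MeasurableSet Z)
    (hanti : ∀ z ∈ Z, ∀ w ∈ Z, dist z w ≤ L * dist (π z) (π w)) :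
    AEMeasurable (Function.invFunOn π Z) (volume.restrict (π '' Z)) :=
  (lipschitzOnWith_invFunOn hanti).continuousOn.aemeasurable
    (measurableSet_image_of_dist_le hπ hZ hanti)

theorem liftedMeasure_apply (hπ : LipschitzWith 1 π) (hZ : MeasurableSet Z)
    (hanti : ∀ z ∈ Z, ∀ w ∈ Z, dist z w ≤ L * dist (π z) (π w)) {S : Set X}
    (hS : MeasurableSet S) : liftedMeasure π Z S = volume (π '' (Z ∩ S)) := by
  have hinj := injOn_of_dist_le hanti
  rw [liftedMeasure, Measure.map_apply_of_aemeasurable (aemeasurable_invFunOn hπ hZ hanti) hS,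
    Measure.restrict_apply' (measurableSet_image_of_dist_le hπ hZ hanti)]
  congr 1
  ext y
  constructor
  · rintro ⟨hy, z, hz, rfl⟩
    rw [mem_preimage, hinj.leftInvOn_invFunOn hz] at hy
    exact ⟨z, ⟨hz, hy⟩, rfl⟩
  · rintro ⟨z, ⟨hz, hzS⟩, rfl⟩
    refine ⟨?_, z, hz, rfl⟩
    rwa [mem_preimage, hinj.leftInvOn_invFunOn hz]

theorem liftedMeasure_le (hπ : LipschitzWith 1 π) (hZ : MeasurableSet Z)
    (hanti : ∀ z ∈ Z, ∀ w ∈ Z, dist z w ≤ L * dist (π z) (π w)) :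
    liftedMeasure π Z ≤ (μHE[m] : Measure X).restrict Z := by
  refine Measure.le_iff.2 fun S hS => ?_
  rw [liftedMeasure_apply hπ hZ hanti hS, Measure.restrict_apply hS, inter_comm S Z,
    ← EuclideanSpace.euclideanHausdorffMeasure_eq_volume]
  simpa using euclideanHausdorffMeasure_image_le (hπ.lipschitzOnWith (s := Z ∩ S)) m

theorem le_liftedMeasure (hπ : LipschitzWith 1 π) (hZ : MeasurableSet Z)
    (hanti : ∀ z ∈ Z, ∀ w ∈ Z, dist z w ≤ L * dist (π z) (π w)) :
    (μHE[m] : Measure X).restrict Z ≤ (L : ENNReal) ^ m • liftedMeasure π Z := by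
  have hinj := injOn_of_dist_le hanti
  refine Measure.le_iff.2 fun S hS => ?_
  rw [Measure.smul_apply, liftedMeasure_apply hπ hZ hanti hS, Measure.restrict_apply hS,
    inter_comm S Z, ← EuclideanSpace.euclideanHausdorffMeasure_eq_volume]
  have himg : Function.invFunOn π Z '' (π '' (Z ∩ S)) = Z ∩ S := by
    rw [image_image]
    refine (image_congr fun z hz => ?_).trans (image_id _)
    exact hinj.leftInvOn_invFunOn hz.1
  have h := euclideanHausdorffMeasure_image_le
    ((lipschitzOnWith_invFunOn hanti).mono (image_mono (inter_subset_left : Z ∩ S ⊆ Z))) m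
  rwa [himg] at h

theorem liftedMeasure_ae_mem (hπ : LipschitzWith 1 π) (hZ : MeasurableSet Z)
    (hanti : ∀ z ∈ Z, ∀ w ∈ Z, dist z w ≤ L * dist (π z) (π w)) :
    ∀ᵐ z ∂(liftedMeasure π Z), z ∈ Z := by
  rw [ae_iff]
  change liftedMeasure π Z Zᶜ = 0
  rw [liftedMeasure_apply hπ hZ hanti hZ.compl]
  simp

theorem integral_liftedMeasure (hπ : LipschitzWith 1 π) (hZ : MeasurableSet Z)
    (hanti : ∀ z ∈ Z, ∀ w ∈ Z, dist z w ≤ L * dist (π z) (π w)) {f : X → ℝ}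
    (hf : Continuous f) : ∫ z, f z ∂(liftedMeasure π Z) =
      ∫ y in π '' Z, f (Function.invFunOn π Z y) := by
  rw [liftedMeasure, integral_map (aemeasurable_invFunOn hπ hZ hanti) hf.aestronglyMeasurable]

end GraphMeasure

/-! ### Slicing in a coordinate direction -/

section Slice

theorem integral_indicator_deriv_of_lt {G : ℝ → ℝ} (hG : ContDiff ℝ 1 G)
    (hGc : HasCompactSupport G) {I S : Set ℝ} {t₀ : ℝ} (hI : ∀ t, t ∉ I → deriv G t = 0)
    (hlt : ∀ t ∈ I, t < t₀ → t ∈ S) (hgt : ∀ t ∈ I, t₀ < t → t ∉ S) :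
    ∫ t, S.indicator (deriv G) t = G t₀ := by
  rw [← hGc.integral_Iic_deriv_eq hG t₀, ← integral_indicator measurableSet_Iic]
  refine integral_congr_ae ?_
  filter_upwards [Measure.ae_ne volume t₀] with t ht
  by_cases hI' : t ∈ I
  · rcases lt_or_gt_of_ne ht with h | h
    · rw [indicator_of_mem (hlt t hI' h), indicator_of_mem (mem_Iic.2 h.le)]
    · rw [indicator_of_notMem (hgt t hI' h), indicator_of_notMem (by simpa using h)]
  · simp [indicator, hI t hI']

theorem integral_indicator_deriv_of_gt {G : ℝ → ℝ} (hG : ContDiff ℝ 1 G)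
    (hGc : HasCompactSupport G) {I S : Set ℝ} {t₀ : ℝ} (hI : ∀ t, t ∉ I → deriv G t = 0)
    (hlt : ∀ t ∈ I, t < t₀ → t ∉ S) (hgt : ∀ t ∈ I, t₀ < t → t ∈ S) :
    ∫ t, S.indicator (deriv G) t = -G t₀ := by
  rw [← hGc.integral_Ioi_deriv_eq hG t₀, ← integral_indicator measurableSet_Ioi]
  refine integral_congr_ae ?_
  filter_upwards [Measure.ae_ne volume t₀] with t ht
  by_cases hI' : t ∈ I
  · rcases lt_or_gt_of_ne ht with h | h
    · rw [indicator_of_notMem (hlt t hI' h), indicator_of_notMem (by simpa using h.le)]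
    · rw [indicator_of_mem (hgt t hI' h), indicator_of_mem (mem_Ioi.2 h)]
  · simp [indicator, hI t hI']

variable {m : ℕ}

/-- The coordinate projection `ℝᵐ⁺¹ → ℝᵐ` that drops the `k`-th coordinate. -/
def dropCoord (k : Fin (m + 1)) (x : EuclideanSpace ℝ (Fin (m + 1))) :
    EuclideanSpace ℝ (Fin m) :=
  WithLp.toLp 2 fun i => x (k.succAbove i)

/-- The point of `ℝᵐ⁺¹` with `k`-th coordinate `t` and the other coordinates given by `y`. -/
def insertCoord (k : Fin (m + 1)) (t : ℝ) (y : EuclideanSpace ℝ (Fin m)) :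
    EuclideanSpace ℝ (Fin (m + 1)) :=
  WithLp.toLp 2 (k.insertNth t y.ofLp)

@[simp] theorem insertCoord_same (k : Fin (m + 1)) (t : ℝ) (y : EuclideanSpace ℝ (Fin m)) :
    insertCoord k t y k = t := by
  simp [insertCoord]

@[simp] theorem insertCoord_succAbove (k : Fin (m + 1)) (t : ℝ) (y : EuclideanSpace ℝ (Fin m))
    (i : Fin m) : insertCoord k t y (k.succAbove i) = y i := by
  simp [insertCoord]

@[simp] theorem dropCoord_apply (k : Fin (m + 1)) (x : EuclideanSpace ℝ (Fin (m + 1)))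
    (i : Fin m) : dropCoord k x i = x (k.succAbove i) := rfl

@[simp] theorem dropCoord_insertCoord (k : Fin (m + 1)) (t : ℝ) (y : EuclideanSpace ℝ (Fin m)) :
    dropCoord k (insertCoord k t y) = y := by
  ext i; simp

@[simp] theorem insertCoord_dropCoord (k : Fin (m + 1)) (x : EuclideanSpace ℝ (Fin (m + 1))) :
    insertCoord k (x k) (dropCoord k x) = x := by
  ext j
  rcases Fin.eq_self_or_eq_succAbove k j with rfl | ⟨i, rfl⟩ <;> simp

theorem insertCoord_eq_add (k : Fin (m + 1)) (t : ℝ) (y : EuclideanSpace ℝ (Fin m)) :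
    insertCoord k t y = insertCoord k 0 y + t • EuclideanSpace.single k 1 := by
  ext j
  rcases Fin.eq_self_or_eq_succAbove k j with rfl | ⟨i, rfl⟩ <;>
    simp [Fin.succAbove_ne]

theorem dist_sq_eq (k : Fin (m + 1)) (x y : EuclideanSpace ℝ (Fin (m + 1))) :
    dist x y ^ 2 = (x k - y k) ^ 2 + dist (dropCoord k x) (dropCoord k y) ^ 2 := by
  rw [EuclideanSpace.dist_eq, EuclideanSpace.dist_eq, Real.sq_sqrt (by positivity),
    Real.sq_sqrt (by positivity), Fin.sum_univ_succAbove _ k]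
  simp [Real.dist_eq, sq_abs]

theorem lipschitzWith_dropCoord (k : Fin (m + 1)) : LipschitzWith 1 (dropCoord k) := by
  refine LipschitzWith.of_dist_le_mul fun x y => ?_
  rw [NNReal.coe_one, one_mul]
  exact le_of_sq_le_sq (by rw [dist_sq_eq k x y]; nlinarith [sq_nonneg (x k - y k)]) dist_nonneg

theorem hasDerivAt_insertCoord (k : Fin (m + 1)) (t : ℝ) (y : EuclideanSpace ℝ (Fin m)) :
    HasDerivAt (fun t => insertCoord k t y) (EuclideanSpace.single k 1) t := by
  rw [funext fun t => insertCoord_eq_add k t y]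
  simpa using ((hasDerivAt_id t).smul_const
    (EuclideanSpace.single k (1 : ℝ))).const_add (insertCoord k 0 y)

theorem contDiff_insertCoord (k : Fin (m + 1)) (y : EuclideanSpace ℝ (Fin m))
    {r : WithTop ℕ∞} : ContDiff ℝ r (fun t => insertCoord k t y) := by
  rw [funext fun t => insertCoord_eq_add k t y]
  exact contDiff_const.add (contDiff_id.smul contDiff_const)

theorem hasDerivAt_comp_insertCoord {f : EuclideanSpace ℝ (Fin (m + 1)) → ℝ}
    (hf : Differentiable ℝ f) (k : Fin (m + 1)) (t : ℝ) (y : EuclideanSpace ℝ (Fin m)) :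
    HasDerivAt (fun t => f (insertCoord k t y))
      (dirDeriv (EuclideanSpace.single k 1) f (insertCoord k t y)) t :=
  (hf _).hasFDerivAt.comp_hasDerivAt t (hasDerivAt_insertCoord k t y)

theorem integral_eq_integral_insertCoord (k : Fin (m + 1))
    {f : EuclideanSpace ℝ (Fin (m + 1)) → ℝ} (hf : Integrable f) :
    ∫ x, f x = ∫ y : EuclideanSpace ℝ (Fin m), ∫ t : ℝ, f (insertCoord k t y) := by
  have e1 := (EuclideanSpace.volume_preserving_symm_measurableEquiv_toLp (Fin (m + 1))).symm
  have e2 := (volume_preserving_piFinSuccAbove (fun _ : Fin (m + 1) => ℝ) k).symm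
  have e := e1.comp e2
  have e3 := EuclideanSpace.volume_preserving_symm_measurableEquiv_toLp (Fin m)
  have hme : MeasurableEmbedding (⇑(MeasurableEquiv.toLp 2 (Fin (m + 1) → ℝ)).symm.symm ∘
      ⇑(MeasurableEquiv.piFinSuccAbove (fun _ : Fin (m + 1) => ℝ) k).symm) :=
    (MeasurableEquiv.measurableEmbedding _).comp (MeasurableEquiv.measurableEmbedding _)
  rw [← e.integral_comp hme f, Measure.volume_eq_prod,
    integral_prod_symm _ (by
      rw [← Measure.volume_eq_prod]; exact (e.integrable_comp_emb hme).2 hf)]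
  rw [← e3.integral_comp (MeasurableEquiv.measurableEmbedding _)]
  rfl

end Slice

/-! ### Boundary charts -/

section Chart

theorem inner_gradient {n : ℕ} (f : EuclideanSpace ℝ (Fin n) → ℝ)
    (x v : EuclideanSpace ℝ (Fin n)) : ⟪∇ f x, v⟫ = dirDeriv v f x := by
  rw [gradient, InnerProductSpace.toDual_symm_apply, dirDeriv]

theorem norm_gradient {n : ℕ} (f : EuclideanSpace ℝ (Fin n) → ℝ)
    (x : EuclideanSpace ℝ (Fin n)) : ‖∇ f x‖ = ‖fderiv ℝ f x‖ := by
  rw [gradient, LinearIsometryEquiv.norm_map]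

theorem gradient_apply {n : ℕ} (f : EuclideanSpace ℝ (Fin n) → ℝ)
    (x : EuclideanSpace ℝ (Fin n)) (j : Fin n) :
    (∇ f x) j = dirDeriv (EuclideanSpace.single j 1) f x := by
  rw [← inner_gradient, EuclideanSpace.inner_single_right]
  simp

/-- The open coordinate cube with centre `p` and half side length `r`. -/
def cube {n : ℕ} (p : EuclideanSpace ℝ (Fin n)) (r : ℝ) : Set (EuclideanSpace ℝ (Fin n)) :=
  EuclideanSpace.equiv (Fin n) ℝ ⁻¹' Metric.ball (EuclideanSpace.equiv (Fin n) ℝ p) r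

section Cube

variable {n : ℕ} {p : EuclideanSpace ℝ (Fin n)} {r : ℝ}

theorem mem_cube (hr : 0 < r) {x : EuclideanSpace ℝ (Fin n)} :
    x ∈ cube p r ↔ ∀ i, |x i - p i| < r := by
  simp [cube, dist_pi_lt_iff hr, Real.dist_eq]

theorem isOpen_cube : IsOpen (cube p r) :=
  Metric.isOpen_ball.preimage (EuclideanSpace.equiv (Fin n) ℝ).continuous

theorem convex_cube : Convex ℝ (cube p r) :=
  (convex_ball _ _).linear_preimage (EuclideanSpace.equiv (Fin n) ℝ).toLinearEquiv.toLinearMap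

theorem isBounded_cube : Bornology.IsBounded (cube p r) := by
  have := (EuclideanSpace.equiv (Fin n) ℝ).symm.lipschitz.isBounded_image
    (Metric.isBounded_ball (x := EuclideanSpace.equiv (Fin n) ℝ p) (r := r))
  rwa [ContinuousLinearEquiv.image_symm_eq_preimage] at this

theorem center_mem_cube (hr : 0 < r) : p ∈ cube p r := by
  simpa [cube] using hr

theorem measurableSet_frontier_inter_cube {Ω : Set (EuclideanSpace ℝ (Fin n))} :
    MeasurableSet (frontier Ω ∩ cube p r) :=
  isClosed_frontier.measurableSet.inter isOpen_cube.measurableSet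

theorem hasCompactSupport_of_tsupport_subset_cube {G : EuclideanSpace ℝ (Fin n) → ℝ}
    (hGs : tsupport G ⊆ cube p r) : HasCompactSupport G :=
  Metric.isCompact_of_isClosed_isBounded (isClosed_tsupport G) (isBounded_cube.subset hGs)

theorem exists_cube_subset {s : Set (EuclideanSpace ℝ (Fin n))} (hs : s ∈ 𝓝 p) :
    ∃ r > 0, cube p r ⊆ s := by
  let e := (EuclideanSpace.equiv (Fin n) ℝ).toHomeomorph
  have h : e.symm ⁻¹' s ∈ 𝓝 (e p) :=
    e.symm.continuous.continuousAt.preimage_mem_nhds (by simpa using hs)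
  obtain ⟨r, hr, h⟩ := Metric.mem_nhds_iff.1 h
  refine ⟨r, hr, fun x hx => ?_⟩
  have := h (show e x ∈ Metric.ball (e p) r from hx)
  simpa using this

end Cube

variable {m : ℕ}

/-- The standard basis vector `e_k`, so that `dirDeriv (basisVec k)` is `∂_k`. -/
abbrev basisVec {n : ℕ} (k : Fin n) : EuclideanSpace ℝ (Fin n) := EuclideanSpace.single k 1

/-- In the cube of half side length `r` around `p` the set `Ω` is `{ρ < 0}`, and `s ∂_k ρ` is
bounded below by `c > 0`, where `s` is a sign; thus `∂Ω` is there a Lipschitz graph over the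
hyperplane `x_k = 0`. -/
structure IsBoundaryChart (Ω : Set (EuclideanSpace ℝ (Fin (m + 1))))
    (p : EuclideanSpace ℝ (Fin (m + 1))) (ρ : EuclideanSpace ℝ (Fin (m + 1)) → ℝ)
    (k : Fin (m + 1)) (s r c L : ℝ) : Prop where
  smooth : ContDiff ℝ ∞ ρ
  r_pos : 0 < r
  c_pos : 0 < c
  sign : s = 1 ∨ s = -1
  mem_iff : ∀ x ∈ cube p r, x ∈ Ω ↔ ρ x < 0
  le_deriv : ∀ x ∈ cube p r, c ≤ s * dirDeriv (basisVec k) ρ x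
  norm_le : ∀ x ∈ cube p r, ‖fderiv ℝ ρ x‖ ≤ L

theorem IsDefiningFunctionAt.exists_chart {Ω : Set (EuclideanSpace ℝ (Fin (m + 1)))}
    {p : EuclideanSpace ℝ (Fin (m + 1))} {ρ : EuclideanSpace ℝ (Fin (m + 1)) → ℝ}
    (h : IsDefiningFunctionAt Ω p ρ) : ∃ k s r c L, IsBoundaryChart Ω p ρ k s r c L := by
  obtain ⟨k, hk⟩ : ∃ k, dirDeriv (basisVec k) ρ p ≠ 0 := by
    by_contra! hcon
    refine h.gradient_ne_zero ?_
    ext j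
    rw [gradient_apply, hcon j]
    rfl
  obtain ⟨s, hs, hspos⟩ : ∃ s : ℝ, (s = 1 ∨ s = -1) ∧ 0 < s * dirDeriv (basisVec k) ρ p := by
    rcases lt_or_gt_of_ne hk with h1 | h1
    · exact ⟨-1, Or.inr rfl, by linarith⟩
    · exact ⟨1, Or.inl rfl, by linarith⟩
  have hc1 : ContinuousAt (fun x => s * dirDeriv (basisVec k) ρ x) p :=
    (continuous_const.mul (dirDeriv_smooth h.smooth _).continuous).continuousAt
  have hc2 : ContinuousAt (fun x => ‖fderiv ℝ ρ x‖) p :=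
    (h.smooth.continuous_fderiv (by simp)).norm.continuousAt
  have e1 := hc1.eventually (lt_mem_nhds (half_lt_self hspos))
  have e2 := hc2.eventually (gt_mem_nhds (lt_add_one _))
  obtain ⟨r, hr, hsub⟩ := exists_cube_subset (h.mem_iff.and (e1.and e2))
  exact ⟨k, s, r, _, _, h.smooth, hr, half_pos hspos, hs, fun x hx => (hsub hx).1,
    fun x hx => (hsub hx).2.1.le, fun x hx => (hsub hx).2.2.le⟩

namespace IsBoundaryChart

variable {Ω : Set (EuclideanSpace ℝ (Fin (m + 1)))}
  {p : EuclideanSpace ℝ (Fin (m + 1))} {ρ : EuclideanSpace ℝ (Fin (m + 1)) → ℝ}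
  {k : Fin (m + 1)} {s r c L : ℝ} (h : IsBoundaryChart Ω p ρ k s r c L)

include h

theorem deriv_ne_zero {x : EuclideanSpace ℝ (Fin (m + 1))} (hx : x ∈ cube p r) :
    dirDeriv (basisVec k) ρ x ≠ 0 := fun h0 => by
  have := h.le_deriv x hx
  rw [h0, mul_zero] at this
  linarith [h.c_pos]

theorem le_abs_deriv {x : EuclideanSpace ℝ (Fin (m + 1))} (hx : x ∈ cube p r) :
    |dirDeriv (basisVec k) ρ x| = s * dirDeriv (basisVec k) ρ x := by
  have h1 := h.le_deriv x hx
  have h2 := h.c_pos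
  rcases h.sign with rfl | rfl
  · rw [abs_of_pos (by linarith), one_mul]
  · rw [abs_of_neg (by linarith)]; ring

theorem isDefiningFunctionAt {x : EuclideanSpace ℝ (Fin (m + 1))} (hx : x ∈ cube p r)
    (h0 : ρ x = 0) : IsDefiningFunctionAt Ω x ρ where
  smooth := h.smooth
  zero := h0
  gradient_ne_zero := fun hg => h.deriv_ne_zero hx (by rw [← inner_gradient, hg, inner_zero_left])
  mem_iff := by
    filter_upwards [isOpen_cube.mem_nhds hx] with y hy using h.mem_iff y hy

theorem mem_frontier_iff (hΩ : IsOpen Ω) {x : EuclideanSpace ℝ (Fin (m + 1))}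
    (hx : x ∈ cube p r) : x ∈ frontier Ω ↔ ρ x = 0 := by
  rw [hΩ.frontier_eq]
  constructor
  · rintro ⟨hcl, hn⟩
    refine le_antisymm (not_lt.1 fun hpos => ?_) (not_lt.1 fun hneg => hn ((h.mem_iff x hx).2 hneg))
    have e1 := h.smooth.continuous.continuousAt.eventually (lt_mem_nhds hpos)
    have e2 := isOpen_cube.mem_nhds hx
    obtain ⟨y, hy, hy1, hy2⟩ := ((mem_closure_iff_frequently.1 hcl).and_eventually
      (e1.and e2)).exists
    exact absurd ((h.mem_iff y hy2).1 hy) (not_lt.2 hy1.le)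
  · intro h0
    have hd := h.isDefiningFunctionAt hx h0
    refine ⟨?_, fun hxΩ => by linarith [(h.mem_iff x hx).1 hxΩ]⟩
    have hl := (hd.eventually_line (-∇ ρ x)).1 (by
      rw [inner_neg_right, real_inner_self_eq_norm_sq]
      have := norm_pos_iff.2 hd.gradient_ne_zero
      nlinarith)
    have hc : Tendsto (fun t : ℝ => x + t • (-∇ ρ x)) (𝓝[>] 0) (𝓝 x) := by
      have : Tendsto (fun t : ℝ => x + t • (-∇ ρ x)) (𝓝 0) (𝓝 (x + (0 : ℝ) • (-∇ ρ x))) :=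
        (by fun_prop : Continuous fun t : ℝ => x + t • (-∇ ρ x)).continuousAt.tendsto
      rw [zero_smul, add_zero] at this
      exact this.mono_left nhdsWithin_le_nhds
    exact mem_closure_of_tendsto hc hl

theorem outerNormal_eq (hΩ : IsOpen Ω) {x : EuclideanSpace ℝ (Fin (m + 1))}
    (hx : x ∈ cube p r) (hxf : x ∈ frontier Ω) : outerNormal Ω x = ‖∇ ρ x‖⁻¹ • ∇ ρ x :=
  IsOuterUnitNormal.outerNormal_eq
    ⟨ρ, h.isDefiningFunctionAt hx ((h.mem_frontier_iff hΩ hx).1 hxf), rfl⟩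

theorem insertCoord_mem {t : ℝ} {y : EuclideanSpace ℝ (Fin m)} :
    insertCoord k t y ∈ cube p r ↔ |t - p k| < r ∧ ∀ i, |y i - p (k.succAbove i)| < r := by
  rw [mem_cube h.r_pos]
  constructor
  · exact fun H => ⟨by simpa using H k, fun i => by simpa using H (k.succAbove i)⟩
  · rintro ⟨h1, h2⟩ j
    rcases Fin.eq_self_or_eq_succAbove k j with rfl | ⟨i, rfl⟩
    · simpa using h1
    · simpa using h2 i

/-- Along the `k`-th coordinate lines the function `s ρ` grows at least at the rate `c`. -/
theorem mul_sub_le {t₁ t₂ : ℝ} (ht : t₁ ≤ t₂) {y : EuclideanSpace ℝ (Fin m)}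
    (h1 : insertCoord k t₁ y ∈ cube p r) (h2 : insertCoord k t₂ y ∈ cube p r) :
    c * (t₂ - t₁) ≤ s * ρ (insertCoord k t₂ y) - s * ρ (insertCoord k t₁ y) := by
  have hd : ∀ t, HasDerivAt (fun t => s * ρ (insertCoord k t y))
      (s * dirDeriv (basisVec k) ρ (insertCoord k t y)) t := fun t =>
    (hasDerivAt_comp_insertCoord (h.smooth.differentiable (by simp)) k t y).const_mul s
  refine (convex_Icc t₁ t₂).mul_sub_le_image_sub_of_le_deriv
    (fun t _ => (hd t).continuousAt.continuousWithinAt)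
    (fun t _ => (hd t).differentiableAt.differentiableWithinAt) (fun t hmem => ?_)
    t₁ (left_mem_Icc.2 ht) t₂ (right_mem_Icc.2 ht) ht
  rw [interior_Icc] at hmem
  rw [(hd t).deriv]
  refine h.le_deriv _ (h.insertCoord_mem.2 ⟨?_, (h.insertCoord_mem.1 h1).2⟩)
  have a1 := abs_lt.1 (h.insertCoord_mem.1 h1).1
  have a2 := abs_lt.1 (h.insertCoord_mem.1 h2).1
  exact abs_lt.2 ⟨by linarith [hmem.1], by linarith [hmem.2]⟩

theorem L_nonneg : 0 ≤ L :=
  (norm_nonneg _).trans (h.norm_le p (center_mem_cube h.r_pos))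

/-- Inside the chart `∂Ω` is a Lipschitz graph: `ρ` varies by at most `L` times the distance of the
projections and by at least `c` times the difference of the `k`-th coordinates. -/
theorem dist_le (hΩ : IsOpen Ω) : ∀ z ∈ frontier Ω ∩ cube p r, ∀ w ∈ frontier Ω ∩ cube p r,
    dist z w ≤ (L / c + 1).toNNReal * dist (dropCoord k z) (dropCoord k w) := by
  rintro z ⟨hzf, hzQ⟩ w ⟨hwf, hwQ⟩
  have hc := h.c_pos
  have hL := h.L_nonneg
  have hz0 := (h.mem_frontier_iff hΩ hzQ).1 hzf
  have hw0 := (h.mem_frontier_iff hΩ hwQ).1 hwf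
  rw [Real.coe_toNNReal _ (by positivity)]
  set d := dist (dropCoord k z) (dropCoord k w) with hd
  have hzQ' : insertCoord k (z k) (dropCoord k z) ∈ cube p r := by simpa using hzQ
  have hwQ' : insertCoord k (w k) (dropCoord k w) ∈ cube p r := by simpa using hwQ
  -- the point with the height of `z` over the projection of `w`
  have hmix : insertCoord k (z k) (dropCoord k w) ∈ cube p r :=
    h.insertCoord_mem.2 ⟨(h.insertCoord_mem.1 hzQ').1, (h.insertCoord_mem.1 hwQ').2⟩
  have hlip : |ρ (insertCoord k (z k) (dropCoord k w))| ≤ L * d := by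
    have h1 := convex_cube.norm_image_sub_le_of_norm_fderiv_le
      (fun x _ => h.smooth.differentiable (by simp) x) h.norm_le hzQ hmix
    rw [hz0, sub_zero, Real.norm_eq_abs, ← dist_eq_norm] at h1
    have h2 : dist (insertCoord k (z k) (dropCoord k w)) z = d := by
      have := dist_sq_eq k (insertCoord k (z k) (dropCoord k w)) z
      simp only [insertCoord_same, sub_self, dropCoord_insertCoord] at this
      rw [hd, dist_comm (dropCoord k z)]
      exact (pow_left_inj₀ dist_nonneg dist_nonneg two_ne_zero).1 (by linarith)
    rwa [h2] at h1
  have habs : |s * ρ (insertCoord k (z k) (dropCoord k w))| ≤ L * d := by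
    rcases h.sign with rfl | rfl <;> simpa using hlip
  have hk : c * |z k - w k| ≤ L * d := by
    rcases le_total (w k) (z k) with hle | hle
    · have := h.mul_sub_le hle hwQ' hmix
      rw [insertCoord_dropCoord, hw0] at this
      rw [abs_of_nonneg (by linarith)]
      linarith [le_abs_self (s * ρ (insertCoord k (z k) (dropCoord k w)))]
    · have := h.mul_sub_le hle hmix hwQ'
      rw [insertCoord_dropCoord, hw0] at this
      rw [abs_of_nonpos (by linarith)]
      linarith [neg_abs_le (s * ρ (insertCoord k (z k) (dropCoord k w)))]
  have hk' : |z k - w k| ≤ L / c * d := by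
    rw [div_mul_eq_mul_div, le_div_iff₀ hc]; linarith
  have hd0 : 0 ≤ d := dist_nonneg
  refine le_of_sq_le_sq ?_ (by positivity)
  rw [dist_sq_eq k z w, ← hd, ← sq_abs (z k - w k)]
  have : 0 ≤ L / c := by positivity
  nlinarith [abs_nonneg (z k - w k), mul_nonneg this hd0, mul_nonneg (mul_nonneg this hd0) hd0]

/-- The fibre integral of `∂_k G` over `Ω` is, up to the sign `s`, the value of `G` at the
boundary point of the fibre, or `0` if the fibre does not meet the boundary. -/
theorem integral_fibre (hΩ : IsOpen Ω) {G : EuclideanSpace ℝ (Fin (m + 1)) → ℝ}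
    (hG : ContDiff ℝ 1 G) (hGs : tsupport G ⊆ cube p r) (y : EuclideanSpace ℝ (Fin m)) :
    ∫ t, Ω.indicator (dirDeriv (basisVec k) G) (insertCoord k t y) =
      s * (dropCoord k '' (frontier Ω ∩ cube p r)).indicator
        (fun y => G (Function.invFunOn (dropCoord k) (frontier Ω ∩ cube p r) y)) y := by
  set Z := frontier Ω ∩ cube p r with hZ
  have hinj : InjOn (dropCoord k) Z := injOn_of_dist_le (h.dist_le hΩ)
  set g : ℝ → ℝ := fun t => G (insertCoord k t y) with hg
  have hgc : ContDiff ℝ 1 g := hG.comp (contDiff_insertCoord k y)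
  have hgd : ∀ t, deriv g t = dirDeriv (basisVec k) G (insertCoord k t y) := fun t =>
    (hasDerivAt_comp_insertCoord (hG.differentiable (by simp)) k t y).deriv
  have hzero : ∀ t, insertCoord k t y ∉ cube p r → g t = 0 := fun t ht =>
    image_eq_zero_of_notMem_tsupport (f := G) fun h' => ht (hGs h')
  have hdzero : ∀ t, insertCoord k t y ∉ cube p r → deriv g t = 0 := fun t ht => by
    rw [hgd]
    exact dirDeriv_eq_zero_of_notMem_tsupport (fun h' => ht (hGs h')) _
  have hgcs : HasCompactSupport g := by
    refine HasCompactSupport.intro (isCompact_Icc (a := p k - r) (b := p k + r)) fun t ht => ?_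
    refine hzero t fun hmem => ht ?_
    have := abs_lt.1 (h.insertCoord_mem.1 hmem).1
    exact ⟨by linarith, by linarith⟩
  set S : Set ℝ := {t | insertCoord k t y ∈ Ω} with hS
  have hint : ∀ t, Ω.indicator (dirDeriv (basisVec k) G) (insertCoord k t y) =
      S.indicator (deriv g) t := by
    intro t
    by_cases ht : insertCoord k t y ∈ Ω
    · rw [indicator_of_mem ht, indicator_of_mem (show t ∈ S from ht), hgd]
    · rw [indicator_of_notMem ht, indicator_of_notMem (show t ∉ S from ht)]
  simp only [hint]
  set I : Set ℝ := {t | insertCoord k t y ∈ cube p r} with hI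
  by_cases hy : y ∈ dropCoord k '' Z
  · rw [indicator_of_mem hy]
    obtain ⟨z, hz, rfl⟩ := hy
    have hval : Function.invFunOn (dropCoord k) Z (dropCoord k z) = z := hinj.leftInvOn_invFunOn hz
    rw [hval]
    have hz0 := (h.mem_frontier_iff hΩ hz.2).1 hz.1
    have hzQ : insertCoord k (z k) (dropCoord k z) ∈ cube p r := by simpa using hz.2
    have hgz : g (z k) = G z := by simp [hg]
    have hc := h.c_pos
    have hlow : ∀ t ∈ I, t < z k → s * ρ (insertCoord k t (dropCoord k z)) < 0 := by
      intro t ht hlt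
      have := h.mul_sub_le hlt.le ht hzQ
      rw [insertCoord_dropCoord, hz0] at this
      nlinarith
    have hupp : ∀ t ∈ I, z k < t → 0 < s * ρ (insertCoord k t (dropCoord k z)) := by
      intro t ht hlt
      have := h.mul_sub_le hlt.le hzQ ht
      rw [insertCoord_dropCoord, hz0] at this
      nlinarith
    rcases h.sign with hs | hs
    · rw [hs] at hlow hupp ⊢
      rw [one_mul, ← hgz]
      refine integral_indicator_deriv_of_lt hgc hgcs (I := I) hdzero (fun t ht hlt => ?_)
        (fun t ht hlt hmem => ?_)
      · exact (h.mem_iff _ ht).2 (by linarith [hlow t ht hlt])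
      · linarith [hupp t ht hlt, (h.mem_iff _ ht).1 hmem]
    · rw [hs] at hlow hupp ⊢
      rw [neg_one_mul, ← hgz]
      refine integral_indicator_deriv_of_gt hgc hgcs (I := I) hdzero (fun t ht hlt hmem => ?_)
        (fun t ht hlt => ?_)
      · linarith [hlow t ht hlt, (h.mem_iff _ ht).1 hmem]
      · exact (h.mem_iff _ ht).2 (by linarith [hupp t ht hlt])
  · rw [indicator_of_notMem hy, mul_zero]
    have hne : ∀ t ∈ I, ρ (insertCoord k t y) ≠ 0 := fun t ht h0 => by
      refine hy ⟨insertCoord k t y, ⟨(h.mem_frontier_iff hΩ ht).2 h0, ht⟩, by simp⟩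
    have hIsub : ∀ t ∈ I, p k - r < t ∧ t < p k + r := fun t ht => by
      have := abs_lt.1 (h.insertCoord_mem.1 ht).1
      exact ⟨by linarith, by linarith⟩
    have hgl : g (p k - r) = 0 := hzero _ fun hmem => by
      have := (hIsub _ hmem).1; linarith
    have hgr : g (p k + r) = 0 := hzero _ fun hmem => by
      have := (hIsub _ hmem).2; linarith
    have hIpre : IsPreconnected I := by
      have : Convex ℝ I := by
        intro a ha b hb u v hu hv huv
        have h1 := h.insertCoord_mem.1 ha
        have h2 := h.insertCoord_mem.1 hb
        refine h.insertCoord_mem.2 ⟨?_, h1.2⟩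
        have := (convex_ball (p k) r) (x := a) (by simpa [Real.dist_eq] using h1.1)
          (y := b) (by simpa [Real.dist_eq] using h2.1) hu hv huv
        simpa [Real.dist_eq] using this
      exact this.isPreconnected
    have hcont : ContinuousOn (fun t => ρ (insertCoord k t y)) I :=
      (h.smooth.continuous.comp (contDiff_insertCoord (r := 0) k y).continuous).continuousOn
    -- without a boundary point on the fibre `ρ` keeps its sign there, and the integral is the value
    -- of `g` at an end of the interval
    have hsign : (∀ t ∈ I, ρ (insertCoord k t y) < 0) ∨ ∀ t ∈ I, 0 < ρ (insertCoord k t y) := by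
      by_contra! hcon
      obtain ⟨⟨a, ha, ha0⟩, b, hb, hb0⟩ := hcon
      obtain ⟨t, ht, ht0⟩ := hIpre.intermediate_value hb ha hcont ⟨hb0, ha0⟩
      exact hne t ht ht0
    rcases hsign with hneg | hpos
    · rw [← hgr]
      exact integral_indicator_deriv_of_lt hgc hgcs (I := I) hdzero
        (fun t ht _ => (h.mem_iff _ ht).2 (hneg t ht))
        (fun t ht hlt => absurd (hIsub t ht).2 (not_lt.2 hlt.le))
    · rw [← hgl]
      exact integral_indicator_deriv_of_lt hgc hgcs (I := I) hdzero
        (fun t ht hlt => absurd (hIsub t ht).1 (not_lt.2 hlt.le))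
        (fun t ht _ hmem => absurd ((h.mem_iff _ ht).1 hmem) (not_lt.2 (hpos t ht).le))

/-- The divergence theorem in a chart for the direction transversal to the boundary. -/
theorem setIntegral_transversal (hΩ : IsOpen Ω) {G : EuclideanSpace ℝ (Fin (m + 1)) → ℝ}
    (hG : ContDiff ℝ 1 G) (hGs : tsupport G ⊆ cube p r) :
    ∫ x in Ω, dirDeriv (basisVec k) G x =
      s * ∫ z, G z ∂(liftedMeasure (dropCoord k) (frontier Ω ∩ cube p r)) := by
  have hGi : Integrable (dirDeriv (basisVec k) G) :=
    (dirDeriv_continuous hG _).integrable_of_hasCompactSupport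
      (dirDeriv_hasCompactSupport (hasCompactSupport_of_tsupport_subset_cube hGs) _)
  rw [← integral_indicator hΩ.measurableSet,
    integral_eq_integral_insertCoord k (hGi.indicator hΩ.measurableSet)]
  simp only [h.integral_fibre hΩ hG hGs]
  rw [integral_const_mul, integral_liftedMeasure (lipschitzWith_dropCoord k)
    measurableSet_frontier_inter_cube (h.dist_le hΩ) hG.continuous,
    integral_indicator (measurableSet_image_of_dist_le (lipschitzWith_dropCoord k)
      measurableSet_frontier_inter_cube (h.dist_le hΩ))]

/-- The divergence theorem in a chart for all coordinate directions, reduced to the transversal one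
with `b = f / ∂_k ρ`. -/
theorem setIntegral_dirDeriv (hΩ : IsOpen Ω) {f : EuclideanSpace ℝ (Fin (m + 1)) → ℝ}
    (hf : ContDiff ℝ 1 f) (hfs : tsupport f ⊆ cube p r) (j : Fin (m + 1)) :
    ∫ x in Ω, dirDeriv (basisVec j) f x =
      s * ∫ z, f z / dirDeriv (basisVec k) ρ z * dirDeriv (basisVec j) ρ z
        ∂(liftedMeasure (dropCoord k) (frontier Ω ∩ cube p r)) := by
  have hρ' : ∀ a, ContDiff ℝ 1 (dirDeriv a ρ) := fun a =>
    (dirDeriv_smooth h.smooth a).of_le (by norm_cast)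
  set b : EuclideanSpace ℝ (Fin (m + 1)) → ℝ := fun x => f x / dirDeriv (basisVec k) ρ x with hb
  have hbz : ∀ x, f x = 0 → b x = 0 := fun x hx => by simp [hb, hx]
  have hbs : tsupport b ⊆ tsupport f := closure_mono fun x hx hfx => hx (hbz x hfx)
  have hbc : ContDiff ℝ 1 b := by
    rw [contDiff_iff_contDiffAt]
    intro x
    by_cases hx : x ∈ tsupport f
    · exact hf.contDiffAt.div (hρ' _).contDiffAt (h.deriv_ne_zero (hfs hx))
    · have : b =ᶠ[𝓝 x] fun _ => 0 := by
        filter_upwards [(isClosed_tsupport f).isOpen_compl.mem_nhds hx] with y hy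
        exact hbz y (image_eq_zero_of_notMem_tsupport hy)
      exact contDiffAt_const.congr_of_eventuallyEq this
  have hfb : f = fun x => b x * dirDeriv (basisVec k) ρ x := by
    funext x
    by_cases hx : x ∈ tsupport f
    · exact (div_mul_cancel₀ _ (h.deriv_ne_zero (hfs hx))).symm
    · have := image_eq_zero_of_notMem_tsupport hx
      simp [hbz x this, this]
  have hGs : tsupport (fun x => b x * dirDeriv (basisVec j) ρ x) ⊆ cube p r :=
    (tsupport_mul_subset_left).trans (hbs.trans hfs)
  calc ∫ x in Ω, dirDeriv (basisVec j) f x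
      = ∫ x in Ω, dirDeriv (basisVec j) (fun x => b x * dirDeriv (basisVec k) ρ x) x := by
        rw [← hfb]
    _ = ∫ x in Ω, dirDeriv (basisVec k) (fun x => b x * dirDeriv (basisVec j) ρ x) x :=
        setIntegral_dirDeriv_swap hΩ.measurableSet h.smooth hbc
          (hasCompactSupport_of_tsupport_subset_cube (hbs.trans hfs))
          (fun x hx => h.mem_iff x (hfs (hbs hx))) _ _
    _ = _ := h.setIntegral_transversal hΩ (hbc.mul (hρ' _)) hGs

end IsBoundaryChart

end Chart

/-! ### The divergence theorem -/

section Divergence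

variable {m : ℕ}

theorem integrable_of_continuousOn_of_ae_mem {X : Type*} [TopologicalSpace X] [MeasurableSpace X]
    [OpensMeasurableSpace X] [T2Space X] {μ : Measure X} [IsFiniteMeasure μ] {K : Set X}
    (hK : IsCompact K) (hμ : ∀ᵐ x ∂μ, x ∈ K) {g : X → ℝ} (hg : ContinuousOn g K) :
    Integrable g μ := by
  rw [← Measure.restrict_eq_self_of_ae_mem hμ]
  exact hg.integrableOn_compact' hK hK.measurableSet

namespace IsBoundaryChart

variable {Ω : Set (EuclideanSpace ℝ (Fin (m + 1)))}
  {p : EuclideanSpace ℝ (Fin (m + 1))} {ρ : EuclideanSpace ℝ (Fin (m + 1)) → ℝ}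
  {k : Fin (m + 1)} {s r c L : ℝ} (h : IsBoundaryChart Ω p ρ k s r c L)

include h

theorem continuousWithinAt_outerNormal (hΩ : IsOpen Ω) (hp : p ∈ frontier Ω) :
    ContinuousWithinAt (outerNormal Ω) (frontier Ω) p := by
  have hpQ := center_mem_cube (p := p) h.r_pos
  have hd := h.isDefiningFunctionAt hpQ ((h.mem_frontier_iff hΩ hpQ).1 hp)
  have hgc : Continuous (∇ ρ) :=
    (InnerProductSpace.toDual ℝ _).symm.continuous.comp (h.smooth.continuous_fderiv (by simp))
  have hc : ContinuousAt (fun x => ‖∇ ρ x‖⁻¹ • ∇ ρ x) p :=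
    (hgc.continuousAt.norm.inv₀ (norm_ne_zero_iff.2 hd.gradient_ne_zero)).smul hgc.continuousAt
  refine hc.continuousWithinAt.congr_of_eventuallyEq ?_ (h.outerNormal_eq hΩ hpQ hp)
  filter_upwards [self_mem_nhdsWithin, mem_nhdsWithin_of_mem_nhds (isOpen_cube.mem_nhds hpQ)]
    with x hx hxQ using h.outerNormal_eq hΩ hxQ hx

/-- The divergence theorem inside a boundary chart, with a boundary measure that is comparable to
the surface measure. Its density with respect to the lifted Lebesgue measure is
`|∇ρ| / |∂_k ρ|`. -/
theorem exists_measure (hΩ : IsOpen Ω) : ∃ (σ : Measure (EuclideanSpace ℝ (Fin (m + 1))))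
    (C : NNReal), IsFiniteMeasure σ ∧
      σ ≤ C • (surfaceMeasure (m + 1)).restrict (frontier Ω ∩ cube p r) ∧
      (surfaceMeasure (m + 1)).restrict (frontier Ω ∩ cube p r) ≤ C • σ ∧
      ∀ f : EuclideanSpace ℝ (Fin (m + 1)) → ℝ, ContDiff ℝ 1 f → tsupport f ⊆ cube p r →
        ∀ j, ∫ x in Ω, dirDeriv (basisVec j) f x = ∫ x, f x * outerNormal Ω x j ∂σ := by
  set Z := frontier Ω ∩ cube p r with hZ
  have hZm : MeasurableSet Z := measurableSet_frontier_inter_cube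
  have hπ := lipschitzWith_dropCoord k
  have hanti := h.dist_le hΩ
  set τ := liftedMeasure (dropCoord k) Z with hτ
  set θ : EuclideanSpace ℝ (Fin (m + 1)) → ℝ := fun x =>
    ‖fderiv ℝ ρ x‖ / |dirDeriv (basisVec k) ρ x| with hθ
  have hθm : Measurable θ :=
    (h.smooth.continuous_fderiv (by simp)).norm.measurable.div
      (dirDeriv_smooth h.smooth _).continuous.abs.measurable
  have hZae : ∀ᵐ z ∂τ, z ∈ Z := liftedMeasure_ae_mem hπ hZm hanti
  have habs : ∀ z ∈ Z, c ≤ |dirDeriv (basisVec k) ρ z| := fun z hz => by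
    rw [h.le_abs_deriv hz.2]; exact h.le_deriv z hz.2
  have hθ1 : ∀ z ∈ Z, 1 ≤ θ z := fun z hz => by
    have h1 := h.c_pos.trans_le (habs z hz)
    rw [hθ, one_le_div h1]
    refine ((fderiv ℝ ρ z).le_opNorm _).trans (le_of_eq ?_)
    simp
  have hθL : ∀ z ∈ Z, θ z ≤ L / c := fun z hz =>
    div_le_div₀ h.L_nonneg (h.norm_le z hz.2) h.c_pos (habs z hz)
  have hup : τ.withDensity (fun x => ENNReal.ofReal (θ x)) ≤ (L / c).toNNReal • τ := by
    have : (L / c).toNNReal • τ = τ.withDensity (fun _ => ENNReal.ofReal (L / c)) := by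
      rw [withDensity_const]; rfl
    rw [this]
    refine withDensity_mono ?_
    filter_upwards [hZae] with z hz using ENNReal.ofReal_le_ofReal (hθL z hz)
  have hlow : τ ≤ τ.withDensity (fun x => ENNReal.ofReal (θ x)) := by
    conv_lhs => rw [← withDensity_one (μ := τ)]
    refine withDensity_mono ?_
    filter_upwards [hZae] with z hz
    simpa using hθ1 z hz
  have hτfin : IsFiniteMeasure τ := by
    constructor
    rw [liftedMeasure_apply hπ hZm hanti MeasurableSet.univ, inter_univ]
    exact (hπ.isBounded_image (isBounded_cube.subset inter_subset_right)).measure_lt_top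
  have hτle : τ ≤ (surfaceMeasure (m + 1)).restrict Z := liftedMeasure_le hπ hZm hanti
  have hleτ : (surfaceMeasure (m + 1)).restrict Z ≤ ((L / c + 1).toNNReal ^ m) • τ := by
    have := le_liftedMeasure hπ hZm hanti
    refine this.trans (le_of_eq ?_)
    rw [← ENNReal.coe_pow]
    rfl
  set A := (L / c).toNNReal
  set B := (L / c + 1).toNNReal ^ m
  refine ⟨τ.withDensity (fun x => ENNReal.ofReal (θ x)), A + B, ?_, ?_, ?_, ?_⟩
  · exact isFiniteMeasure_of_le _ hup
  · calc _ ≤ A • τ := hup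
      _ ≤ (A + B) • τ := by gcongr; simp
      _ ≤ _ := by gcongr
  · calc _ ≤ B • τ := hleτ
      _ ≤ (A + B) • τ := by gcongr; simp
      _ ≤ _ := by gcongr
  · intro f hf hfs j
    rw [h.setIntegral_dirDeriv hΩ hf hfs j, integral_withDensity_eq_integral_toReal_smul
      hθm.ennreal_ofReal (Eventually.of_forall fun _ => ENNReal.ofReal_lt_top),
      ← integral_const_mul]
    refine integral_congr_ae ?_
    filter_upwards [hZae] with z hz
    have hk := h.deriv_ne_zero hz.2
    have hθ0 : 0 ≤ θ z := zero_le_one.trans (hθ1 z hz)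
    have hg : ‖fderiv ℝ ρ z‖ ≠ 0 := by
      intro h0
      refine hk ?_
      rw [dirDeriv, norm_eq_zero.1 h0]; rfl
    rw [ENNReal.toReal_ofReal hθ0, h.outerNormal_eq hΩ hz.2 hz.1]
    simp only [hθ, PiLp.smul_apply, smul_eq_mul, gradient_apply, norm_gradient]
    rw [h.le_abs_deriv hz.2]
    rcases h.sign with rfl | rfl <;> field_simp

end IsBoundaryChart

/-- **Divergence theorem** on a bounded smooth domain, with a boundary measure `σ` that is only
claimed to be comparable to the surface measure. -/
theorem exists_boundaryMeasure {Ω : Set (EuclideanSpace ℝ (Fin (m + 1)))} (hΩ : IsOpen Ω)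
    (hb : Bornology.IsBounded Ω) (hs : HasSmoothBoundary Ω) :
    ContinuousOn (outerNormal Ω) (frontier Ω) ∧
    ∃ (σ : Measure (EuclideanSpace ℝ (Fin (m + 1)))) (C : NNReal), IsFiniteMeasure σ ∧
      σ ≤ C • (surfaceMeasure (m + 1)).restrict (frontier Ω) ∧
      (surfaceMeasure (m + 1)).restrict (frontier Ω) ≤ C • σ ∧
      ∀ f : EuclideanSpace ℝ (Fin (m + 1)) → ℝ, ContDiff ℝ 1 f →
        ∀ j, ∫ x in Ω, dirDeriv (basisVec j) f x = ∫ x, f x * outerNormal Ω x j ∂σ := by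
  have hchart : ∀ p ∈ frontier Ω, ∃ ρ k s r c L, IsBoundaryChart Ω p ρ k s r c L := by
    intro p hp
    obtain ⟨ρ, hρ⟩ := hs p hp
    obtain ⟨k, s, r, c, L, h⟩ := hρ.exists_chart
    exact ⟨ρ, k, s, r, c, L, h⟩
  have hνc : ContinuousOn (outerNormal Ω) (frontier Ω) := by
    intro p hp
    obtain ⟨ρ, k, s, r, c, L, h⟩ := hchart p hp
    exact h.continuousWithinAt_outerNormal hΩ hp
  refine ⟨hνc, ?_⟩
  have hcompact : IsCompact (frontier Ω) :=
    Metric.isCompact_of_isClosed_isBounded isClosed_frontier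
      (hb.closure.subset frontier_subset_closure)
  have hloc : ∀ p : frontier Ω, ∃ (r : ℝ) (σ : Measure (EuclideanSpace ℝ (Fin (m + 1))))
      (C : NNReal), 0 < r ∧ IsFiniteMeasure σ ∧
      σ ≤ C • (surfaceMeasure (m + 1)).restrict (frontier Ω ∩ cube p r) ∧
      (surfaceMeasure (m + 1)).restrict (frontier Ω ∩ cube p r) ≤ C • σ ∧
      ∀ f : EuclideanSpace ℝ (Fin (m + 1)) → ℝ, ContDiff ℝ 1 f → tsupport f ⊆ cube p r →
        ∀ j, ∫ x in Ω, dirDeriv (basisVec j) f x = ∫ x, f x * outerNormal Ω x j ∂σ := by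
    intro p
    obtain ⟨ρ, k, s, r, c, L, h⟩ := hchart p p.2
    obtain ⟨σ, C, h'⟩ := h.exists_measure hΩ
    exact ⟨r, σ, C, h.r_pos, h'⟩
  choose r σ C hr hfin hle hge hdiv using hloc
  obtain ⟨t, ht⟩ := hcompact.elim_finite_subcover (fun p : frontier Ω => cube (p : _) (r p))
    (fun p => isOpen_cube) (fun x hx => mem_iUnion.2 ⟨⟨x, hx⟩, center_mem_cube (hr _)⟩)
  -- a partition of unity subordinate to `Ω` and finitely many boundary charts
  let U : Option t → Set (EuclideanSpace ℝ (Fin (m + 1))) := fun i =>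
    i.elim Ω fun p => cube (p : _) (r p)
  have hUo : ∀ i, IsOpen (U i) := by
    rintro (_ | p)
    · exact hΩ
    · exact isOpen_cube
  have hUc : closure Ω ⊆ ⋃ i, U i := by
    intro x hx
    by_cases hxΩ : x ∈ Ω
    · exact mem_iUnion.2 ⟨none, hxΩ⟩
    · have : x ∈ frontier Ω := by rw [hΩ.frontier_eq]; exact ⟨hx, hxΩ⟩
      obtain ⟨p, hp, hxp⟩ := mem_iUnion₂.1 (ht this)
      exact mem_iUnion.2 ⟨some ⟨p, hp⟩, hxp⟩
  obtain ⟨χ, hχ⟩ := SmoothPartitionOfUnity.exists_isSubordinate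
    (modelWithCornersSelf ℝ (EuclideanSpace ℝ (Fin (m + 1)))) isClosed_closure U hUo hUc
  have hχs : ∀ i, ContDiff ℝ 1 (χ i) := fun i =>
    ((χ i).contMDiff.contDiff).of_le (by norm_cast)
  have hχsum : ∀ x ∈ closure Ω, ∑ i, χ i x = 1 := fun x hx => by
    rw [← finsum_eq_sum_of_fintype]
    exact χ.sum_eq_one hx
  have hχ0 : ∀ x ∈ frontier Ω, χ none x = 0 := fun x hx =>
    image_eq_zero_of_notMem_tsupport fun hmem => by
      have h1 : x ∈ Ω := hχ none hmem
      rw [hΩ.frontier_eq] at hx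
      exact hx.2 h1
  have hχsum' : ∀ x ∈ frontier Ω, ∑ p : t, χ (some p) x = 1 := fun x hx => by
    have := hχsum x (frontier_subset_closure hx)
    rwa [Fintype.sum_option, hχ0 x hx, zero_add] at this
  let w : t → EuclideanSpace ℝ (Fin (m + 1)) → ENNReal := fun p x => ENNReal.ofReal (χ (some p) x)
  have hwm : ∀ p, Measurable (w p) := fun p =>
    ((hχs (some p)).continuous.measurable).ennreal_ofReal
  have hw1 : ∀ p x, w p x ≤ 1 := fun p x => by
    simpa [w] using χ.le_one (some p) x
  have hle' : ∀ p : t, (σ p).withDensity (w p) ≤ σ p := fun p => by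
    conv_rhs => rw [← withDensity_one (μ := σ p)]
    exact withDensity_mono (Eventually.of_forall (hw1 p))
  have hfin' : ∀ p : t, IsFiniteMeasure ((σ p).withDensity (w p)) := fun p =>
    have := hfin p
    isFiniteMeasure_of_le _ (hle' p)
  have hlef : ∀ p : t, (σ p).withDensity (w p) ≤
      C p • (surfaceMeasure (m + 1)).restrict (frontier Ω) := fun p =>
    (hle' p).trans ((hle p).trans (by gcongr; exact inter_subset_left))
  have hae : ∀ p : t, ∀ᵐ x ∂((σ p).withDensity (w p)), x ∈ frontier Ω := fun p =>
    ((Measure.absolutelyContinuous_of_le (hlef p)).trans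
      Measure.smul_absolutelyContinuous).ae_le
      (ae_restrict_mem isClosed_frontier.measurableSet)
  refine ⟨∑ p : t, (σ p).withDensity (w p), ∑ p : t, C p, ⟨?_⟩, ?_, ?_, ?_⟩
  · rw [Measure.finsetSum_apply]
    exact ENNReal.sum_lt_top.2 fun p _ => measure_lt_top _ _
  · rw [Finset.sum_smul]
    exact Finset.sum_le_sum fun p _ => hlef p
  · refine Measure.le_iff.2 fun S hS => ?_
    -- the cutoffs of the boundary charts add up to `1` on `∂Ω`
    have hsum : (surfaceMeasure (m + 1)).restrict (frontier Ω) S =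
        ∑ p : t, ∫⁻ x in S, w p x ∂(surfaceMeasure (m + 1)).restrict (frontier Ω) := by
      rw [← lintegral_finsetSum _ fun p _ => hwm p, ← setLIntegral_one]
      refine lintegral_congr_ae (ae_restrict_of_ae ?_)
      filter_upwards [ae_restrict_mem isClosed_frontier.measurableSet] with x hx
      rw [← ENNReal.ofReal_sum_of_nonneg fun p _ => χ.nonneg (some p) x, hχsum' x hx,
        ENNReal.ofReal_one]
    rw [hsum, Measure.smul_apply, Measure.finsetSum_apply, ENNReal.smul_def, smul_eq_mul,
      Finset.mul_sum]
    refine Finset.sum_le_sum fun p _ => ?_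
    have hcut : ∀ x, w p x = (cube (p : EuclideanSpace ℝ (Fin (m + 1))) (r p)).indicator (w p) x :=
      fun x => by
        by_cases hx : x ∈ cube (p : EuclideanSpace ℝ (Fin (m + 1))) (r p)
        · rw [indicator_of_mem hx]
        · rw [indicator_of_notMem hx]
          have : χ (some p) x = 0 :=
            image_eq_zero_of_notMem_tsupport fun hmem => hx (hχ (some p) hmem)
          simp [w, this]
    rw [withDensity_apply _ hS]
    calc ∫⁻ x in S, w p x ∂(surfaceMeasure (m + 1)).restrict (frontier Ω)
        = ∫⁻ x in S, w p x ∂(surfaceMeasure (m + 1)).restrict (frontier Ω ∩ cube p (r p)) := by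
          rw [lintegral_congr hcut, lintegral_indicator isOpen_cube.measurableSet,
            Measure.restrict_restrict isOpen_cube.measurableSet, Measure.restrict_restrict hS,
            Measure.restrict_restrict (isOpen_cube.measurableSet.inter hS)]
          congr 2
          ext x; simp only [mem_inter_iff]; tauto
      _ ≤ ∫⁻ x in S, w p x ∂(C p • σ p) :=
          lintegral_mono' (Measure.restrict_mono le_rfl (hge p)) le_rfl
      _ = C p * ∫⁻ x in S, w p x ∂σ p := by
          rw [Measure.restrict_smul, lintegral_smul_measure]; rfl
      _ ≤ _ := by
          gcongr
          exact Finset.single_le_sum (f := fun p : t => C p) (fun _ _ => zero_le)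
            (Finset.mem_univ p)
  · intro f hf j
    have hχf : ∀ i, ContDiff ℝ 1 (fun x => χ i x * f x) := fun i => (hχs i).mul hf
    have hsupp : ∀ i, tsupport (fun x => χ i x * f x) ⊆ U i := fun i =>
      tsupport_mul_subset_left.trans (hχ i)
    have hbU : ∀ i, HasCompactSupport (fun x => χ i x * f x) := by
      intro i
      refine Metric.isCompact_of_isClosed_isBounded (isClosed_tsupport _)
        (Bornology.IsBounded.subset ?_ (hsupp i))
      rcases i with _ | p
      · exact hb
      · exact isBounded_cube
    have hint : ∀ i, Integrable (dirDeriv (basisVec j) (fun x => χ i x * f x)) := fun i =>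
      (dirDeriv_continuous (hχf i) _).integrable_of_hasCompactSupport
        (dirDeriv_hasCompactSupport (hbU i) _)
    have hfsum : ∀ x ∈ Ω, dirDeriv (basisVec j) f x =
        ∑ i, dirDeriv (basisVec j) (fun x => χ i x * f x) x := by
      intro x hx
      rw [← dirDeriv_sum _ fun i _ => (hχf i).differentiable (by simp) x]
      have : f =ᶠ[𝓝 x] fun y => ∑ i, χ i y * f y := by
        filter_upwards [hΩ.mem_nhds hx] with y hy
        rw [← Finset.sum_mul, hχsum y (subset_closure hy), one_mul]
      rw [dirDeriv, dirDeriv, this.fderiv_eq]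
    rw [setIntegral_congr_fun hΩ.measurableSet hfsum,
      integral_finsetSum _ fun i _ => (hint i).integrableOn, Fintype.sum_option]
    have hnone : ∫ x in Ω, dirDeriv (basisVec j) (fun x => χ none x * f x) x = 0 := by
      rw [setIntegral_eq_integral_of_forall_compl_eq_zero fun x hx => ?_]
      · exact integral_dirDeriv_eq_zero (hχf none) (hbU none) _
      · exact dirDeriv_eq_zero_of_notMem_tsupport (fun hmem => hx (hsupp none hmem)) _
    have hνj : ContinuousOn (fun x => f x * outerNormal Ω x j) (frontier Ω) :=
      hf.continuous.continuousOn.mul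
        ((EuclideanSpace.proj (𝕜 := ℝ) j).continuous.comp_continuousOn hνc)
    rw [hnone, zero_add, integral_finsetSum_measure fun p _ =>
      integrable_of_continuousOn_of_ae_mem hcompact (hae p) hνj]
    refine Finset.sum_congr rfl fun p _ => ?_
    rw [hdiv p _ (hχf (some p)) (hsupp (some p)) j,
      integral_withDensity_eq_integral_toReal_smul (hwm p)
        (Eventually.of_forall fun _ => ENNReal.ofReal_lt_top)]
    refine integral_congr_ae (Eventually.of_forall fun x => ?_)
    simp only [w, ENNReal.toReal_ofReal (χ.nonneg (some p) x), smul_eq_mul]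
    ring

end Divergence

/-! ### Vector calculus in coordinates -/

section Calculus

variable {n : ℕ}

/-- The Laplacian `Δf`. -/
def laplace (f : EuclideanSpace ℝ (Fin n) → ℝ) (x : EuclideanSpace ℝ (Fin n)) : ℝ :=
  ∑ j, dirDeriv (basisVec j) (dirDeriv (basisVec j) f) x

/-- The product `∇f · ∇g` of gradients. -/
def gradDot (f g : EuclideanSpace ℝ (Fin n) → ℝ) (x : EuclideanSpace ℝ (Fin n)) : ℝ :=
  ∑ j, dirDeriv (basisVec j) f x * dirDeriv (basisVec j) g x

/-- The Hessian of `f` evaluated at the gradients of `g` and `k`: `f''(∇g, ∇k)`. -/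
def hessForm (f g k : EuclideanSpace ℝ (Fin n) → ℝ) (x : EuclideanSpace ℝ (Fin n)) : ℝ :=
  ∑ i, ∑ j, dirDeriv (basisVec i) (dirDeriv (basisVec j) f) x * dirDeriv (basisVec i) g x *
    dirDeriv (basisVec j) k x

variable {f g k : EuclideanSpace ℝ (Fin n) → ℝ}

theorem laplace_smooth (hf : ContDiff ℝ ∞ f) : ContDiff ℝ ∞ (laplace f) :=
  ContDiff.sum fun _ _ => dirDeriv_smooth (dirDeriv_smooth hf _) _

theorem gradDot_smooth (hf : ContDiff ℝ ∞ f) (hg : ContDiff ℝ ∞ g) :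
    ContDiff ℝ ∞ (gradDot f g) :=
  ContDiff.sum fun _ _ => (dirDeriv_smooth hf _).mul (dirDeriv_smooth hg _)

theorem hessForm_smooth (hf : ContDiff ℝ ∞ f) (hg : ContDiff ℝ ∞ g) (hk : ContDiff ℝ ∞ k) :
    ContDiff ℝ ∞ (hessForm f g k) :=
  ContDiff.sum fun _ _ => ContDiff.sum fun _ _ =>
    ((dirDeriv_smooth (dirDeriv_smooth hf _) _).mul (dirDeriv_smooth hg _)).mul
      (dirDeriv_smooth hk _)

theorem gradDot_comm (f g : EuclideanSpace ℝ (Fin n) → ℝ) (x : EuclideanSpace ℝ (Fin n)) :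
    gradDot f g x = gradDot g f x :=
  Finset.sum_congr rfl fun _ _ => mul_comm _ _

theorem gradDot_self_nonneg (f : EuclideanSpace ℝ (Fin n) → ℝ) (x : EuclideanSpace ℝ (Fin n)) :
    0 ≤ gradDot f f x :=
  Finset.sum_nonneg fun _ _ => mul_self_nonneg _

theorem gradDot_sq_le (f g : EuclideanSpace ℝ (Fin n) → ℝ) (x : EuclideanSpace ℝ (Fin n)) :
    gradDot f g x ^ 2 ≤ gradDot f f x * gradDot g g x := by
  simpa [gradDot, sq] using Finset.sum_mul_sq_le_sq_mul_sq Finset.univ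
    (fun j => dirDeriv (basisVec j) f x) (fun j => dirDeriv (basisVec j) g x)

theorem hessForm_comm (hf : ContDiff ℝ ∞ f) (g k : EuclideanSpace ℝ (Fin n) → ℝ)
    (x : EuclideanSpace ℝ (Fin n)) : hessForm f g k x = hessForm f k g x := by
  unfold hessForm
  rw [Finset.sum_comm]
  refine Finset.sum_congr rfl fun i _ => Finset.sum_congr rfl fun j _ => ?_
  rw [dirDeriv_comm hf]
  ring

theorem smooth_differentiable (hf : ContDiff ℝ ∞ f) : Differentiable ℝ f :=
  hf.differentiable (by simp)

theorem gradDot_mul_left (hf : ContDiff ℝ ∞ f) (hg : ContDiff ℝ ∞ g)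
    (k : EuclideanSpace ℝ (Fin n) → ℝ) (x : EuclideanSpace ℝ (Fin n)) :
    gradDot (fun y => f y * g y) k x = f x * gradDot g k x + g x * gradDot f k x := by
  simp only [gradDot, Finset.mul_sum, ← Finset.sum_add_distrib]
  refine Finset.sum_congr rfl fun j _ => ?_
  rw [dirDeriv_mul (smooth_differentiable hf x) (smooth_differentiable hg x)]
  ring

theorem gradDot_gradDot_left (hf : ContDiff ℝ ∞ f) (hg : ContDiff ℝ ∞ g)
    (k : EuclideanSpace ℝ (Fin n) → ℝ) (x : EuclideanSpace ℝ (Fin n)) :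
    gradDot (gradDot f g) k x = hessForm f k g x + hessForm g k f x := by
  unfold hessForm
  rw [gradDot, ← Finset.sum_add_distrib]
  refine Finset.sum_congr rfl fun i _ => ?_
  have : dirDeriv (basisVec i) (gradDot f g) x = ∑ j, dirDeriv (basisVec i)
      (fun y => dirDeriv (basisVec j) f y * dirDeriv (basisVec j) g y) x :=
    dirDeriv_sum _ (fun j _ => ((smooth_differentiable (dirDeriv_smooth hf _)).mul
      (smooth_differentiable (dirDeriv_smooth hg _))) x) _
  rw [this, Finset.sum_mul, ← Finset.sum_add_distrib]
  refine Finset.sum_congr rfl fun j _ => ?_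
  rw [dirDeriv_mul (smooth_differentiable (dirDeriv_smooth hf _) x)
    (smooth_differentiable (dirDeriv_smooth hg _) x)]
  ring

theorem sum_dirDeriv_mul (hf : ContDiff ℝ ∞ f) (hg : ContDiff ℝ ∞ g)
    (x : EuclideanSpace ℝ (Fin n)) :
    ∑ j, dirDeriv (basisVec j) (fun y => f y * dirDeriv (basisVec j) g y) x =
      gradDot f g x + f x * laplace g x := by
  simp only [gradDot, laplace, Finset.mul_sum, ← Finset.sum_add_distrib]
  refine Finset.sum_congr rfl fun j _ => ?_
  rw [dirDeriv_mul (smooth_differentiable hf x)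
    (smooth_differentiable (dirDeriv_smooth hg _) x)]

theorem normalDeriv_eq_sum (Ω : Set (EuclideanSpace ℝ (Fin n)))
    (f : EuclideanSpace ℝ (Fin n) → ℝ) (x : EuclideanSpace ℝ (Fin n)) :
    normalDeriv Ω f x = ∑ j, dirDeriv (basisVec j) f x * outerNormal Ω x j := by
  have h := (EuclideanSpace.basisFun (Fin n) ℝ).sum_repr (outerNormal Ω x)
  simp only [EuclideanSpace.basisFun_repr, EuclideanSpace.basisFun_apply] at h
  rw [normalDeriv]
  conv_lhs => rw [← h]
  rw [map_sum]
  refine Finset.sum_congr rfl fun j _ => ?_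
  rw [map_smul, smul_eq_mul, mul_comm, dirDeriv]

end Calculus

/-! ### Green's formula -/

section Green

variable {n : ℕ}

theorem integrableOn_of_isBounded {Ω : Set (EuclideanSpace ℝ (Fin n))}
    (hb : Bornology.IsBounded Ω) {F : Type*} [NormedAddCommGroup F]
    {f : EuclideanSpace ℝ (Fin n) → F} (hf : Continuous f) : IntegrableOn f Ω :=
  (hf.continuousOn.integrableOn_compact hb.isCompact_closure).mono_set subset_closure

/-- `σ` is a finite measure carried by `∂Ω` for which the divergence theorem holds with the
outer normal `ν`. -/
structure IsBoundaryMeasure (Ω : Set (EuclideanSpace ℝ (Fin n)))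
    (σ : Measure (EuclideanSpace ℝ (Fin n))) : Prop where
  finite : IsFiniteMeasure σ
  ae_mem : ∀ᵐ x ∂σ, x ∈ frontier Ω
  normal_continuousOn : ContinuousOn (outerNormal Ω) (frontier Ω)
  divergence : ∀ f : EuclideanSpace ℝ (Fin n) → ℝ, ContDiff ℝ 1 f → ∀ j,
    ∫ x in Ω, dirDeriv (basisVec j) f x = ∫ x, f x * outerNormal Ω x j ∂σ

theorem continuousOn_normalDeriv {Ω : Set (EuclideanSpace ℝ (Fin n))}
    (hν : ContinuousOn (outerNormal Ω) (frontier Ω)) {F : Type*} [NormedAddCommGroup F]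
    [NormedSpace ℝ F] {f : EuclideanSpace ℝ (Fin n) → F} (hf : ContDiff ℝ ∞ f) :
    ContinuousOn (normalDeriv Ω f) (frontier Ω) :=
  (hf.continuous_fderiv (by simp)).continuousOn.clm_apply hν

theorem isCompact_frontier_of_isBounded {Ω : Set (EuclideanSpace ℝ (Fin n))}
    (hb : Bornology.IsBounded Ω) : IsCompact (frontier Ω) :=
  Metric.isCompact_of_isClosed_isBounded isClosed_frontier
    (hb.closure.subset frontier_subset_closure)

namespace IsBoundaryMeasure

variable {Ω : Set (EuclideanSpace ℝ (Fin n))} {σ : Measure (EuclideanSpace ℝ (Fin n))}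
  (h : IsBoundaryMeasure Ω σ)

include h

theorem integrable (hb : Bornology.IsBounded Ω) {g : EuclideanSpace ℝ (Fin n) → ℝ}
    (hg : ContinuousOn g (frontier Ω)) : Integrable g σ :=
  have := h.finite
  integrable_of_continuousOn_of_ae_mem (isCompact_frontier_of_isBounded hb) h.ae_mem hg

/-- Green's formula `∫_Ω (∇f·∇g + f Δg) = ∫_{∂Ω} f ∂_ν g`. -/
theorem green (hb : Bornology.IsBounded Ω) {f g : EuclideanSpace ℝ (Fin n) → ℝ}
    (hf : ContDiff ℝ ∞ f) (hg : ContDiff ℝ ∞ g) :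
    ∫ x in Ω, (gradDot f g x + f x * laplace g x) = ∫ x, f x * normalDeriv Ω g x ∂σ := by
  have hX : ∀ j, ContDiff ℝ ∞ (fun y => f y * dirDeriv (basisVec j) g y) := fun j =>
    hf.mul (dirDeriv_smooth hg _)
  simp only [← sum_dirDeriv_mul hf hg, normalDeriv_eq_sum, Finset.mul_sum]
  rw [integral_finsetSum _ fun j _ =>
      (integrableOn_of_isBounded hb (dirDeriv_smooth (hX j) (basisVec j)).continuous),
    integral_finsetSum _ fun j _ => ?_]
  · refine Finset.sum_congr rfl fun j _ => ?_
    rw [h.divergence _ ((hX j).of_le (by norm_cast)) j]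
    simp only [mul_assoc]
  · refine h.integrable hb ?_
    exact hf.continuous.continuousOn.mul ((dirDeriv_smooth hg _).continuous.continuousOn.mul
      ((EuclideanSpace.proj (𝕜 := ℝ) j).continuous.comp_continuousOn h.normal_continuousOn))

end IsBoundaryMeasure

/-- A function that vanishes on `∂Ω` has there a gradient parallel to the normal. -/
theorem dirDeriv_eq_normalDeriv {m : ℕ} {Ω : Set (EuclideanSpace ℝ (Fin (m + 1)))}
    (hΩ : IsOpen Ω) (hs : HasSmoothBoundary Ω) {v : EuclideanSpace ℝ (Fin (m + 1)) → ℝ}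
    (hv : ContDiff ℝ ∞ v) (hv0 : ∀ x ∈ frontier Ω, v x = 0)
    {x : EuclideanSpace ℝ (Fin (m + 1))} (hx : x ∈ frontier Ω) (j : Fin (m + 1)) :
    dirDeriv (basisVec j) v x = normalDeriv Ω v x * outerNormal Ω x j ∧
      ‖outerNormal Ω x‖ = 1 := by
  obtain ⟨ρ, hρ⟩ := hs x hx
  obtain ⟨k, s, r, c, L, hc⟩ := hρ.exists_chart
  have hxQ := center_mem_cube (p := x) hc.r_pos
  have hext : IsLocalExtrOn v {y | ρ y = ρ x} x := by
    refine Or.inl ?_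
    have h1 : ∀ᶠ y in 𝓝[{y | ρ y = ρ x}] x, v x ≤ v y := by
      filter_upwards [self_mem_nhdsWithin,
        mem_nhdsWithin_of_mem_nhds (isOpen_cube.mem_nhds hxQ)] with y hy hyQ
      have : ρ y = 0 := by rw [← hρ.zero]; exact hy
      rw [hv0 x hx, hv0 y ((hc.mem_frontier_iff hΩ hyQ).2 this)]
    exact h1
  obtain ⟨a, b, hab, heq⟩ := hext.exists_multipliers_of_hasStrictFDerivAt_1d
    (hρ.smooth.contDiffAt.hasStrictFDerivAt (by simp))
    (hv.contDiffAt.hasStrictFDerivAt (by simp))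
  have hg := norm_pos_iff.2 hρ.gradient_ne_zero
  have hb : b ≠ 0 := by
    rintro rfl
    rw [zero_smul, add_zero] at heq
    rcases smul_eq_zero.1 heq with ha | h0
    · exact hab (by rw [ha]; rfl)
    · rw [norm_gradient, h0, norm_zero] at hg
      exact lt_irrefl _ hg
  have hνeq := hc.outerNormal_eq hΩ hxQ hx
  -- Lagrange multipliers: `v` is constant on the level set of `ρ` through `x`
  have hlin : fderiv ℝ v x = (-(a / b)) • fderiv ℝ ρ x := by
    have h1 : b • fderiv ℝ v x = (-a) • fderiv ℝ ρ x := by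
      rw [neg_smul]; exact eq_neg_of_add_eq_zero_right heq
    rw [← inv_smul_smul₀ hb (fderiv ℝ v x), h1, smul_smul]
    congr 1
    field_simp
  have hρν : fderiv ℝ ρ x (outerNormal Ω x) = ‖∇ ρ x‖ := by
    have : fderiv ℝ ρ x (outerNormal Ω x) = ⟪∇ ρ x, outerNormal Ω x⟫ := by
      rw [inner_gradient, dirDeriv]
    rw [this, hνeq, real_inner_smul_right, real_inner_self_eq_norm_sq]
    field_simp
  constructor
  · rw [normalDeriv, dirDeriv, hlin]
    simp only [smul_apply, smul_eq_mul]
    rw [hρν, hνeq]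
    simp only [PiLp.smul_apply, smul_eq_mul, gradient_apply, dirDeriv]
    field_simp
  · rw [hνeq, norm_smul, norm_inv, norm_norm, inv_mul_cancel₀ hg.ne']

end Green

/-! ### The Carleman identity for real functions -/

section Identity

variable {n : ℕ}

/-- The symmetric part `-h²Δ - |∇ψ|²` of the operator `e^{ψ/h} (hD)² e^{-ψ/h}`. -/
def symPart (h : ℝ) (ψ v : EuclideanSpace ℝ (Fin n) → ℝ) (x : EuclideanSpace ℝ (Fin n)) : ℝ :=
  -h ^ 2 * laplace v x - gradDot ψ ψ x * v x

/-- The antisymmetric part `2h∇ψ·∇ + hΔψ` of the operator `e^{ψ/h} (hD)² e^{-ψ/h}`. -/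
def skewPart (h : ℝ) (ψ v : EuclideanSpace ℝ (Fin n) → ℝ) (x : EuclideanSpace ℝ (Fin n)) : ℝ :=
  2 * h * gradDot ψ v x + h * laplace ψ x * v x

theorem symPart_smooth (h : ℝ) {ψ v : EuclideanSpace ℝ (Fin n) → ℝ} (hψ : ContDiff ℝ ∞ ψ)
    (hv : ContDiff ℝ ∞ v) : ContDiff ℝ ∞ (symPart h ψ v) :=
  (contDiff_const.mul (laplace_smooth hv)).sub ((gradDot_smooth hψ hψ).mul hv)

theorem skewPart_smooth (h : ℝ) {ψ v : EuclideanSpace ℝ (Fin n) → ℝ} (hψ : ContDiff ℝ ∞ ψ)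
    (hv : ContDiff ℝ ∞ v) : ContDiff ℝ ∞ (skewPart h ψ v) :=
  (contDiff_const.mul (gradDot_smooth hψ hv)).add
    ((contDiff_const.mul (laplace_smooth hψ)).mul hv)

variable {m : ℕ} {Ω : Set (EuclideanSpace ℝ (Fin (m + 1)))}
  {σ : Measure (EuclideanSpace ℝ (Fin (m + 1)))} {ψ v : EuclideanSpace ℝ (Fin (m + 1)) → ℝ}

theorem gradDot_eq_of_boundary (hΩ : IsOpen Ω) (hs : HasSmoothBoundary Ω)
    (hv : ContDiff ℝ ∞ v) (hv0 : ∀ x ∈ frontier Ω, v x = 0)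
    (f : EuclideanSpace ℝ (Fin (m + 1)) → ℝ) {x : EuclideanSpace ℝ (Fin (m + 1))}
    (hx : x ∈ frontier Ω) : gradDot f v x = normalDeriv Ω f x * normalDeriv Ω v x := by
  rw [normalDeriv_eq_sum Ω f, Finset.sum_mul]
  refine Finset.sum_congr rfl fun j _ => ?_
  rw [(dirDeriv_eq_normalDeriv hΩ hs hv hv0 hx j).1]
  ring

/-- The commutator identity: `2 (Av, Bv)` for the symmetric and antisymmetric parts `A`, `B`, as
a bulk integral plus the boundary term produced by `-h²Δ` and `2h∇ψ·∇` (Rellich's identity). -/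
theorem integral_symPart_mul_skewPart (hΩ : IsOpen Ω) (hb : Bornology.IsBounded Ω)
    (hs : HasSmoothBoundary Ω) (hσ : IsBoundaryMeasure Ω σ) (h : ℝ) (hψ : ContDiff ℝ ∞ ψ)
    (hv : ContDiff ℝ ∞ v) (hv0 : ∀ x ∈ frontier Ω, v x = 0) :
    ∫ x in Ω, 2 * (symPart h ψ v x * skewPart h ψ v x) =
      (∫ x in Ω, (4 * h ^ 3 * hessForm ψ v v x + 4 * h * hessForm ψ ψ ψ x * v x ^ 2
        - h ^ 3 * laplace (laplace ψ) x * v x ^ 2))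
      - 2 * h ^ 3 * ∫ x, normalDeriv Ω ψ x * normalDeriv Ω v x ^ 2 ∂σ := by
  have hL := laplace_smooth hψ
  have hψψ := gradDot_smooth hψ hψ
  have hψv := gradDot_smooth hψ hv
  have hvv := gradDot_smooth hv hv
  have hv2 : ContDiff ℝ ∞ (fun y => v y * v y) := hv.mul hv
  have hLv : ContDiff ℝ ∞ (fun y => laplace ψ y * v y) := hL.mul hv
  have hψv2 : ContDiff ℝ ∞ (fun y => gradDot ψ ψ y * (v y * v y)) := hψψ.mul hv2
  -- the five terms of the divergence, each of the form `div (f ∇g)`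
  have g1 := hσ.green hb hψv hv
  have g2 := hσ.green hb hvv hψ
  have g3 := hσ.green hb hLv hv
  have g4 := hσ.green hb hv2 hL
  have g5 := hσ.green hb hψv2 hψ
  have hae : ∀ f g : EuclideanSpace ℝ (Fin (m + 1)) → ℝ, (∀ x ∈ frontier Ω, f x = g x) →
      ∫ x, f x ∂σ = ∫ x, g x ∂σ := fun f g hfg => integral_congr_ae (by
    filter_upwards [hσ.ae_mem] with x hx using hfg x hx)
  rw [hae _ (fun x => normalDeriv Ω ψ x * normalDeriv Ω v x ^ 2) (fun x hx => by
    rw [gradDot_eq_of_boundary hΩ hs hv hv0 ψ hx]; ring)] at g1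
  rw [hae _ (fun x => normalDeriv Ω ψ x * normalDeriv Ω v x ^ 2) (fun x hx => by
    rw [gradDot_eq_of_boundary hΩ hs hv hv0 v hx]; ring)] at g2
  rw [hae _ (fun _ => 0) (fun x hx => by rw [hv0 x hx]; ring), integral_zero] at g3 g4 g5
  have i : ∀ {f g : EuclideanSpace ℝ (Fin (m + 1)) → ℝ}, ContDiff ℝ ∞ f → ContDiff ℝ ∞ g →
      IntegrableOn (fun x => gradDot f g x + f x * laplace g x) Ω := fun hf hg =>
    integrableOn_of_isBounded hb
      ((gradDot_smooth hf hg).add (hf.mul (laplace_smooth hg))).continuous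
  have i1 := (i hψv hv).const_mul (-4 * h ^ 3)
  have i2 := (i hvv hψ).const_mul (2 * h ^ 3)
  have i3 := (i hLv hv).const_mul (-2 * h ^ 3)
  have i4 := (i hv2 hL).const_mul (h ^ 3)
  have i5 := (i hψv2 hψ).const_mul (-2 * h)
  have hbulk : IntegrableOn (fun x => 4 * h ^ 3 * hessForm ψ v v x
      + 4 * h * hessForm ψ ψ ψ x * v x ^ 2 - h ^ 3 * laplace (laplace ψ) x * v x ^ 2) Ω :=
    integrableOn_of_isBounded hb
      (((contDiff_const.mul (hessForm_smooth hψ hv hv)).add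
        ((contDiff_const.mul (hessForm_smooth hψ hψ hψ)).mul (hv.pow 2))).sub
        ((contDiff_const.mul (laplace_smooth hL)).mul (hv.pow 2))).continuous
  have hpt : ∀ x, 2 * (symPart h ψ v x * skewPart h ψ v x) =
      (4 * h ^ 3 * hessForm ψ v v x + 4 * h * hessForm ψ ψ ψ x * v x ^ 2
        - h ^ 3 * laplace (laplace ψ) x * v x ^ 2)
      + ((-4 * h ^ 3) * (gradDot (gradDot ψ v) v x + gradDot ψ v x * laplace v x)
      + ((2 * h ^ 3) * (gradDot (gradDot v v) ψ x + gradDot v v x * laplace ψ x)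
      + ((-2 * h ^ 3) * (gradDot (fun y => laplace ψ y * v y) v x
          + laplace ψ x * v x * laplace v x)
      + ((h ^ 3) * (gradDot (fun y => v y * v y) (laplace ψ) x
          + v x * v x * laplace (laplace ψ) x)
      + (-2 * h) * (gradDot (fun y => gradDot ψ ψ y * (v y * v y)) ψ x
          + gradDot ψ ψ x * (v x * v x) * laplace ψ x))))) := by
    intro x
    rw [gradDot_gradDot_left hψ hv, gradDot_gradDot_left hv hv, gradDot_mul_left hL hv,
      gradDot_mul_left hv hv, gradDot_mul_left hψψ hv2, gradDot_mul_left hv hv,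
      gradDot_gradDot_left hψ hψ, hessForm_comm hv v ψ, gradDot_comm (laplace ψ) v,
      gradDot_comm v ψ, symPart, skewPart]
    ring
  simp only [hpt]
  have j4 := i4.fun_add i5
  have j3 := i3.fun_add j4
  have j2 := i2.fun_add j3
  rw [integral_add hbulk (i1.fun_add j2), integral_add i1 j2, integral_add i2 j3,
    integral_add i3 j4, integral_add i4 i5]
  simp only [integral_const_mul]
  rw [g1, g2, g3, g4, g5]
  ring

/-- The symmetric part controls the gradient: `(Av, v) = h²‖∇v‖² - ∫ |∇ψ|² v²`. -/
theorem integral_symPart_mul_self (hb : Bornology.IsBounded Ω) (hσ : IsBoundaryMeasure Ω σ) (h : ℝ)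
    (hψ : ContDiff ℝ ∞ ψ) (hv : ContDiff ℝ ∞ v) (hv0 : ∀ x ∈ frontier Ω, v x = 0) :
    ∫ x in Ω, symPart h ψ v x * v x =
      ∫ x in Ω, (h ^ 2 * gradDot v v x - gradDot ψ ψ x * v x ^ 2) := by
  have g := hσ.green hb hv hv
  have h0 : ∫ x, v x * normalDeriv Ω v x ∂σ = 0 := by
    rw [← integral_zero (EuclideanSpace ℝ (Fin (m + 1))) ℝ (μ := σ)]
    refine integral_congr_ae ?_
    filter_upwards [hσ.ae_mem] with x hx
    rw [hv0 x hx, zero_mul]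
  rw [h0] at g
  rw [← sub_eq_zero, ← integral_sub, ← mul_zero (-h ^ 2), ← g, ← integral_const_mul]
  · refine integral_congr_ae (Eventually.of_forall fun x => ?_)
    simp only [symPart]
    ring
  · exact integrableOn_of_isBounded hb ((symPart_smooth h hψ hv).mul hv).continuous
  · exact integrableOn_of_isBounded hb ((contDiff_const.mul (gradDot_smooth hv hv)).sub
      ((gradDot_smooth hψ hψ).mul (hv.pow 2))).continuous

/-- The Carleman estimate for a real function `v` and a weight `ψ` whose Hessian is almost
nonnegative on all vectors and of size `h / ε` in the direction `∇ψ`. The gradient term is gained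
from the symmetric part, with the multiplier `K = 4k₂ + 1`. -/
theorem carleman_real (hΩ : IsOpen Ω) (hb : Bornology.IsBounded Ω)
    (hs : HasSmoothBoundary Ω) (hσ : IsBoundaryMeasure Ω σ) {h ε k₂ k₄ K : ℝ} (h0 : 0 < h)
    (h1 : h ≤ 1) (hk₂ : 0 ≤ k₂) (hk₄ : 0 ≤ k₄) (hK : K = 4 * k₂ + 1)
    (hψ : ContDiff ℝ ∞ ψ) (hv : ContDiff ℝ ∞ v) (hv0 : ∀ x ∈ frontier Ω, v x = 0)
    (hess1 : ∀ x ∈ Ω, -(h * k₂) * gradDot v v x ≤ hessForm ψ v v x)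
    (hess2 : ∀ x ∈ Ω, h / (4 * ε) - 4 * h * k₂ ≤ hessForm ψ ψ ψ x)
    (hlap : ∀ x ∈ Ω, laplace (laplace ψ) x ≤ h * k₄)
    (hgrad : ∀ x ∈ Ω, gradDot ψ ψ x ≤ 4) :
    ∫ x in Ω, (h ^ 4 * gradDot v v x
        + h ^ 2 * (1 / ε - 16 * k₂ - k₄ - K ^ 2 / 4 - 4 * K) * v x ^ 2) ≤
      (∫ x in Ω, (symPart h ψ v x + skewPart h ψ v x) ^ 2)
        + 2 * h ^ 3 * ∫ x, normalDeriv Ω ψ x * normalDeriv Ω v x ^ 2 ∂σ := by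
  have hK0 : 0 ≤ K := by rw [hK]; positivity
  have e1 := integral_symPart_mul_skewPart hΩ hb hs hσ h hψ hv hv0
  have e2 := integral_symPart_mul_self hb hσ h hψ hv hv0
  have hA := symPart_smooth h hψ hv
  have hB := skewPart_smooth h hψ hv
  have hvv := gradDot_smooth hv hv
  have hψψ := gradDot_smooth hψ hψ
  have I : ∀ {f : EuclideanSpace ℝ (Fin (m + 1)) → ℝ}, ContDiff ℝ ∞ f → IntegrableOn f Ω :=
    fun hf => integrableOn_of_isBounded hb hf.continuous
  have cAB : ContDiff ℝ ∞ (fun x => 2 * (symPart h ψ v x * skewPart h ψ v x)) :=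
    contDiff_const.mul (hA.mul hB)
  have cAv : ContDiff ℝ ∞ (fun x => symPart h ψ v x * v x) := hA.mul hv
  have cg : ContDiff ℝ ∞ (fun x => h ^ 2 * gradDot v v x - gradDot ψ ψ x * v x ^ 2) :=
    (contDiff_const.mul hvv).sub (hψψ.mul (hv.pow 2))
  have cv : ContDiff ℝ ∞ (fun x => K ^ 2 * h ^ 4 / 4 * v x ^ 2) :=
    contDiff_const.mul (hv.pow 2)
  have cbulk : ContDiff ℝ ∞ (fun x => 4 * h ^ 3 * hessForm ψ v v x
      + 4 * h * hessForm ψ ψ ψ x * v x ^ 2 - h ^ 3 * laplace (laplace ψ) x * v x ^ 2) :=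
    ((contDiff_const.mul (hessForm_smooth hψ hv hv)).add
      ((contDiff_const.mul (hessForm_smooth hψ hψ hψ)).mul (hv.pow 2))).sub
      ((contDiff_const.mul (laplace_smooth (laplace_smooth hψ))).mul (hv.pow 2))
  -- `A² ≥ K h² A v - K² h⁴ v² / 4` turns `‖Av‖²` into the gradient term
  have s1 : (∫ x in Ω, 2 * (symPart h ψ v x * skewPart h ψ v x))
      + K * h ^ 2 * (∫ x in Ω, symPart h ψ v x * v x)
      - (∫ x in Ω, K ^ 2 * h ^ 4 / 4 * v x ^ 2)
      ≤ ∫ x in Ω, (symPart h ψ v x + skewPart h ψ v x) ^ 2 := by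
    rw [← integral_const_mul, ← integral_add (I cAB) ((I cAv).const_mul _),
      ← integral_sub ((I cAB).fun_add ((I cAv).const_mul _)) (I cv)]
    refine integral_mono (((I cAB).fun_add ((I cAv).const_mul _)).fun_sub (I cv))
      (I ((hA.add hB).pow 2)) fun x => ?_
    nlinarith [sq_nonneg (symPart h ψ v x - K * h ^ 2 / 2 * v x), sq_nonneg (skewPart h ψ v x)]
  have s2 : ∫ x in Ω, (h ^ 4 * gradDot v v x
        + h ^ 2 * (1 / ε - 16 * k₂ - k₄ - K ^ 2 / 4 - 4 * K) * v x ^ 2) ≤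
      (∫ x in Ω, (4 * h ^ 3 * hessForm ψ v v x + 4 * h * hessForm ψ ψ ψ x * v x ^ 2
        - h ^ 3 * laplace (laplace ψ) x * v x ^ 2))
      + K * h ^ 2 * (∫ x in Ω, (h ^ 2 * gradDot v v x - gradDot ψ ψ x * v x ^ 2))
      - (∫ x in Ω, K ^ 2 * h ^ 4 / 4 * v x ^ 2) := by
    rw [← integral_const_mul, ← integral_add (I cbulk) ((I cg).const_mul _),
      ← integral_sub ((I cbulk).fun_add ((I cg).const_mul _)) (I cv)]
    refine setIntegral_mono_on (I ((contDiff_const.mul hvv).add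
      (contDiff_const.mul (hv.pow 2)))) (((I cbulk).fun_add ((I cg).const_mul _)).fun_sub (I cv))
      hΩ.measurableSet fun x hx => ?_
    have a1 := mul_le_mul_of_nonneg_left (hess1 x hx) (by positivity : 0 ≤ 4 * h ^ 3)
    have a2 := mul_le_mul_of_nonneg_left (hess2 x hx)
      (by positivity : 0 ≤ 4 * h * v x ^ 2)
    have a3 := mul_le_mul_of_nonneg_left (hlap x hx) (by positivity : 0 ≤ h ^ 3 * v x ^ 2)
    have a4 := mul_le_mul_of_nonneg_left (hgrad x hx)
      (by positivity : 0 ≤ K * h ^ 2 * v x ^ 2)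
    have h42 : h ^ 4 ≤ h ^ 2 := pow_le_pow_of_le_one h0.le h1 (by norm_num)
    have a5 := mul_le_mul_of_nonneg_right h42
      (by positivity : 0 ≤ (k₄ + K ^ 2 / 4) * v x ^ 2)
    have e3 : 4 * h * v x ^ 2 * (h / (4 * ε) - 4 * h * k₂) =
        h ^ 2 * (1 / ε) * v x ^ 2 - 16 * h ^ 2 * k₂ * v x ^ 2 := by
      by_cases hε : ε = 0
      · subst hε; simp; ring
      · field_simp; ring
    rw [e3] at a2
    have e4 : K * h ^ 2 * (h ^ 2 * gradDot v v x) =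
        4 * k₂ * h ^ 4 * gradDot v v x + h ^ 4 * gradDot v v x := by rw [hK]; ring
    linear_combination a1 + a2 + a3 + a4 + a5 - e4
  rw [e2] at s1
  linarith

end Identity

/-! ### The convexified weight -/

section Weight

variable {n : ℕ} {α : EuclideanSpace ℝ (Fin n)} {κ : EuclideanSpace ℝ (Fin n) → ℝ} {ε h : ℝ}

theorem linearWeight_smooth (α : EuclideanSpace ℝ (Fin n)) : ContDiff ℝ ∞ (linearWeight α) :=
  contDiff_const.inner ℝ contDiff_id

theorem dirDeriv_linearWeight (α v x : EuclideanSpace ℝ (Fin n)) :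
    dirDeriv v (linearWeight α) x = ⟪α, v⟫ := by
  have : HasFDerivAt (linearWeight α) (innerSL ℝ α) x := (innerSL ℝ α).hasFDerivAt
  rw [dirDeriv, this.fderiv, innerSL_apply_apply]

theorem dirDeriv_basisVec_linearWeight (α x : EuclideanSpace ℝ (Fin n)) (j : Fin n) :
    dirDeriv (basisVec j) (linearWeight α) x = α j := by
  rw [dirDeriv_linearWeight, EuclideanSpace.inner_single_right]
  simp

theorem gradDot_linearWeight_self (hα : ‖α‖ = 1) (x : EuclideanSpace ℝ (Fin n)) :
    gradDot (linearWeight α) (linearWeight α) x = 1 := by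
  have h2 : ‖α‖ ^ 2 = 1 := by rw [hα, one_pow]
  rw [EuclideanSpace.real_norm_sq_eq] at h2
  simpa only [gradDot, dirDeriv_basisVec_linearWeight, ← sq] using h2

/-- The convexified weight is `φ + h g` with `g = φ² / (2ε) + κ`; conjugation with `e^g` relates
the operators conjugated with `φ` and with `φ_ε`. -/
def weightCorrection (α : EuclideanSpace ℝ (Fin n)) (κ : EuclideanSpace ℝ (Fin n) → ℝ)
    (ε : ℝ) (x : EuclideanSpace ℝ (Fin n)) : ℝ :=
  linearWeight α x ^ 2 / (2 * ε) + κ x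

theorem convexifiedWeight_eq (x : EuclideanSpace ℝ (Fin n)) :
    convexifiedWeight α κ ε h x = linearWeight α x + h * weightCorrection α κ ε x := by
  rw [convexifiedWeight, weightCorrection]
  ring

theorem weightCorrection_smooth (hκ : ContDiff ℝ ∞ κ) :
    ContDiff ℝ ∞ (weightCorrection α κ ε) :=
  (((linearWeight_smooth α).pow 2).div_const _).add hκ

theorem convexifiedWeight_smooth (hκ : ContDiff ℝ ∞ κ) :
    ContDiff ℝ ∞ (convexifiedWeight α κ ε h) := by
  rw [funext fun x => convexifiedWeight_eq (α := α) (κ := κ) (ε := ε) (h := h) x]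
  exact (linearWeight_smooth α).add (contDiff_const.mul (weightCorrection_smooth hκ))

theorem dirDeriv_const_mul {f : EuclideanSpace ℝ (Fin n) → ℝ} (c : ℝ)
    {x : EuclideanSpace ℝ (Fin n)} (hf : DifferentiableAt ℝ f x) (v : EuclideanSpace ℝ (Fin n)) :
    dirDeriv v (fun y => c * f y) x = c * dirDeriv v f x := by
  simp [dirDeriv, fderiv_const_mul hf]

theorem dirDeriv_const_add {f : EuclideanSpace ℝ (Fin n) → ℝ} (c : ℝ)
    (x v : EuclideanSpace ℝ (Fin n)) :
    dirDeriv v (fun y => c + f y) x = dirDeriv v f x := by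
  simp [dirDeriv]

theorem dirDeriv_convexifiedWeight (hκ : ContDiff ℝ ∞ κ) (j : Fin n)
    (x : EuclideanSpace ℝ (Fin n)) :
    dirDeriv (basisVec j) (convexifiedWeight α κ ε h) x =
      α j + h / ε * α j * linearWeight α x + h * dirDeriv (basisVec j) κ x := by
  have hφ := smooth_differentiable (linearWeight_smooth α)
  have hκd := smooth_differentiable hκ
  have hφφ : Differentiable ℝ fun y => linearWeight α y * linearWeight α y := hφ.mul hφ
  have heq : convexifiedWeight α κ ε h = fun y => (linearWeight α y
      + (h / ε / 2) * (linearWeight α y * linearWeight α y)) + h * κ y := by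
    funext y
    rw [convexifiedWeight]
    ring
  rw [heq, dirDeriv_add ((hφ x).fun_add ((hφφ x).const_mul _)) ((hκd x).const_mul h),
    dirDeriv_add (hφ x) ((hφφ x).const_mul _), dirDeriv_const_mul _ (hφφ x),
    dirDeriv_const_mul _ (hκd x), dirDeriv_mul (hφ x) (hφ x), dirDeriv_basisVec_linearWeight]
  ring

theorem dirDeriv_dirDeriv_convexifiedWeight (hκ : ContDiff ℝ ∞ κ) (i j : Fin n)
    (x : EuclideanSpace ℝ (Fin n)) :
    dirDeriv (basisVec i) (dirDeriv (basisVec j) (convexifiedWeight α κ ε h)) x =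
      h / ε * α i * α j + h * dirDeriv (basisVec i) (dirDeriv (basisVec j) κ) x := by
  have hφ := smooth_differentiable (linearWeight_smooth α)
  have hκd := smooth_differentiable (dirDeriv_smooth hκ (basisVec j))
  rw [funext fun x => dirDeriv_convexifiedWeight (α := α) (ε := ε) (h := h) hκ j x,
    dirDeriv_add (((hφ x).const_mul _).const_add _) ((hκd x).const_mul h),
    dirDeriv_const_add, dirDeriv_const_mul _ (hφ x), dirDeriv_const_mul _ (hκd x),
    dirDeriv_basisVec_linearWeight]
  ring

theorem laplace_convexifiedWeight (hα : ‖α‖ = 1) (hκ : ContDiff ℝ ∞ κ)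
    (x : EuclideanSpace ℝ (Fin n)) :
    laplace (convexifiedWeight α κ ε h) x = h / ε + h * laplace κ x := by
  have h2 := gradDot_linearWeight_self hα x
  simp only [gradDot, dirDeriv_basisVec_linearWeight] at h2
  simp only [laplace, dirDeriv_dirDeriv_convexifiedWeight hκ, Finset.sum_add_distrib,
    ← Finset.mul_sum, mul_assoc, h2, mul_one]

theorem laplace_laplace_convexifiedWeight (hα : ‖α‖ = 1) (hκ : ContDiff ℝ ∞ κ)
    (x : EuclideanSpace ℝ (Fin n)) :
    laplace (laplace (convexifiedWeight α κ ε h)) x = h * laplace (laplace κ) x := by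
  have hL := laplace_smooth hκ
  rw [funext fun y => laplace_convexifiedWeight (ε := ε) (h := h) hα hκ y]
  rw [laplace, laplace, Finset.mul_sum]
  refine Finset.sum_congr rfl fun j _ => ?_
  have : dirDeriv (basisVec j) (fun y => h / ε + h * laplace κ y) =
      fun y => h * dirDeriv (basisVec j) (laplace κ) y := by
    funext y
    rw [dirDeriv_const_add, dirDeriv_const_mul _ (smooth_differentiable hL y)]
  rw [this, dirDeriv_const_mul _ (smooth_differentiable (dirDeriv_smooth hL _) x)]

theorem hessForm_convexifiedWeight (hκ : ContDiff ℝ ∞ κ)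
    (f : EuclideanSpace ℝ (Fin n) → ℝ) (x : EuclideanSpace ℝ (Fin n)) :
    hessForm (convexifiedWeight α κ ε h) f f x =
      h / ε * gradDot (linearWeight α) f x ^ 2 + h * hessForm κ f f x := by
  rw [sq]
  simp only [hessForm, gradDot, dirDeriv_dirDeriv_convexifiedWeight hκ,
    dirDeriv_basisVec_linearWeight, Finset.mul_sum, Finset.sum_mul, ← Finset.sum_add_distrib]
  rw [Finset.sum_comm]
  refine Finset.sum_congr rfl fun i _ => Finset.sum_congr rfl fun j _ => ?_
  rw [dirDeriv_comm hκ]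
  ring

theorem gradDot_linearWeight_convexifiedWeight (hα : ‖α‖ = 1) (hκ : ContDiff ℝ ∞ κ)
    (x : EuclideanSpace ℝ (Fin n)) :
    gradDot (linearWeight α) (convexifiedWeight α κ ε h) x =
      1 + h / ε * linearWeight α x + h * gradDot (linearWeight α) κ x := by
  rw [← gradDot_linearWeight_self hα x]
  conv_rhs => rw [← mul_one (h / ε * linearWeight α x), ← gradDot_linearWeight_self hα x]
  simp only [gradDot, dirDeriv_convexifiedWeight hκ, dirDeriv_basisVec_linearWeight,
    Finset.mul_sum, ← Finset.sum_add_distrib]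
  refine Finset.sum_congr rfl fun j _ => ?_
  ring

theorem gradDot_convexifiedWeight_self (hα : ‖α‖ = 1) (hκ : ContDiff ℝ ∞ κ)
    (x : EuclideanSpace ℝ (Fin n)) :
    gradDot (convexifiedWeight α κ ε h) (convexifiedWeight α κ ε h) x =
      (1 + h / ε * linearWeight α x) ^ 2
      + 2 * (1 + h / ε * linearWeight α x) * (h * gradDot (linearWeight α) κ x)
      + h ^ 2 * gradDot κ κ x := by
  set c := 1 + h / ε * linearWeight α x with hc
  have hd : ∀ j, dirDeriv (basisVec j) (convexifiedWeight α κ ε h) x =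
      c * α j + h * dirDeriv (basisVec j) κ x := fun j => by
    rw [dirDeriv_convexifiedWeight hκ, hc]
    ring
  rw [← mul_one (c ^ 2), ← gradDot_linearWeight_self hα x]
  simp only [gradDot, hd, dirDeriv_basisVec_linearWeight,
    Finset.mul_sum, ← Finset.sum_add_distrib]
  refine Finset.sum_congr rfl fun j _ => ?_
  ring

/-- The sum of the absolute values of the second derivatives, a bound for the Hessian. -/
def hessBound (f : EuclideanSpace ℝ (Fin n) → ℝ) (x : EuclideanSpace ℝ (Fin n)) : ℝ :=
  ∑ i, ∑ j, |dirDeriv (basisVec i) (dirDeriv (basisVec j) f) x|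

theorem hessBound_continuous {f : EuclideanSpace ℝ (Fin n) → ℝ} (hf : ContDiff ℝ ∞ f) :
    Continuous (hessBound f) :=
  continuous_finsetSum _ fun _ _ => continuous_finsetSum _ fun _ _ =>
    (dirDeriv_smooth (dirDeriv_smooth hf _) _).continuous.abs

theorem abs_hessForm_le (f v : EuclideanSpace ℝ (Fin n) → ℝ) (x : EuclideanSpace ℝ (Fin n)) :
    |hessForm f v v x| ≤ hessBound f x * gradDot v v x := by
  have hle : ∀ j, dirDeriv (basisVec j) v x ^ 2 ≤ gradDot v v x := fun j => by
    rw [sq]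
    exact Finset.single_le_sum (f := fun j => dirDeriv (basisVec j) v x * dirDeriv (basisVec j) v x)
      (fun _ _ => mul_self_nonneg _) (Finset.mem_univ j)
  rw [hessForm, hessBound, Finset.sum_mul]
  refine (Finset.abs_sum_le_sum_abs _ _).trans (Finset.sum_le_sum fun i _ => ?_)
  rw [Finset.sum_mul]
  refine (Finset.abs_sum_le_sum_abs _ _).trans (Finset.sum_le_sum fun j _ => ?_)
  rw [mul_assoc, abs_mul]
  refine mul_le_mul_of_nonneg_left ?_ (abs_nonneg _)
  refine abs_le.2 ⟨?_, ?_⟩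
  · nlinarith [hle i, hle j, sq_nonneg (dirDeriv (basisVec i) v x + dirDeriv (basisVec j) v x)]
  · nlinarith [hle i, hle j, sq_nonneg (dirDeriv (basisVec i) v x - dirDeriv (basisVec j) v x)]

/-- `|∇φ_ε| ≤ 2` and `φ_ε''(∇φ_ε, ∇φ_ε) ≥ h/(4ε) - O(h)` for small `h / ε` and `h`. -/
theorem convexifiedWeight_bounds (hα : ‖α‖ = 1) (hκ : ContDiff ℝ ∞ κ) (h0 : 0 < h) (hε : 0 < ε)
    {k₁ k₂ : ℝ} (hk₁ : 0 ≤ k₁) (hk₂ : 0 ≤ k₂) (hhk : h * k₁ ≤ 1 / 4)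
    {x : EuclideanSpace ℝ (Fin n)} (hφ : |h / ε * linearWeight α x| ≤ 1 / 4)
    (hκ1 : gradDot κ κ x ≤ k₁ ^ 2) (hκ2 : hessBound κ x ≤ k₂) :
    gradDot (convexifiedWeight α κ ε h) (convexifiedWeight α κ ε h) x ≤ 4 ∧
    h / (4 * ε) - 4 * h * k₂ ≤ hessForm (convexifiedWeight α κ ε h) (convexifiedWeight α κ ε h)
      (convexifiedWeight α κ ε h) x := by
  set a := h / ε * linearWeight α x
  have ha := abs_le.1 hφ
  have hcs : |h * gradDot (linearWeight α) κ x| ≤ 1 / 4 := by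
    have h1 := gradDot_sq_le (linearWeight α) κ x
    rw [gradDot_linearWeight_self hα, one_mul] at h1
    have h2 : |gradDot (linearWeight α) κ x| ≤ k₁ :=
      abs_le_of_sq_le_sq (h1.trans hκ1) hk₁
    rw [abs_mul, abs_of_pos h0]
    exact (mul_le_mul_of_nonneg_left h2 h0.le).trans hhk
  have hb := abs_le.1 hcs
  set b := h * gradDot (linearWeight α) κ x
  have hk : h ^ 2 * gradDot κ κ x ≤ 1 / 16 := by
    calc h ^ 2 * gradDot κ κ x ≤ h ^ 2 * k₁ ^ 2 := by gcongr
      _ = (h * k₁) ^ 2 := by ring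
      _ ≤ (1 / 4) ^ 2 := by gcongr
      _ = 1 / 16 := by norm_num
  have hgrad : gradDot (convexifiedWeight α κ ε h) (convexifiedWeight α κ ε h) x ≤ 4 := by
    rw [gradDot_convexifiedWeight_self hα hκ]
    nlinarith [ha.1, ha.2, hb.1, hb.2]
  refine ⟨hgrad, ?_⟩
  rw [hessForm_convexifiedWeight hκ, gradDot_linearWeight_convexifiedWeight hα hκ]
  have hsq : 1 / 4 ≤ (1 + a + b) ^ 2 := by nlinarith [ha.1, hb.1]
  have h1 : h / (4 * ε) ≤ h / ε * (1 + a + b) ^ 2 := by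
    have : h / (4 * ε) = h / ε * (1 / 4) := by field_simp
    rw [this]
    gcongr
  have h2 := (abs_le.1 (abs_hessForm_le κ (convexifiedWeight α κ ε h) x)).1
  have h3 : hessBound κ x * gradDot (convexifiedWeight α κ ε h) (convexifiedWeight α κ ε h) x
      ≤ k₂ * 4 := mul_le_mul hκ2 hgrad (gradDot_self_nonneg _ _) hk₂
  have h4 : h * (-(k₂ * 4)) ≤ h * hessForm κ (convexifiedWeight α κ ε h)
      (convexifiedWeight α κ ε h) x := mul_le_mul_of_nonneg_left (by linarith) h0.le
  linarith

/-- The term `φ² / (2ε)` is convex, so only the Hessian of `κ` can be negative. -/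
theorem convexifiedWeight_hess_lower (hκ : ContDiff ℝ ∞ κ) (h0 : 0 < h) (hε : 0 < ε) {k₂ : ℝ}
    (v : EuclideanSpace ℝ (Fin n) → ℝ) {x : EuclideanSpace ℝ (Fin n)}
    (hκ2 : hessBound κ x ≤ k₂) :
    -(h * k₂) * gradDot v v x ≤ hessForm (convexifiedWeight α κ ε h) v v x := by
  rw [hessForm_convexifiedWeight hκ]
  have h1 := (abs_le.1 (abs_hessForm_le κ v x)).1
  have h2 := mul_le_mul_of_nonneg_right hκ2 (gradDot_self_nonneg v x)
  have h3 : h * (-(k₂ * gradDot v v x)) ≤ h * hessForm κ v v x :=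
    mul_le_mul_of_nonneg_left (by linarith) h0.le
  have h4 : 0 ≤ h / ε * gradDot (linearWeight α) v x ^ 2 := by positivity
  linarith

end Weight

/-! ### Conjugation with exponential weights -/

section Conjugation

variable {n : ℕ}

theorem exp_smooth {f : EuclideanSpace ℝ (Fin n) → ℝ} (hf : ContDiff ℝ ∞ f) :
    ContDiff ℝ ∞ (fun y => Real.exp (f y)) :=
  Real.contDiff_exp.comp hf

theorem dirDeriv_exp_mul {f r : EuclideanSpace ℝ (Fin n) → ℝ} (hf : ContDiff ℝ ∞ f)
    (hr : ContDiff ℝ ∞ r) (v x : EuclideanSpace ℝ (Fin n)) :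
    dirDeriv v (fun y => Real.exp (f y) * r y) x =
      Real.exp (f x) * (dirDeriv v r x + dirDeriv v f x * r x) := by
  have hfd := smooth_differentiable hf x
  rw [dirDeriv_mul (smooth_differentiable (exp_smooth hf) x) (smooth_differentiable hr x),
    dirDeriv_comp hfd Real.differentiable_exp.differentiableAt, Real.deriv_exp]
  ring

/-- `e^{ψ/h} (-h²Δ) e^{-ψ/h}` is the sum of its symmetric and antisymmetric parts. -/
theorem laplace_exp_mul {ψ r : EuclideanSpace ℝ (Fin n) → ℝ} (hψ : ContDiff ℝ ∞ ψ)
    (hr : ContDiff ℝ ∞ r) {h : ℝ} (h0 : 0 < h) (x : EuclideanSpace ℝ (Fin n)) :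
    -h ^ 2 * laplace (fun y => Real.exp (-ψ y / h) * r y) x =
      Real.exp (-ψ x / h) * (symPart h ψ r x + skewPart h ψ r x) := by
  have hf : ContDiff ℝ ∞ (fun y => -ψ y / h) := hψ.neg.div_const h
  have hfd : ∀ v, dirDeriv v (fun y => -ψ y / h) = fun y => (-1 / h) * dirDeriv v ψ y := by
    intro v
    funext y
    rw [← dirDeriv_const_mul _ (smooth_differentiable hψ y)]
    congr 2
    funext z
    ring
  rw [symPart, skewPart]
  simp only [laplace, gradDot, Finset.mul_sum, Finset.sum_mul, ← Finset.sum_add_distrib,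
    ← Finset.sum_sub_distrib]
  refine Finset.sum_congr rfl fun j _ => ?_
  have hj := dirDeriv_smooth hψ (basisVec j)
  have hrj := dirDeriv_smooth hr (basisVec j)
  have h1 : dirDeriv (basisVec j) (fun y => Real.exp (-ψ y / h) * r y) = fun y =>
      Real.exp (-ψ y / h) * (dirDeriv (basisVec j) r y
        + (-1 / h) * (dirDeriv (basisVec j) ψ y * r y)) := by
    funext y
    rw [dirDeriv_exp_mul hf hr, hfd]
    ring
  have hc : ContDiff ℝ ∞ (fun y => dirDeriv (basisVec j) r y
        + (-1 / h) * (dirDeriv (basisVec j) ψ y * r y)) :=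
    hrj.add (contDiff_const.mul (hj.mul hr))
  rw [h1, dirDeriv_exp_mul hf hc, hfd,
    dirDeriv_add (smooth_differentiable hrj x)
      ((smooth_differentiable (hj.mul hr) x).const_mul _),
    dirDeriv_const_mul _ (smooth_differentiable (hj.mul hr) x),
    dirDeriv_mul (smooth_differentiable hj x) (smooth_differentiable hr x)]
  field_simp
  ring

theorem re_smooth {u : EuclideanSpace ℝ (Fin n) → ℂ} (hu : ContDiff ℝ ∞ u) :
    ContDiff ℝ ∞ (fun y => (u y).re) :=
  Complex.reCLM.contDiff.comp hu

theorem im_smooth {u : EuclideanSpace ℝ (Fin n) → ℂ} (hu : ContDiff ℝ ∞ u) :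
    ContDiff ℝ ∞ (fun y => (u y).im) :=
  Complex.imCLM.contDiff.comp hu

theorem fderiv_complex {u : EuclideanSpace ℝ (Fin n) → ℂ} {x : EuclideanSpace ℝ (Fin n)}
    (hu : DifferentiableAt ℝ u x) (v : EuclideanSpace ℝ (Fin n)) :
    fderiv ℝ u x v = (dirDeriv v (fun y => (u y).re) x : ℂ) +
      (dirDeriv v (fun y => (u y).im) x : ℂ) * Complex.I := by
  have h1 : fderiv ℝ (fun y => (u y).re) x = Complex.reCLM.comp (fderiv ℝ u x) :=
    (Complex.reCLM.hasFDerivAt.comp x hu.hasFDerivAt).fderiv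
  have h2 : fderiv ℝ (fun y => (u y).im) x = Complex.imCLM.comp (fderiv ℝ u x) :=
    (Complex.imCLM.hasFDerivAt.comp x hu.hasFDerivAt).fderiv
  rw [dirDeriv, dirDeriv, h1, h2]
  simp

theorem contDiff_complex {a b : EuclideanSpace ℝ (Fin n) → ℝ} (ha : ContDiff ℝ ∞ a)
    (hb : ContDiff ℝ ∞ b) : ContDiff ℝ ∞ (fun y => (a y : ℂ) + (b y : ℂ) * Complex.I) :=
  (Complex.ofRealCLM.contDiff.comp ha).add
    ((Complex.ofRealCLM.contDiff.comp hb).mul contDiff_const)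

theorem fderiv_ofReal_add {a b : EuclideanSpace ℝ (Fin n) → ℝ} (ha : ContDiff ℝ ∞ a)
    (hb : ContDiff ℝ ∞ b) (x v : EuclideanSpace ℝ (Fin n)) :
    fderiv ℝ (fun y => (a y : ℂ) + (b y : ℂ) * Complex.I) x v =
      (dirDeriv v a x : ℂ) + (dirDeriv v b x : ℂ) * Complex.I := by
  rw [fderiv_complex ((contDiff_complex ha hb).differentiable (by simp) x)]
  simp

theorem semiDSq_ofReal_add {a b : EuclideanSpace ℝ (Fin n) → ℝ} (ha : ContDiff ℝ ∞ a)
    (hb : ContDiff ℝ ∞ b) (h : ℝ) (x : EuclideanSpace ℝ (Fin n)) :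
    semiDSq h (fun y => (a y : ℂ) + (b y : ℂ) * Complex.I) x =
      ((-h ^ 2 * laplace a x : ℝ) : ℂ) + ((-h ^ 2 * laplace b x : ℝ) : ℂ) * Complex.I := by
  have h1 : ∀ j, semiD h j (fun y => (a y : ℂ) + (b y : ℂ) * Complex.I) = fun y =>
      ((h * dirDeriv (basisVec j) b y : ℝ) : ℂ)
        + ((-h * dirDeriv (basisVec j) a y : ℝ) : ℂ) * Complex.I := by
    intro j
    funext y
    rw [semiD, fderiv_ofReal_add ha hb]
    push_cast
    linear_combination (-(h : ℂ) * (dirDeriv (basisVec j) b y : ℂ)) * Complex.I_sq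
  have h2 : ∀ j, semiD h j (semiD h j (fun y => (a y : ℂ) + (b y : ℂ) * Complex.I)) x =
      -(h : ℂ) ^ 2 * (dirDeriv (basisVec j) (dirDeriv (basisVec j) a) x : ℂ)
        + -(h : ℂ) ^ 2 * (dirDeriv (basisVec j) (dirDeriv (basisVec j) b) x : ℂ) * Complex.I := by
    intro j
    have hA := dirDeriv_smooth ha (basisVec j)
    have hB := dirDeriv_smooth hb (basisVec j)
    rw [h1, semiD, fderiv_ofReal_add (contDiff_const.mul hB) (contDiff_const.mul hA),
      dirDeriv_const_mul _ (smooth_differentiable hA x),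
      dirDeriv_const_mul _ (smooth_differentiable hB x)]
    push_cast
    linear_combination ((h : ℂ) ^ 2 *
      (dirDeriv (basisVec j) (dirDeriv (basisVec j) a) x : ℂ)) * Complex.I_sq
  simp only [semiDSq, h2, laplace]
  push_cast
  rw [Finset.mul_sum, Finset.mul_sum, Finset.sum_mul, ← Finset.sum_add_distrib]

theorem norm_sq_ofReal_add (a b : ℝ) : ‖(a : ℂ) + (b : ℂ) * Complex.I‖ ^ 2 = a ^ 2 + b ^ 2 := by
  rw [Complex.sq_norm, Complex.normSq_add_mul_I]

theorem norm_semiD_sq {u : EuclideanSpace ℝ (Fin n) → ℂ} (hu : ContDiff ℝ ∞ u) (h : ℝ)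
    (j : Fin n) (x : EuclideanSpace ℝ (Fin n)) :
    ‖semiD h j u x‖ ^ 2 = h ^ 2 * (dirDeriv (basisVec j) (fun y => (u y).re) x ^ 2
      + dirDeriv (basisVec j) (fun y => (u y).im) x ^ 2) := by
  rw [semiD, fderiv_complex (hu.differentiable (by simp) x), norm_mul, mul_pow,
    norm_sq_ofReal_add, norm_mul, norm_neg, Complex.norm_I, one_mul, Complex.norm_real,
    Real.norm_eq_abs, sq_abs]

theorem norm_normalDeriv_sq {Ω : Set (EuclideanSpace ℝ (Fin n))}
    {u : EuclideanSpace ℝ (Fin n) → ℂ} (hu : ContDiff ℝ ∞ u) (x : EuclideanSpace ℝ (Fin n)) :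
    ‖normalDeriv Ω u x‖ ^ 2 = normalDeriv Ω (fun y => (u y).re) x ^ 2
      + normalDeriv Ω (fun y => (u y).im) x ^ 2 := by
  rw [normalDeriv, fderiv_complex (hu.differentiable (by simp) x), norm_sq_ofReal_add]
  rfl

/-- The operator conjugated with the linear weight, in terms of the function `e^g u` and the
operator conjugated with the convexified weight `φ + h g`. -/
theorem conjugatedOp_eq {α : EuclideanSpace ℝ (Fin n)} {κ : EuclideanSpace ℝ (Fin n) → ℝ}
    (hκ : ContDiff ℝ ∞ κ) (q : EuclideanSpace ℝ (Fin n) → ℂ)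
    {u : EuclideanSpace ℝ (Fin n) → ℂ} (hu : ContDiff ℝ ∞ u) {ε h : ℝ} (h0 : 0 < h)
    {r s : EuclideanSpace ℝ (Fin n) → ℝ}
    (hr : r = fun y => Real.exp (weightCorrection α κ ε y) * (u y).re)
    (hs : s = fun y => Real.exp (weightCorrection α κ ε y) * (u y).im)
    (x : EuclideanSpace ℝ (Fin n)) :
    conjugatedOp h (linearWeight α) q u x =
      (Real.exp (-weightCorrection α κ ε x) : ℂ) *
        ((((symPart h (convexifiedWeight α κ ε h) r x
            + skewPart h (convexifiedWeight α κ ε h) r x : ℝ) : ℂ)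
          + ((symPart h (convexifiedWeight α κ ε h) s x
            + skewPart h (convexifiedWeight α κ ε h) s x : ℝ) : ℂ) * Complex.I)
          + (h : ℂ) ^ 2 * q x * ((r x : ℂ) + (s x : ℂ) * Complex.I)) := by
  have hg := weightCorrection_smooth (α := α) (ε := ε) hκ
  have hψ := convexifiedWeight_smooth (α := α) (ε := ε) (h := h) hκ
  have hrs : ContDiff ℝ ∞ r := by rw [hr]; exact (exp_smooth hg).mul (re_smooth hu)
  have hss : ContDiff ℝ ∞ s := by rw [hs]; exact (exp_smooth hg).mul (im_smooth hu)
  have hE : ContDiff ℝ ∞ (fun y => Real.exp (-convexifiedWeight α κ ε h y / h)) :=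
    exp_smooth (hψ.neg.div_const h)
  have hexp : ∀ y, Real.exp (-linearWeight α y / h) =
      Real.exp (-convexifiedWeight α κ ε h y / h) * Real.exp (weightCorrection α κ ε y) := by
    intro y
    rw [← Real.exp_add, convexifiedWeight_eq]
    congr 1
    field_simp
    ring
  have hv : (fun y => (Real.exp (-linearWeight α y / h) : ℂ) * u y) = fun y =>
      ((Real.exp (-convexifiedWeight α κ ε h y / h) * r y : ℝ) : ℂ)
        + ((Real.exp (-convexifiedWeight α κ ε h y / h) * s y : ℝ) : ℂ) * Complex.I := by
    funext y
    rw [hexp y, hr, hs]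
    conv_lhs => rw [← Complex.re_add_im (u y)]
    push_cast
    ring
  have hfin : Real.exp (linearWeight α x / h) * Real.exp (-convexifiedWeight α κ ε h x / h) =
      Real.exp (-weightCorrection α κ ε x) := by
    rw [← Real.exp_add, convexifiedWeight_eq]
    congr 1
    field_simp
    ring
  have hvx := congrFun hv x
  simp only [conjugatedOp]
  rw [hvx, hv, semiDSq_ofReal_add (hE.mul hrs) (hE.mul hss), laplace_exp_mul hψ hrs h0,
    laplace_exp_mul hψ hss h0, ← hfin]
  push_cast
  ring

end Conjugation

/-! ### The Carleman estimate for the convexified weight -/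

section Estimates

theorem exists_bound_on_closure {n : ℕ} {Ω : Set (EuclideanSpace ℝ (Fin n))}
    (hb : Bornology.IsBounded Ω) {F : Type*} [NormedAddCommGroup F]
    {f : EuclideanSpace ℝ (Fin n) → F} (hf : Continuous f) :
    ∃ M, 0 ≤ M ∧ ∀ x ∈ closure Ω, ‖f x‖ ≤ M := by
  obtain ⟨M, hM⟩ := hb.isCompact_closure.exists_bound_of_continuousOn hf.continuousOn
  exact ⟨max M 0, le_max_right _ _, fun x hx => (hM x hx).trans (le_max_left _ _)⟩

variable {m : ℕ} {Ω : Set (EuclideanSpace ℝ (Fin (m + 1)))}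
  {σ : Measure (EuclideanSpace ℝ (Fin (m + 1)))} {α : EuclideanSpace ℝ (Fin (m + 1))}
  {κ : EuclideanSpace ℝ (Fin (m + 1)) → ℝ}

/-- By taking `ε` small the coefficient of `h²‖v‖²` becomes as large as desired, which leaves room
for the potential. -/
theorem exists_carleman_real (hΩ : IsOpen Ω) (hb : Bornology.IsBounded Ω)
    (hs : HasSmoothBoundary Ω) (hσ : IsBoundaryMeasure Ω σ) (hα : ‖α‖ = 1)
    (hκ : ContDiff ℝ ∞ κ) {Q : ℝ} (hQ : 0 ≤ Q) :
    ∃ ε h₀ : ℝ, 0 < ε ∧ 0 < h₀ ∧ h₀ ≤ ε ∧ ε ≤ 1 ∧ ∀ h : ℝ, 0 < h → h ≤ h₀ →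
      ∀ v : EuclideanSpace ℝ (Fin (m + 1)) → ℝ, ContDiff ℝ ∞ v → (∀ x ∈ frontier Ω, v x = 0) →
        ∫ x in Ω, (h ^ 4 * gradDot v v x + h ^ 2 * (1 + Q) * v x ^ 2) ≤
          (∫ x in Ω, (symPart h (convexifiedWeight α κ ε h) v x
            + skewPart h (convexifiedWeight α κ ε h) v x) ^ 2)
          + 2 * h ^ 3 * ∫ x, normalDeriv Ω (convexifiedWeight α κ ε h) x
              * normalDeriv Ω v x ^ 2 ∂σ := by
  obtain ⟨R, hR0, hR⟩ := exists_bound_on_closure hb (linearWeight_smooth α).continuous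
  obtain ⟨k₁', hk₁0, hk₁⟩ := exists_bound_on_closure hb (gradDot_smooth hκ hκ).continuous
  obtain ⟨k₂, hk₂0, hk₂⟩ := exists_bound_on_closure hb (hessBound_continuous hκ)
  obtain ⟨k₄, hk₄0, hk₄⟩ := exists_bound_on_closure hb
    (laplace_smooth (laplace_smooth hκ)).continuous
  set k₁ := Real.sqrt k₁' with hk₁def
  have hk₁sq : k₁ ^ 2 = k₁' := Real.sq_sqrt hk₁0
  have hk₁nn : 0 ≤ k₁ := Real.sqrt_nonneg _
  set K := 4 * k₂ + 1 with hK
  have hK0 : 0 ≤ K := by positivity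
  set A := 16 * k₂ + k₄ + K ^ 2 / 4 + 4 * K + 1 + Q with hA
  have hA1 : 1 ≤ A := by
    have : 0 ≤ 16 * k₂ + k₄ + K ^ 2 / 4 + 4 * K + Q := by positivity
    linarith
  have hA0 : 0 < A := by linarith
  have hε : 0 < 1 / A := by positivity
  refine ⟨1 / A, min (1 / A / (4 * (R + 1))) (min (1 / A) (1 / (4 * (k₁ + 1)))), hε,
    lt_min (by positivity) (lt_min hε (by positivity)),
    (min_le_right _ _).trans (min_le_left _ _), (div_le_one hA0).2 hA1, ?_⟩
  intro h h0 hh v hv hv0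
  have hh1 : h ≤ 1 / A / (4 * (R + 1)) := hh.trans (min_le_left _ _)
  have hh2 : h ≤ 1 / A := hh.trans ((min_le_right _ _).trans (min_le_left _ _))
  have hh3 : h ≤ 1 / (4 * (k₁ + 1)) := hh.trans ((min_le_right _ _).trans (min_le_right _ _))
  have hle1 : h ≤ 1 := hh2.trans ((div_le_one hA0).2 hA1)
  have hhk : h * k₁ ≤ 1 / 4 := by
    rw [le_div_iff₀ (by positivity)] at hh3
    nlinarith
  have hφ : ∀ x ∈ Ω, |h / (1 / A) * linearWeight α x| ≤ 1 / 4 := by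
    intro x hx
    have h1 : |linearWeight α x| ≤ R := by simpa using hR x (subset_closure hx)
    rw [le_div_iff₀ (by positivity)] at hh1
    have h2 : h / (1 / A) * (4 * (R + 1)) ≤ 1 := by
      rw [div_mul_eq_mul_div, div_le_one hε]; exact hh1
    have h3 : 0 ≤ h / (1 / A) := by positivity
    rw [abs_mul, abs_of_nonneg h3]
    nlinarith [mul_le_mul_of_nonneg_left h1 h3]
  have hκ1 : ∀ x ∈ Ω, gradDot κ κ x ≤ k₁ ^ 2 := fun x hx => by
    rw [hk₁sq]; exact (le_abs_self _).trans (hk₁ x (subset_closure hx))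
  have hκ2 : ∀ x ∈ Ω, hessBound κ x ≤ k₂ := fun x hx =>
    (le_abs_self _).trans (hk₂ x (subset_closure hx))
  have main := carleman_real hΩ hb hs hσ (ε := 1 / A) h0 hle1 hk₂0 hk₄0 hK
    (convexifiedWeight_smooth (α := α) (ε := 1 / A) (h := h) hκ) hv hv0
    (fun x hx => convexifiedWeight_hess_lower hκ h0 hε v (hκ2 x hx))
    (fun x hx => (convexifiedWeight_bounds hα hκ h0 hε hk₁nn hk₂0 hhk (hφ x hx) (hκ1 x hx)
      (hκ2 x hx)).2)
    (fun x hx => by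
      rw [laplace_laplace_convexifiedWeight hα hκ]
      exact mul_le_mul_of_nonneg_left ((le_abs_self _).trans (hk₄ x (subset_closure hx))) h0.le)
    (fun x hx => (convexifiedWeight_bounds hα hκ h0 hε hk₁nn hk₂0 hhk (hφ x hx) (hκ1 x hx)
      (hκ2 x hx)).1)
  have hcoef : 1 / (1 / A) - 16 * k₂ - k₄ - K ^ 2 / 4 - 4 * K = 1 + Q := by
    rw [one_div_one_div, hA]; ring
  rwa [hcoef] at main

theorem integrableOn_norm_sq_add_mul (hΩ : IsOpen Ω) (hb : Bornology.IsBounded Ω)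
    {c d q : EuclideanSpace ℝ (Fin (m + 1)) → ℂ} (hc : Continuous c) (hd : Continuous d)
    (hq : AEStronglyMeasurable q (volume.restrict Ω)) {Q : ℝ}
    (hQ : ∀ᵐ x ∂(volume.restrict Ω), ‖q x‖ ≤ Q) :
    IntegrableOn (fun x => ‖c x + d x * q x‖ ^ 2) Ω := by
  obtain ⟨M, hM0, hM⟩ := exists_bound_on_closure hb hc
  obtain ⟨N, hN0, hN⟩ := exists_bound_on_closure hb hd
  have : IsFiniteMeasure (volume.restrict Ω) := ⟨by simpa using hb.measure_lt_top⟩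
  refine Integrable.of_bound
    ((hc.aestronglyMeasurable.add (hd.aestronglyMeasurable.mul hq)).norm.pow 2)
    ((M + N * Q) ^ 2) ?_
  filter_upwards [hQ, ae_restrict_mem hΩ.measurableSet] with x hx hxΩ
  rw [Real.norm_eq_abs, abs_of_nonneg (by positivity)]
  refine pow_le_pow_left₀ (norm_nonneg _) ((norm_add_le _ _).trans ?_) 2
  rw [norm_mul]
  exact add_le_add (hM x (subset_closure hxΩ))
    (mul_le_mul (hN x (subset_closure hxΩ)) hx (norm_nonneg _) hN0)

theorem contDiff_exp_mul {g a : EuclideanSpace ℝ (Fin (m + 1)) → ℝ} (hg : ContDiff ℝ ∞ g)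
    (ha : ContDiff ℝ ∞ a) : ContDiff ℝ ∞ (fun y => Real.exp (g y) * a y) :=
  (exp_smooth hg).mul ha

/-- The passage from real functions and the free operator to complex functions and the operator
with a bounded potential, in terms of `r + i s = e^g u`. -/
theorem carleman_complex (hΩ : IsOpen Ω) (hb : Bornology.IsBounded Ω) (hκ : ContDiff ℝ ∞ κ)
    {q : EuclideanSpace ℝ (Fin (m + 1)) → ℂ} (hq : AEStronglyMeasurable q (volume.restrict Ω))
    {Q : ℝ} (hQ : ∀ᵐ x ∂(volume.restrict Ω), ‖q x‖ ≤ Q) {ε h M : ℝ} (h0 : 0 < h) (h1 : h ≤ 1)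
    (hM : ∀ x ∈ closure Ω, |weightCorrection α κ ε x| ≤ M) (hσ : IsBoundaryMeasure Ω σ)
    (hreal : ∀ v : EuclideanSpace ℝ (Fin (m + 1)) → ℝ, ContDiff ℝ ∞ v →
      (∀ x ∈ frontier Ω, v x = 0) →
        ∫ x in Ω, (h ^ 4 * gradDot v v x + h ^ 2 * (1 + 2 * Q ^ 2) * v x ^ 2) ≤
          (∫ x in Ω, (symPart h (convexifiedWeight α κ ε h) v x
            + skewPart h (convexifiedWeight α κ ε h) v x) ^ 2)
          + 2 * h ^ 3 * ∫ x, normalDeriv Ω (convexifiedWeight α κ ε h) x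
              * normalDeriv Ω v x ^ 2 ∂σ)
    {u : EuclideanSpace ℝ (Fin (m + 1)) → ℂ} (hu : ContDiff ℝ ∞ u)
    (hu0 : ∀ x ∈ frontier Ω, u x = 0) {r s : EuclideanSpace ℝ (Fin (m + 1)) → ℝ}
    (hr : r = fun y => Real.exp (weightCorrection α κ ε y) * (u y).re)
    (hs : s = fun y => Real.exp (weightCorrection α κ ε y) * (u y).im) :
    h ^ 2 * ∫ x in Ω, (h ^ 2 * (gradDot r r x + gradDot s s x) + (r x ^ 2 + s x ^ 2)) ≤
      2 * Real.exp M ^ 2 * normSqL2 Ω (conjugatedOp h (linearWeight α) q u)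
        + 2 * h ^ 3 * ∫ x, normalDeriv Ω (convexifiedWeight α κ ε h) x
          * (normalDeriv Ω r x ^ 2 + normalDeriv Ω s x ^ 2) ∂σ := by
  have hg := weightCorrection_smooth (α := α) (ε := ε) hκ
  have hrs : ContDiff ℝ ∞ r := by rw [hr]; exact contDiff_exp_mul hg (re_smooth hu)
  have hss : ContDiff ℝ ∞ s := by rw [hs]; exact contDiff_exp_mul hg (im_smooth hu)
  have hr0 : ∀ x ∈ frontier Ω, r x = 0 := fun x hx => by simp [hr, hu0 x hx]
  have hs0 : ∀ x ∈ frontier Ω, s x = 0 := fun x hx => by simp [hs, hu0 x hx]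
  set ψ := convexifiedWeight α κ ε h with hψdef
  have hψ : ContDiff ℝ ∞ ψ := convexifiedWeight_smooth hκ
  set P : (EuclideanSpace ℝ (Fin (m + 1)) → ℝ) → EuclideanSpace ℝ (Fin (m + 1)) → ℝ :=
    fun v x => symPart h ψ v x + skewPart h ψ v x with hP
  have hPs : ∀ {v}, ContDiff ℝ ∞ v → ContDiff ℝ ∞ (P v) := fun hv =>
    (symPart_smooth h hψ hv).add (skewPart_smooth h hψ hv)
  set p : EuclideanSpace ℝ (Fin (m + 1)) → ℂ := fun x => (P r x : ℂ) + (P s x : ℂ) * Complex.I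
    with hp
  set W : EuclideanSpace ℝ (Fin (m + 1)) → ℂ := fun x => (r x : ℂ) + (s x : ℂ) * Complex.I
    with hW
  have hconj : ∀ x, conjugatedOp h (linearWeight α) q u x =
      (Real.exp (-weightCorrection α κ ε x) : ℂ) * (p x + (h : ℂ) ^ 2 * q x * W x) := fun x =>
    conjugatedOp_eq hκ q hu h0 hr hs x
  have hpc : Continuous p := (contDiff_complex (hPs hrs) (hPs hss)).continuous
  have hWc : Continuous W := (contDiff_complex hrs hss).continuous
  have hec : Continuous fun x => (Real.exp (-weightCorrection α κ ε x) : ℂ) :=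
    Complex.continuous_ofReal.comp (exp_smooth hg.neg).continuous
  have hNi : IntegrableOn (fun x => ‖conjugatedOp h (linearWeight α) q u x‖ ^ 2) Ω := by
    have := integrableOn_norm_sq_add_mul hΩ hb (hec.mul hpc)
      (hec.mul ((continuous_const (y := (h : ℂ) ^ 2)).mul hWc)) hq hQ
    refine this.congr_fun (fun x _ => ?_) hΩ.measurableSet
    simp only [hconj, Pi.mul_apply]
    congr 2
    ring
  have I : ∀ {f : EuclideanSpace ℝ (Fin (m + 1)) → ℝ}, ContDiff ℝ ∞ f → IntegrableOn f Ω :=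
    fun hf => integrableOn_of_isBounded hb hf.continuous
  have cv : ∀ {v : EuclideanSpace ℝ (Fin (m + 1)) → ℝ}, ContDiff ℝ ∞ v →
      ContDiff ℝ ∞ (fun x => h ^ 4 * gradDot v v x + h ^ 2 * (1 + 2 * Q ^ 2) * v x ^ 2) :=
    fun hv => (contDiff_const.mul (gradDot_smooth hv hv)).add (contDiff_const.mul (hv.pow 2))
  have cW : ContDiff ℝ ∞ (fun x => 2 * h ^ 2 * Q ^ 2 * (r x ^ 2 + s x ^ 2)) :=
    contDiff_const.mul ((hrs.pow 2).add (hss.pow 2))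
  have e1 : (∫ x in Ω, P r x ^ 2) + (∫ x in Ω, P s x ^ 2) ≤
      2 * Real.exp M ^ 2 * normSqL2 Ω (conjugatedOp h (linearWeight α) q u)
        + ∫ x in Ω, 2 * h ^ 2 * Q ^ 2 * (r x ^ 2 + s x ^ 2) := by
    rw [normSqL2, ← integral_const_mul, ← integral_add (hNi.const_mul _) (I cW),
      ← integral_add (I ((hPs hrs).pow 2)) (I ((hPs hss).pow 2))]
    refine integral_mono_ae ((I ((hPs hrs).pow 2)).fun_add (I ((hPs hss).pow 2)))
      ((hNi.const_mul _).fun_add (I cW)) ?_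
    filter_upwards [hQ, ae_restrict_mem hΩ.measurableSet] with x hqx hxΩ
    have hQ0 : 0 ≤ Q := (norm_nonneg _).trans hqx
    have n1 : ‖p x‖ ^ 2 = P r x ^ 2 + P s x ^ 2 := norm_sq_ofReal_add _ _
    have n2 : ‖W x‖ ^ 2 = r x ^ 2 + s x ^ 2 := norm_sq_ofReal_add _ _
    rw [← n1, ← n2]
    have n3 : ‖p x + (h : ℂ) ^ 2 * q x * W x‖ =
        Real.exp (weightCorrection α κ ε x) * ‖conjugatedOp h (linearWeight α) q u x‖ := by
      rw [hconj, norm_mul, Complex.norm_real, Real.norm_eq_abs, Real.abs_exp, ← mul_assoc,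
        ← Real.exp_add]
      simp
    have n4 : ‖p x + (h : ℂ) ^ 2 * q x * W x‖ ≤
        Real.exp M * ‖conjugatedOp h (linearWeight α) q u x‖ := by
      rw [n3]
      gcongr
      exact (abs_le.1 (hM x (subset_closure hxΩ))).2
    have n5 : ‖(h : ℂ) ^ 2 * q x * W x‖ ≤ h * (Q * ‖W x‖) := by
      rw [norm_mul, norm_mul, norm_pow, Complex.norm_real, Real.norm_eq_abs, abs_of_pos h0,
        mul_assoc]
      have : h ^ 2 ≤ h := by nlinarith
      exact mul_le_mul this (mul_le_mul_of_nonneg_right hqx (norm_nonneg _)) (by positivity) h0.le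
    have n6 : ‖p x‖ ≤ Real.exp M * ‖conjugatedOp h (linearWeight α) q u x‖
        + h * (Q * ‖W x‖) := by
      have := norm_sub_le (p x + (h : ℂ) ^ 2 * q x * W x) ((h : ℂ) ^ 2 * q x * W x)
      rw [add_sub_cancel_right] at this
      linarith
    have n7 := pow_le_pow_left₀ (norm_nonneg _) n6 2
    nlinarith [sq_nonneg (Real.exp M * ‖conjugatedOp h (linearWeight α) q u x‖
      - h * (Q * ‖W x‖))]
  have e2 := hreal r hrs hr0
  have e3 := hreal s hss hs0
  have hνi : ∀ {v : EuclideanSpace ℝ (Fin (m + 1)) → ℝ}, ContDiff ℝ ∞ v →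
      Integrable (fun x => normalDeriv Ω ψ x * normalDeriv Ω v x ^ 2) σ := fun hv =>
    hσ.integrable hb ((continuousOn_normalDeriv hσ.normal_continuousOn hψ).mul
      ((continuousOn_normalDeriv hσ.normal_continuousOn hv).pow 2))
  have e4 : ∫ x, normalDeriv Ω ψ x * (normalDeriv Ω r x ^ 2 + normalDeriv Ω s x ^ 2) ∂σ =
      (∫ x, normalDeriv Ω ψ x * normalDeriv Ω r x ^ 2 ∂σ)
        + ∫ x, normalDeriv Ω ψ x * normalDeriv Ω s x ^ 2 ∂σ := by
    rw [← integral_add (hνi hrs) (hνi hss)]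
    simp only [mul_add]
  have e5 : h ^ 2 * ∫ x in Ω, (h ^ 2 * (gradDot r r x + gradDot s s x) + (r x ^ 2 + s x ^ 2)) =
      (∫ x in Ω, (h ^ 4 * gradDot r r x + h ^ 2 * (1 + 2 * Q ^ 2) * r x ^ 2))
      + (∫ x in Ω, (h ^ 4 * gradDot s s x + h ^ 2 * (1 + 2 * Q ^ 2) * s x ^ 2))
      - ∫ x in Ω, 2 * h ^ 2 * Q ^ 2 * (r x ^ 2 + s x ^ 2) := by
    rw [← integral_const_mul, ← integral_add (I (cv hrs)) (I (cv hss)),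
      ← integral_sub ((I (cv hrs)).fun_add (I (cv hss))) (I cW)]
    congr 1
    funext x
    ring
  rw [e4, e5]
  linarith

/-- Undoing the conjugation by `e^g` costs only constants. -/
theorem normSq_le_conjugated (hΩ : IsOpen Ω) (hb : Bornology.IsBounded Ω)
    {g : EuclideanSpace ℝ (Fin (m + 1)) → ℝ} (hg : ContDiff ℝ ∞ g) {h M G : ℝ} (h0 : 0 < h)
    (h1 : h ≤ 1) (hM : ∀ x ∈ closure Ω, |g x| ≤ M) (hG : ∀ x ∈ closure Ω, gradDot g g x ≤ G)
    (hG0 : 0 ≤ G) {u : EuclideanSpace ℝ (Fin (m + 1)) → ℂ} (hu : ContDiff ℝ ∞ u)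
    {r s : EuclideanSpace ℝ (Fin (m + 1)) → ℝ} (hr : r = fun y => Real.exp (g y) * (u y).re)
    (hs : s = fun y => Real.exp (g y) * (u y).im) :
    normSqL2 Ω u + ∑ j, normSqL2 Ω (semiD h j u) ≤ Real.exp M ^ 2 * (2 + 2 * G) *
      ∫ x in Ω, (h ^ 2 * (gradDot r r x + gradDot s s x) + (r x ^ 2 + s x ^ 2)) := by
  have hrs : ContDiff ℝ ∞ r := by rw [hr]; exact contDiff_exp_mul hg (re_smooth hu)
  have hss : ContDiff ℝ ∞ s := by rw [hs]; exact contDiff_exp_mul hg (im_smooth hu)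
  have hre := re_smooth hu
  have him := im_smooth hu
  have I : ∀ {f : EuclideanSpace ℝ (Fin (m + 1)) → ℝ}, ContDiff ℝ ∞ f → IntegrableOn f Ω :=
    fun hf => integrableOn_of_isBounded hb hf.continuous
  set a : EuclideanSpace ℝ (Fin (m + 1)) → ℝ := fun y => (u y).re with ha
  set b : EuclideanSpace ℝ (Fin (m + 1)) → ℝ := fun y => (u y).im with hb'
  -- each of the real functions `f = e^{-g} k` separately
  have key : ∀ (f k : EuclideanSpace ℝ (Fin (m + 1)) → ℝ), ContDiff ℝ ∞ f →
      (k = fun y => Real.exp (g y) * f y) → ∀ x ∈ closure Ω,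
      f x ^ 2 ≤ Real.exp M ^ 2 * k x ^ 2 ∧
      gradDot f f x ≤ Real.exp M ^ 2 * (2 * gradDot k k x + 2 * G * k x ^ 2) := by
    intro f k hf hk x hx
    have hks : ContDiff ℝ ∞ k := by rw [hk]; exact contDiff_exp_mul hg hf
    have hfk : f = fun y => Real.exp (-g y) * k y := by
      funext y
      rw [hk, ← mul_assoc, ← Real.exp_add]
      simp
    have he : Real.exp (-g x) ≤ Real.exp M := Real.exp_le_exp.2 (by
      have := (abs_le.1 (hM x hx)).1; linarith)
    have he2 : Real.exp (-g x) ^ 2 ≤ Real.exp M ^ 2 :=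
      pow_le_pow_left₀ (Real.exp_pos _).le he 2
    constructor
    · rw [hfk, mul_pow]
      exact mul_le_mul_of_nonneg_right he2 (sq_nonneg _)
    · have hd : ∀ j, dirDeriv (basisVec j) f x = Real.exp (-g x) *
          (dirDeriv (basisVec j) k x - dirDeriv (basisVec j) g x * k x) := by
        intro j
        have hneg : dirDeriv (basisVec j) (fun y => -g y) x = -dirDeriv (basisVec j) g x := by
          simp [dirDeriv, fderiv_fun_neg]
        rw [hfk, dirDeriv_exp_mul hg.neg hks, hneg]
        ring
      have hle : gradDot f f x ≤
          Real.exp (-g x) ^ 2 * (2 * gradDot k k x + 2 * gradDot g g x * k x ^ 2) := by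
        simp only [gradDot, hd, Finset.mul_sum, Finset.sum_mul, ← Finset.sum_add_distrib]
        refine Finset.sum_le_sum fun j _ => ?_
        have := mul_nonneg (sq_nonneg (Real.exp (-g x)))
          (sq_nonneg (dirDeriv (basisVec j) k x + dirDeriv (basisVec j) g x * k x))
        nlinarith
      have hgG := mul_le_mul_of_nonneg_right (hG x hx) (sq_nonneg (k x))
      have hkk := gradDot_self_nonneg k x
      refine hle.trans (mul_le_mul he2 (by linarith) ?_ (by positivity))
      have := gradDot_self_nonneg g x
      positivity
  have hnorm : normSqL2 Ω u + ∑ j, normSqL2 Ω (semiD h j u) =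
      ∫ x in Ω, ((a x ^ 2 + b x ^ 2) + h ^ 2 * (gradDot a a x + gradDot b b x)) := by
    have c1 : ContDiff ℝ ∞ (fun x => a x ^ 2 + b x ^ 2) := (hre.pow 2).add (him.pow 2)
    have c2 : ∀ j : Fin (m + 1), ContDiff ℝ ∞ (fun x => h ^ 2 * (dirDeriv (basisVec j) a x ^ 2
        + dirDeriv (basisVec j) b x ^ 2)) := fun j => contDiff_const.mul
      (((dirDeriv_smooth hre _).pow 2).add ((dirDeriv_smooth him _).pow 2))
    have s1 : normSqL2 Ω u = ∫ x in Ω, (a x ^ 2 + b x ^ 2) := by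
      refine integral_congr_ae (Eventually.of_forall fun x => ?_)
      simp only [Complex.sq_norm, Complex.normSq_apply, ha, hb']
      ring
    have s2 : ∀ j, normSqL2 Ω (semiD h j u) = ∫ x in Ω, h ^ 2 * (dirDeriv (basisVec j) a x ^ 2
        + dirDeriv (basisVec j) b x ^ 2) := fun j => by
      simp only [normSqL2, norm_semiD_sq hu, ha, hb']
    rw [s1, Finset.sum_congr rfl fun j _ => s2 j, ← integral_finsetSum _ fun j _ => I (c2 j),
      ← integral_add (I c1) (integrable_finsetSum _ fun j _ => I (c2 j))]
    congr 1
    funext x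
    simp only [gradDot, ← Finset.mul_sum, Finset.sum_add_distrib, sq]
  rw [hnorm, ← integral_const_mul]
  refine setIntegral_mono_on (I (((hre.pow 2).add (him.pow 2)).add (contDiff_const.mul
    ((gradDot_smooth hre hre).add (gradDot_smooth him him)))))
    (I (contDiff_const.mul ((contDiff_const.mul ((gradDot_smooth hrs hrs).add
      (gradDot_smooth hss hss))).add ((hrs.pow 2).add (hss.pow 2))))) hΩ.measurableSet
    fun x hx => ?_
  obtain ⟨ka, kga⟩ := key a r hre hr x (subset_closure hx)
  obtain ⟨kb, kgb⟩ := key b s him hs x (subset_closure hx)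
  have hh : h ^ 2 ≤ 1 := pow_le_one₀ h0.le h1
  have t1 := mul_le_mul_of_nonneg_left (add_le_add kga kgb) (sq_nonneg h)
  have t2 := mul_le_mul_of_nonneg_right hh
    (by positivity : 0 ≤ Real.exp M ^ 2 * (2 * G) * (r x ^ 2 + s x ^ 2))
  have t3 : 0 ≤ Real.exp M ^ 2 * (2 * G) * (h ^ 2 * (gradDot r r x + gradDot s s x)) := by
    have := gradDot_self_nonneg r x
    have := gradDot_self_nonneg s x
    positivity
  have t4 : 0 ≤ Real.exp M ^ 2 * (r x ^ 2 + s x ^ 2) := by positivity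
  linear_combination ka + kb + t1 + t2 + t3 + t4

theorem measurableSet_inter_preimage_of_continuousOn {X Y : Type*} [TopologicalSpace X]
    [MeasurableSpace X] [OpensMeasurableSpace X] [TopologicalSpace Y] {f : X → Y} {K : Set X}
    (hf : ContinuousOn f K) (hK : MeasurableSet K) {t : Set Y} (ht : IsOpen t) :
    MeasurableSet (K ∩ f ⁻¹' t) := by
  obtain ⟨U, hU, h⟩ := continuousOn_iff'.1 hf t ht
  rw [inter_comm, h]
  exact hU.measurableSet.inter hK

/-- The signed boundary term, estimated by the boundary integrals over `∂Ω₊` and `∂Ω₋`. The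
measure `σ` need only be comparable to the surface measure, since the two signs are treated
separately. -/
theorem boundary_comparison (hb : Bornology.IsBounded Ω) (hσ : IsBoundaryMeasure Ω σ)
    {C : NNReal} (hle : σ ≤ C • (surfaceMeasure (m + 1)).restrict (frontier Ω))
    (hge : (surfaceMeasure (m + 1)).restrict (frontier Ω) ≤ C • σ)
    {g ψ : EuclideanSpace ℝ (Fin (m + 1)) → ℝ} (hg : ContDiff ℝ ∞ g) (hψ : ContDiff ℝ ∞ ψ) {M : ℝ}
    (hM : ∀ x ∈ closure Ω, |g x| ≤ M) {u : EuclideanSpace ℝ (Fin (m + 1)) → ℂ}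
    (hu : ContDiff ℝ ∞ u) (hu0 : ∀ x ∈ frontier Ω, u x = 0)
    {r s : EuclideanSpace ℝ (Fin (m + 1)) → ℝ} (hr : r = fun y => Real.exp (g y) * (u y).re)
    (hs : s = fun y => Real.exp (g y) * (u y).im) :
    ∃ S : ℝ, 0 ≤ S ∧ boundaryForm Ω (boundaryMinus Ω ψ) ψ u ≤ C * S ∧
      ∫ x, normalDeriv Ω ψ x * (normalDeriv Ω r x ^ 2 + normalDeriv Ω s x ^ 2) ∂σ ≤
        Real.exp M ^ 2 * (C * boundaryForm Ω (boundaryPlus Ω ψ) ψ u)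
          - (Real.exp M ^ 2)⁻¹ * S := by
  have hνc := hσ.normal_continuousOn
  have hψc := continuousOn_normalDeriv hνc hψ
  have huc := continuousOn_normalDeriv hνc hu
  have hKm : MeasurableSet (frontier Ω) := isClosed_frontier.measurableSet
  have hPm : MeasurableSet (boundaryPlus Ω ψ) :=
    measurableSet_inter_preimage_of_continuousOn hψc hKm isOpen_Ioi
  have hNm : MeasurableSet (boundaryMinus Ω ψ) :=
    measurableSet_inter_preimage_of_continuousOn hψc hKm isOpen_Iio
  set F : EuclideanSpace ℝ (Fin (m + 1)) → ℝ := fun x =>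
    |normalDeriv Ω ψ x| * ‖normalDeriv Ω u x‖ ^ 2 with hF
  have hF0 : ∀ x, 0 ≤ F x := fun x => by positivity
  have hFc : ContinuousOn F (frontier Ω) := hψc.abs.mul (huc.norm.pow 2)
  have hFσ : Integrable F σ := hσ.integrable hb hFc
  have hFC : Integrable F (C • σ) := hFσ.smul_measure ENNReal.coe_ne_top
  have hFS : Integrable F ((surfaceMeasure (m + 1)).restrict (frontier Ω)) :=
    hFC.mono_measure hge
  have hFCS : Integrable F (C • (surfaceMeasure (m + 1)).restrict (frontier Ω)) :=
    hFS.smul_measure ENNReal.coe_ne_top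
  have hsub : ∀ {A}, A ⊆ frontier Ω → boundaryForm Ω A ψ u =
      ∫ x in A, F x ∂(surfaceMeasure (m + 1)).restrict (frontier Ω) := fun {A} hA => by
    rw [boundaryForm, Measure.restrict_restrict_of_subset hA]
  have hplus : ∫ x in boundaryPlus Ω ψ, F x ∂σ ≤ C * boundaryForm Ω (boundaryPlus Ω ψ) ψ u := by
    rw [hsub fun x hx => hx.1]
    calc ∫ x in boundaryPlus Ω ψ, F x ∂σ
        ≤ ∫ x in boundaryPlus Ω ψ, F x ∂(C • (surfaceMeasure (m + 1)).restrict (frontier Ω)) :=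
          integral_mono_measure (Measure.restrict_mono le_rfl hle)
            (Eventually.of_forall hF0) hFCS.integrableOn
      _ = _ := by
          rw [Measure.restrict_smul, integral_smul_nnreal_measure]; rfl
  have hminus : boundaryForm Ω (boundaryMinus Ω ψ) ψ u ≤ C * ∫ x in boundaryMinus Ω ψ, F x ∂σ := by
    rw [hsub fun x hx => hx.1]
    calc ∫ x in boundaryMinus Ω ψ, F x ∂(surfaceMeasure (m + 1)).restrict (frontier Ω)
        ≤ ∫ x in boundaryMinus Ω ψ, F x ∂(C • σ) :=
          integral_mono_measure (Measure.restrict_mono le_rfl hge)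
            (Eventually.of_forall hF0) hFC.integrableOn
      _ = _ := by
          rw [Measure.restrict_smul, integral_smul_nnreal_measure]; rfl
  refine ⟨∫ x in boundaryMinus Ω ψ, F x ∂σ, integral_nonneg hF0, hminus, ?_⟩
  have hrs : ContDiff ℝ ∞ r := by rw [hr]; exact contDiff_exp_mul hg (re_smooth hu)
  have hss : ContDiff ℝ ∞ s := by rw [hs]; exact contDiff_exp_mul hg (im_smooth hu)
  have hnd : ∀ x ∈ frontier Ω, normalDeriv Ω r x ^ 2 + normalDeriv Ω s x ^ 2 =
      Real.exp (g x) ^ 2 * ‖normalDeriv Ω u x‖ ^ 2 := by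
    intro x hx
    have h1 : ∀ f : EuclideanSpace ℝ (Fin (m + 1)) → ℝ, ContDiff ℝ ∞ f → f x = 0 →
        normalDeriv Ω (fun y => Real.exp (g y) * f y) x = Real.exp (g x) * normalDeriv Ω f x := by
      intro f hf hf0
      have := dirDeriv_exp_mul hg hf (outerNormal Ω x) x
      rw [hf0, mul_zero, add_zero] at this
      exact this
    rw [norm_normalDeriv_sq hu, hr, hs, h1 _ (re_smooth hu) (by rw [hu0 x hx]; rfl),
      h1 _ (im_smooth hu) (by rw [hu0 x hx]; rfl)]
    ring
  have hint : Integrable (fun x => normalDeriv Ω ψ x *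
      (normalDeriv Ω r x ^ 2 + normalDeriv Ω s x ^ 2)) σ :=
    hσ.integrable hb (hψc.mul (((continuousOn_normalDeriv hνc hrs).pow 2).add
      ((continuousOn_normalDeriv hνc hss).pow 2)))
  have hkey : ∫ x, normalDeriv Ω ψ x * (normalDeriv Ω r x ^ 2 + normalDeriv Ω s x ^ 2) ∂σ ≤
      Real.exp M ^ 2 * (∫ x in boundaryPlus Ω ψ, F x ∂σ)
        - (Real.exp M ^ 2)⁻¹ * ∫ x in boundaryMinus Ω ψ, F x ∂σ := by
    rw [← integral_indicator hPm, ← integral_indicator hNm, ← integral_const_mul,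
      ← integral_const_mul, ← integral_sub ((hFσ.indicator hPm).const_mul _)
      ((hFσ.indicator hNm).const_mul _)]
    refine integral_mono_ae hint (((hFσ.indicator hPm).const_mul _).sub
      ((hFσ.indicator hNm).const_mul _)) ?_
    filter_upwards [hσ.ae_mem] with x hx
    have hxM := abs_le.1 (hM x (frontier_subset_closure hx))
    have hupp : Real.exp (g x) ^ 2 ≤ Real.exp M ^ 2 :=
      pow_le_pow_left₀ (Real.exp_pos _).le (Real.exp_le_exp.2 hxM.2) 2
    have hlow : (Real.exp M ^ 2)⁻¹ ≤ Real.exp (g x) ^ 2 := by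
      rw [← inv_pow, ← Real.exp_neg]
      exact pow_le_pow_left₀ (Real.exp_pos _).le (Real.exp_le_exp.2 hxM.1) 2
    rw [hnd x hx]
    rcases lt_trichotomy (normalDeriv Ω ψ x) 0 with hneg | hzero | hpos
    · have hN : x ∈ boundaryMinus Ω ψ := ⟨hx, hneg⟩
      have hP : x ∉ boundaryPlus Ω ψ := fun h => absurd h.2 (not_lt.2 hneg.le)
      rw [indicator_of_mem hN, indicator_of_notMem hP]
      have h1 : normalDeriv Ω ψ x * (Real.exp (g x) ^ 2 * ‖normalDeriv Ω u x‖ ^ 2) =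
          -(Real.exp (g x) ^ 2 * F x) := by
        simp only [hF, abs_of_neg hneg]; ring
      rw [h1]
      have := mul_le_mul_of_nonneg_right hlow (hF0 x)
      linarith
    · have hN : x ∉ boundaryMinus Ω ψ := fun h => absurd h.2 (by rw [hzero]; exact lt_irrefl _)
      have hP : x ∉ boundaryPlus Ω ψ := fun h => absurd h.2 (by rw [hzero]; exact lt_irrefl _)
      rw [indicator_of_notMem hN, indicator_of_notMem hP, hzero]
      simp
    · have hP : x ∈ boundaryPlus Ω ψ := ⟨hx, hpos⟩
      have hN : x ∉ boundaryMinus Ω ψ := fun h => absurd h.2 (not_lt.2 hpos.le)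
      rw [indicator_of_notMem hN, indicator_of_mem hP]
      have h1 : normalDeriv Ω ψ x * (Real.exp (g x) ^ 2 * ‖normalDeriv Ω u x‖ ^ 2) =
          Real.exp (g x) ^ 2 * F x := by
        simp only [hF, abs_of_pos hpos]; ring
      rw [h1]
      have := mul_le_mul_of_nonneg_right hupp (hF0 x)
      linarith
  exact hkey.trans (sub_le_sub_right (mul_le_mul_of_nonneg_left hplus (by positivity)) _)

end Estimates

end CarlemanBoundary

end

open CarlemanBoundary in
/-- Carleman estimate with boundary terms. Functions in `C^∞` of the closure of `Ω` are the
restrictions of smooth functions on `ℝⁿ`; only their values on the closure matter below. -/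
theorem proposition4p1 (n : ℕ) (hn : 2 ≤ n) (Ω : Set (EuclideanSpace ℝ (Fin n)))
    (hΩ_open : IsOpen Ω) (hΩ_bdd : Bornology.IsBounded Ω) (hΩ_smooth : HasSmoothBoundary Ω)
    (α : EuclideanSpace ℝ (Fin n)) (hα : ‖α‖ = 1)
    (κ : EuclideanSpace ℝ (Fin n) → ℝ) (hκ : ContDiff ℝ ∞ κ)
    (hκν : ∀ x ∈ frontier Ω, normalDeriv Ω κ x = -1)
    (q : EuclideanSpace ℝ (Fin n) → ℂ) (hq : MemLp q ⊤ (volume.restrict Ω)) :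
    ∃ ε C₀ h₀ : ℝ, 0 < ε ∧ 0 < C₀ ∧ 0 < h₀ ∧ h₀ ≤ ε ∧ ε ≤ 1 ∧
      ∀ h : ℝ, 0 < h → h ≤ h₀ →
        ∀ u : EuclideanSpace ℝ (Fin n) → ℂ, ContDiff ℝ ∞ u → (∀ x ∈ frontier Ω, u x = 0) →
          h ^ 3 / C₀ * boundaryForm Ω (boundaryMinus Ω (convexifiedWeight α κ ε h))
              (convexifiedWeight α κ ε h) u
            + h ^ 2 / C₀ * (normSqL2 Ω u + ∑ j, normSqL2 Ω (semiD h j u))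
          ≤ normSqL2 Ω (conjugatedOp h (linearWeight α) q u)
            + h ^ 3 * boundaryForm Ω (boundaryPlus Ω (convexifiedWeight α κ ε h))
              (convexifiedWeight α κ ε h) u := by
  obtain ⟨m, rfl⟩ : ∃ m, n = m + 1 := ⟨n - 1, by omega⟩
  obtain ⟨hνc, σ, C, hfin, hle, hge, hdiv⟩ :=
    exists_boundaryMeasure hΩ_open hΩ_bdd hΩ_smooth
  have hσ : IsBoundaryMeasure Ω σ := ⟨hfin,
    ((Measure.absolutelyContinuous_of_le hle).trans Measure.smul_absolutelyContinuous).ae_le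
      (ae_restrict_mem isClosed_frontier.measurableSet), hνc, hdiv⟩
  obtain ⟨Q, hQ⟩ : ∃ Q : ℝ, ∀ᵐ x ∂(volume.restrict Ω), ‖q x‖ ≤ Q := by
    have hlt : eLpNormEssSup q (volume.restrict Ω) < ⊤ := by
      rw [← eLpNorm_exponent_top]; exact hq.2
    refine ⟨(eLpNormEssSup q (volume.restrict Ω)).toReal, ?_⟩
    filter_upwards [ae_le_eLpNormEssSup (f := q) (μ := volume.restrict Ω)] with x hx
    rw [← toReal_enorm]
    exact ENNReal.toReal_mono hlt.ne hx
  obtain ⟨ε, h₀, hε, hh₀, hh₀ε, hε1, hreal⟩ := exists_carleman_real hΩ_open hΩ_bdd hΩ_smooth hσ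
    hα hκ (by positivity : 0 ≤ 2 * Q ^ 2)
  have hg := weightCorrection_smooth (α := α) (ε := ε) hκ
  obtain ⟨M, hM0, hM⟩ := exists_bound_on_closure hΩ_bdd hg.continuous
  obtain ⟨G, hG0, hG⟩ := exists_bound_on_closure hΩ_bdd (gradDot_smooth hg hg).continuous
  have hG' : ∀ x ∈ closure Ω, gradDot (weightCorrection α κ ε) (weightCorrection α κ ε) x ≤ G :=
    fun x hx => (le_abs_self _).trans (hG x hx)
  set T := Real.exp M ^ 2 with hT
  have hT0 : 0 < T := by positivity
  have hC0 : (0 : ℝ) ≤ C := C.2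
  -- `D` bounds the left side by the left side for `e^g u`, and `2T + 2TC` collects the constants of
  -- the right side; the coefficients there become `1` on division by their product
  set D := C * T + T * (2 + 2 * G) with hD
  have hD0 : 0 < D := by positivity
  refine ⟨ε, D * (2 * T + 2 * T * C), h₀, hε, by positivity, hh₀, hh₀ε, hε1, ?_⟩
  intro h h0 hh u hu hu0
  have h1 : h ≤ 1 := hh.trans (hh₀ε.trans hε1)
  obtain ⟨r, hr⟩ : ∃ r : EuclideanSpace ℝ (Fin (m + 1)) → ℝ,
    r = fun y => Real.exp (weightCorrection α κ ε y) * (u y).re := ⟨_, rfl⟩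
  obtain ⟨s, hs⟩ : ∃ s : EuclideanSpace ℝ (Fin (m + 1)) → ℝ,
    s = fun y => Real.exp (weightCorrection α κ ε y) * (u y).im := ⟨_, rfl⟩
  have e1 := carleman_complex hΩ_open hΩ_bdd hκ hq.1 hQ h0 h1 hM hσ (hreal h h0 hh) hu hu0 hr hs
  have e2 := normSq_le_conjugated hΩ_open hΩ_bdd hg h0 h1 hM hG' hG0 hu hr hs
  obtain ⟨S, hS, e3, e4⟩ := boundary_comparison hΩ_bdd hσ hle hge hg
    (convexifiedWeight_smooth (α := α) (ε := ε) (h := h) hκ) hM hu hu0 hr hs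
  rw [← hT] at e1 e2 e4
  have hBp : 0 ≤ boundaryForm Ω (boundaryPlus Ω (convexifiedWeight α κ ε h))
      (convexifiedWeight α κ ε h) u := integral_nonneg fun x => by positivity
  have hN : 0 ≤ normSqL2 Ω (conjugatedOp h (linearWeight α) q u) :=
    integral_nonneg fun x => by positivity
  have hI : 0 ≤ ∫ x in Ω, (h ^ 2 * (gradDot r r x + gradDot s s x) + (r x ^ 2 + s x ^ 2)) :=
    integral_nonneg fun x => add_nonneg (mul_nonneg (sq_nonneg h)
      (add_nonneg (gradDot_self_nonneg _ x) (gradDot_self_nonneg _ x))) (by positivity)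
  set Bm := boundaryForm Ω (boundaryMinus Ω (convexifiedWeight α κ ε h))
    (convexifiedWeight α κ ε h) u
  set Bp := boundaryForm Ω (boundaryPlus Ω (convexifiedWeight α κ ε h))
    (convexifiedWeight α κ ε h) u
  set N := normSqL2 Ω (conjugatedOp h (linearWeight α) q u)
  set U := normSqL2 Ω u + ∑ j, normSqL2 Ω (semiD h j u)
  set W := ∫ x in Ω, (h ^ 2 * (gradDot r r x + gradDot s s x) + (r x ^ 2 + s x ^ 2))
  have f1 : h ^ 2 * W + 2 * h ^ 3 * (T⁻¹ * S) ≤ 2 * T * N + 2 * h ^ 3 * (T * (C * Bp)) := by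
    have := mul_le_mul_of_nonneg_left e4 (by positivity : 0 ≤ 2 * h ^ 3)
    linarith
  have f2 : h ^ 3 * Bm + h ^ 2 * U ≤ D * (h ^ 2 * W + 2 * h ^ 3 * (T⁻¹ * S)) := by
    have a1 := mul_le_mul_of_nonneg_left e3 (by positivity : 0 ≤ h ^ 3)
    have a2 := mul_le_mul_of_nonneg_left e2 (by positivity : 0 ≤ h ^ 2)
    have a3 : 0 ≤ C * T * (h ^ 2 * W) := by positivity
    have a4 : 0 ≤ T * (2 + 2 * G) * (2 * h ^ 3 * (T⁻¹ * S)) := by positivity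
    have a5 : C * T * (2 * h ^ 3 * (T⁻¹ * S)) = 2 * (h ^ 3 * (C * S)) := by field_simp
    have a6 : 0 ≤ h ^ 3 * (C * S) := by positivity
    rw [hD]
    linarith
  have f3 : 2 * T * N + 2 * h ^ 3 * (T * (C * Bp)) ≤ (2 * T + 2 * T * C) * (N + h ^ 3 * Bp) := by
    have b1 : 0 ≤ 2 * T * C * N := by positivity
    have b2 : 0 ≤ 2 * T * (h ^ 3 * Bp) := by positivity
    linarith
  rw [div_mul_eq_mul_div, div_mul_eq_mul_div, ← add_div, div_le_iff₀ (by positivity)]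
  calc h ^ 3 * Bm + h ^ 2 * U ≤ D * ((2 * T + 2 * T * C) * (N + h ^ 3 * Bp)) :=
        f2.trans (mul_le_mul_of_nonneg_left (f1.trans f3) hD0.le)
    _ = _ := by ring
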